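/- **Setting.** Let $d\ge 1$ and $N\ge 2$ be integers. Let $\Sigma_n=\{1,\dots,N\}^n$, let $\Sigma_*=\bigcup_{n\ge 0}\Sigma_n$ be the set of finite words (with empty word $\varnothing$), and for a word $\mathtt i=i_1\cdots i_n$ and $m\le n$ write $\mathtt i|_m=i_1\cdots i_m$. Let $t_1,\dots,t_N\in\mathbb R^d$ be points such that for every coordinate $k\in\{1,\dots,d\}$ the $k$th coordinates of $t_1,\dots,t_N$ are not all equal. Fix $0<\underline\alpha\le\overline\alpha<1$. Let $(\Omega,\mathcal F,\mathbb P)$ be a probability space and let $\alpha_{\mathtt i}^{(k)}$, $\mathtt i\in\Sigma_*\setminus\{\varnothing\}$, $k\in\{1,\dots,d\}$, be real random variables such that * (R1) the random vectors $(\alpha_{\mathtt i1}^{(\ell)},\dots,\alpha_{\mathtt iN}^{(\ell)})$, $\mathtt i\in\Sigma_*$, $\ell\in\{1,\dots,d\}$, are independent; * (R2) for every $\ell\in\{1,\dots,d\}$ the random vectors $(\alpha_{\mathtt i1}^{(\ell)},\dots,\alpha_{\mathtt iN}^{(\ell)})$, $\mathtt i\in\Sigma_*$, are identically distributed; * (R3)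 $|\alpha_{\mathtt i}^{(k)}|\in[\underline\alpha,\overline\alpha]$ almost surely for all $\mathtt i\neq\varnothing$ and all $k$; * (R4) for every $k\in\{1,\dots,d\}$ there is $\ell_k\in\{1,\dots,N\}$ such that the distribution $\mu$ of $\log|\alpha_{\ell_k}^{(k)}|$ is eventually smooth, i.e. for some $n\ge1$ the $n$-fold convolution $\mu^{*n}$ is absolutely continuous with respect to Lebesgue measure with a continuous density. Put $A_\varnothing=I$ and $A_{\mathtt i}=\operatorname{diag}(\alpha_{\mathtt i}^{(1)},\dots,\alpha_{\mathtt i}^{(d)})$ for $\mathtt i\ne\varnothing$. Let $f_\varnothing$ be the identity, and for $\mathtt i=i_1\cdots i_n$ with $n\ge1$ let $f_{\mathtt i}(x)=A_{\mathtt i}x+(I-A_{\mathtt i})t_{i_n}$, a random affine map fixing $t_{i_n}$. Let $B\subset\mathbb R^d$ be a non-empty compact set such that almost surely $f_{\mathtt i}(B)\subseteq B$ for all $\mathtt i\in\Sigma_*$ (such sets exist, for instance large cubes centred at the origin), and let $$X=\bigcap_{n=0}^\infty\ \bigcup_{\mathtt i\in\Sigma_n} f_{\mathtt i|_0}\circ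 f_{\mathtt i|_1}\circ\cdots\circ f_{\mathtt i|_n}(B)$$ be the self-affine sponge with random contractions. For a permutation $\sigma$ of $\{1,\dots,d\}$, $s\ge0$ and $A=\operatorname{diag}(a_1,\dots,a_d)$ let $$\varphi_\sigma^s(A)=\begin{cases}|a_{\sigma(1)}|\cdots|a_{\sigma(\lfloor s\rfloor)}|\,|a_{\sigma(\lceil s\rceil)}|^{s-\lfloor s\rfloor},&0\le s\le d,\\ (|a_{\sigma(1)}|\cdots|a_{\sigma(d)}|)^{s/d},&s>d,\end{cases}$$ with $\varphi_\sigma^0(A)=1$. **Theorem.** There is a unique real number $s_0\ge0$ with $$\max_\sigma\sum_{i=1}^N\mathbb E\,\varphi_\sigma^{s_0}(A_i)=1,$$ the maximum being over all permutations $\sigma$ of $\{1,\dots,d\}$. Almost surely, the Minkowski dimension $\dim_M X$ exists (as the limit, as $r\downarrow0$, of $\log N_r(X)/(-\log r)$, where $N_r(X)$ is the least number of closed balls of radius $r$ that cover $X$), and $$\dim_H X=\dim_M X=\min\{d,s_0\},$$ where $\dim_H$ denotes the Hausdorff dimension. Moreover, if $s_0>d$, then the $d$-dimensional Lebesgue measure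 of $X$ is positive almost surely. -/

import Mathlib

open MeasureTheory ProbabilityTheory Filter Topology

noncomputable section

namespace RandomSponge

/-- The `n`-fold convolution `μ ∗ ⋯ ∗ μ` of a measure on the line (a unit mass at `0` for `n = 0`). -/
def convPow (μ : Measure ℝ) : ℕ → Measure ℝ
  | 0 => Measure.dirac 0
  | n + 1 => (convPow μ n).conv μ

/-- A distribution on the line is eventually smooth if some convolution power `μ^{∗n}`, `n ≥ 1`,
is absolutely continuous with respect to Lebesgue measure, with a continuous density. -/
def EventuallySmooth (μ : Measure ℝ) : Prop :=
  ∃ n : ℕ, 1 ≤ n ∧ ∃ g : ℝ → ℝ, Continuous g ∧ (∀ x, 0 ≤ g x) ∧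
    convPow μ n = volume.withDensity (fun x => ENNReal.ofReal (g x))

/-- The number `N_r(S)` of closed balls of radius `r` (centred anywhere) needed to cover `S`. -/
def ballCoverNumber {d : ℕ} (r : ℝ) (S : Set (EuclideanSpace ℝ (Fin d))) : ℕ :=
  (Metric.externalCoveringNumber r.toNNReal S).toNat

/-- `S` is bounded, its Minkowski dimension exists (as a limit), and it equals `s`. -/
def HasMinkowskiDim {d : ℕ} (S : Set (EuclideanSpace ℝ (Fin d))) (s : ℝ) : Prop :=
  Bornology.IsBounded S ∧
    Tendsto (fun r : ℝ => Real.log (ballCoverNumber r S) / (-Real.log r)) (𝓝[>] 0) (𝓝 s)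

/-- The function `φ_σ^s(diag(a))`, `s ≥ 0`:
`|a_{σ(1)}| ⋯ |a_{σ(⌊s⌋)}| |a_{σ(⌈s⌉)}|^{s - ⌊s⌋}` for `s ≤ d` and
`(|a_{σ(1)}| ⋯ |a_{σ(d)}|)^{s/d}` for `s > d`. The index `k : Fin d` stands for `k + 1`; the last
factor of the first case is absent for `s = 0`. -/
def permSVF {d : ℕ} (σ : Equiv.Perm (Fin d)) (s : ℝ) (a : Fin d → ℝ) : ℝ :=
  if s ≤ d then
    (∏ k : Fin d with k.val + 1 ≤ ⌊s⌋₊, |a (σ k)|) *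
      ∏ k : Fin d with k.val + 1 = ⌈s⌉₊, |a (σ k)| ^ (s - (⌊s⌋₊ : ℝ))
  else
    (∏ k : Fin d, |a (σ k)|) ^ (s / (d : ℝ))

section Sponge

variable {N d : ℕ} {Ω : Type*}

/-- The random diagonal matrix `A_w = diag(α_w^{(1)}, …, α_w^{(d)})` attached to a finite word `w`,
with `A_∅ = I`. -/
def diagMatrix (α : List (Fin N) → Fin d → Ω → ℝ) (ω : Ω) (w : List (Fin N)) :
    Matrix (Fin d) (Fin d) ℝ :=
  if w = [] then 1 else Matrix.diagonal (fun k => α w k ω)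

/-- The point `t_i`, where `i` is the last letter of `w` (irrelevant for the empty word). -/
def lastPoint (t : Fin N → EuclideanSpace ℝ (Fin d)) (w : List (Fin N)) :
    EuclideanSpace ℝ (Fin d) :=
  w.getLast?.elim 0 t

/-- The random affine map `f_w(x) = A_w x + (I - A_w) t_i`, where `i` is the last letter of `w`. -/
def affMap (t : Fin N → EuclideanSpace ℝ (Fin d)) (α : List (Fin N) → Fin d → Ω → ℝ) (ω : Ω)
    (w : List (Fin N)) (x : EuclideanSpace ℝ (Fin d)) : EuclideanSpace ℝ (Fin d) :=
  Matrix.toEuclideanLin (diagMatrix α ω w) x +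
    Matrix.toEuclideanLin (1 - diagMatrix α ω w) (lastPoint t w)

/-- The composition `f_{w|_0} ∘ f_{w|_1} ∘ ⋯ ∘ f_{w|_n}` along the prefixes `w|_m` of `w`. -/
def prefixComp (t : Fin N → EuclideanSpace ℝ (Fin d)) (α : List (Fin N) → Fin d → Ω → ℝ) (ω : Ω)
    (w : List (Fin N)) : ℕ → EuclideanSpace ℝ (Fin d) → EuclideanSpace ℝ (Fin d)
  | 0 => affMap t α ω []
  | n + 1 => prefixComp t α ω w n ∘ affMap t α ω (w.take (n + 1))

/-- The random set `X = ⋂_n ⋃_{|w| = n} f_{w|_0} ∘ ⋯ ∘ f_{w|_n}(B)`. -/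
def sponge (t : Fin N → EuclideanSpace ℝ (Fin d)) (α : List (Fin N) → Fin d → Ω → ℝ)
    (B : Set (EuclideanSpace ℝ (Fin d))) (ω : Ω) : Set (EuclideanSpace ℝ (Fin d)) :=
  ⋂ n : ℕ, ⋃ w : List (Fin N), ⋃ _ : w.length = n, prefixComp t α ω w n '' B

/-- The quantity `max_σ ∑_i 𝔼 φ_σ^s(A_i)`, the maximum being over all permutations `σ` of the
coordinates and the sum over all words of length one. -/
def maxExpectedSVF [MeasurableSpace Ω] (P : Measure Ω) (α : List (Fin N) → Fin d → Ω → ℝ)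
    (s : ℝ) : ℝ :=
  Finset.univ.sup' Finset.univ_nonempty
    (fun σ : Equiv.Perm (Fin d) => ∑ i : Fin N, ∫ ω, permSVF σ s (fun k => α [i] k ω) ∂P)

end Sponge

end RandomSponge

end

/-!
The numbers `α_w^{(k)}` are ratios on the tree of words, independent along branches and between
coordinates. The product of the ratios of the coordinate `k` along the word `w` is, up to a constant,
the `k`-th side of the cylinder coded by `w`, and
`∏ k, |side k| ^ p k` is a multiplicative weight with expectation `∏ j, 𝔼 ∏ k, |α_{w_j}^{(k)}| ^ p k`.
With the exponents `svfExponent`, permuted by `σ`, this weight is `φ_σ^s` of the cylinder, so that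
`∑ i, 𝔼 φ_σ^s(A_i)` decides whether the total weight of the words of length `n` grows or decays. This
sum decays in `s` at a rate between `log a` and `log b`, which gives the existence and uniqueness of
`s₀` (`exists_unique_maxExpectedSVF_eq_one`). The ratios are bounded only almost surely, but they
can be modified on a null set (`boundedRatio`).

*Upper bound.* For `s₀ < s ≤ d` every permutation has a subcritical sum, so almost surely
the sum of `φ_σ^s` over all cylinders converges. Cover the sponge at scale `r` by the cylinders that
are the first, along each branch, to have fewer than `⌈s⌉` sides longer than `r`; a cylinder of this kind is covered by at
most a constant times `r ^ (-s) φ_σ^s` balls, where `σ` sorts its sides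
(`exists_ballCoverNumber_le`). If `s₀ ≥ d`, boundedness is enough.

*Lower bound.* Let `σ` attain the maximum and lower the exponents slightly, so that they are below
one (or equal to one if `s₀ > d`) while the total weight of the words of length one exceeds one. The
weights then form a supercritical branching process, and the energy of the corresponding mass
distribution on the points coded by the words of length `n` has to be bounded. The kernel is a
product over the coordinates, which are independent, so the expected energy of a pair of words is a
product of one-dimensional expectations; no relation between the orders of the sides of the two
cylinders is needed. In one coordinate the words are made to contain a long run of a letter `l` with
eventually smooth logarithmic ratio: the logarithm of the product along the run has a bounded
density, and below the run stands a letter whose fixed point differs from that of `l`, hence the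
difference of the two points has a density bounded by a constant over the side of the common prefix
(`lintegral_weight_mul_kernel_le`, `exists_isSeparating`). Inserting one such word for each coordinate
after every long block costs a constant factor per block, which the block length absorbs
(`exists_blocks`). Summing over pairs gives a second moment comparable to the square of the first
(`lintegral_energy_le`); the second moment method shows that the normalized energy is bounded with
positive probability, and Kolmogorov's zero-one law, applied along a ray of the tree, makes this
almost sure below some word (`ae_frequently_energy_le`). Bounded energies with exponents below one
bound the Hausdorff dimension from below (`le_dimH_of_energy_le`), and with all exponents equal to
one they give positive volume (`volume_pos_of_energy_le`).
-/

namespace RandomSponge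

/-! ### Singular value functions as weighted products -/

/-- The exponent of the `k`-th factor (counted from `0`) of `φ_σ^s`; with it the two cases in the
definition of `permSVF` become the single formula `permSVF_eq_prod_rpow`. -/
noncomputable def svfExponent (d : ℕ) (s : ℝ) (k : ℕ) : ℝ :=
  max 0 (min (s - k) 1) + max (s / d - 1) 0

lemma permSVF_eq_prod_rpow {d : ℕ} (hd : 1 ≤ d) (σ : Equiv.Perm (Fin d)) {s : ℝ} (hs : 0 ≤ s)
    {a : Fin d → ℝ} (ha : ∀ k, 0 < |a k|) :
    permSVF σ s a = ∏ k : Fin d, |a (σ k)| ^ svfExponent d s k := by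
  have hd0 : (0 : ℝ) < d := by exact_mod_cast hd
  unfold permSVF svfExponent
  split_ifs with h
  · rw [Finset.prod_filter, Finset.prod_filter, ← Finset.prod_mul_distrib]
    refine Finset.prod_congr rfl fun k _ => ?_
    have h1 : max (s / d - 1) 0 = 0 := by
      apply max_eq_right
      have : s / d ≤ 1 := by rw [div_le_one hd0]; exact h
      linarith
    rw [h1, add_zero]
    have hfl := Nat.floor_le hs
    have hlt := Nat.lt_floor_add_one s
    have hcl := Nat.le_ceil s
    by_cases hk : k.val + 1 ≤ ⌊s⌋₊
    · have hk' : ((k.val : ℝ) + 1) ≤ s := by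
        have : ((k.val + 1 : ℕ) : ℝ) ≤ ⌊s⌋₊ := by exact_mod_cast hk
        push_cast at this; linarith
      rw [if_pos hk, min_eq_right (by linarith), max_eq_right zero_le_one, Real.rpow_one]
      split_ifs with hc
      · have h2 : ((k.val + 1 : ℕ) : ℝ) = ⌈s⌉₊ := by exact_mod_cast hc
        have h3 : ((k.val + 1 : ℕ) : ℝ) ≤ ⌊s⌋₊ := by exact_mod_cast hk
        have : s - ⌊s⌋₊ = 0 := by linarith
        rw [this, Real.rpow_zero, mul_one]
      · rw [mul_one]
    · rw [if_neg hk, one_mul]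
      push Not at hk
      have hk1 : (⌊s⌋₊ : ℝ) ≤ k.val := by exact_mod_cast Nat.lt_succ_iff.mp hk
      split_ifs with hc
      · have h4 : k.val < ⌈s⌉₊ := by omega
        have h5 : (k.val : ℝ) < s := Nat.lt_ceil.mp h4
        have h6 : k.val ≤ ⌊s⌋₊ := Nat.le_floor h5.le
        have h7 : (k.val : ℝ) = ⌊s⌋₊ := le_antisymm (by exact_mod_cast h6) hk1
        rw [h7, min_eq_left (by linarith), max_eq_right (by linarith)]
      · have h4 : ⌈s⌉₊ ≤ k.val := by
          have := Nat.ceil_le_floor_add_one s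
          omega
        have h5 : s ≤ k.val := Nat.ceil_le.mp h4
        rw [min_eq_left (by linarith), max_eq_left (by linarith), Real.rpow_zero]
  · push Not at h
    rw [← Real.finsetProd_rpow _ _ (fun k _ => (ha _).le)]
    refine Finset.prod_congr rfl fun k _ => ?_
    have hk : (k.val : ℝ) + 1 ≤ d := by exact_mod_cast k.2
    have h1 : 1 ≤ s / d := by rw [le_div_iff₀ hd0]; linarith
    rw [min_eq_right (by linarith), max_eq_right zero_le_one, max_eq_left (by linarith),
      add_sub_cancel]

lemma sum_clamp {s : ℝ} (hs : 0 ≤ s) (d : ℕ) :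
    ∑ k : Fin d, max 0 (min (s - k) 1) = min s d := by
  rw [Fin.sum_univ_eq_sum_range (fun k : ℕ => max 0 (min (s - k) 1)) d]
  have : ∀ k : ℕ, max 0 (min (s - k) 1) = min s ((k + 1 : ℕ) : ℝ) - min s (k : ℝ) := by
    intro k; push_cast
    rcases le_total s k with h | h
    · rw [min_eq_left h, min_eq_left (by linarith), min_eq_left (by linarith),
        max_eq_left (by linarith), sub_self]
    · rcases le_total s (k + 1) with h' | h'
      · rw [min_eq_left h', min_eq_right h, min_eq_left (by linarith), max_eq_right (by linarith)]
      · rw [min_eq_right h', min_eq_right h, min_eq_right (by linarith),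
          max_eq_right (by linarith)]
        ring
  simp_rw [this]
  rw [Finset.sum_range_sub (fun k : ℕ => min s (k : ℝ))]
  simp [hs]

lemma sum_svfExponent {d : ℕ} (hd : 1 ≤ d) {s : ℝ} (hs : 0 ≤ s) :
    ∑ k : Fin d, svfExponent d s k = s := by
  have hd0 : (0 : ℝ) < d := by exact_mod_cast hd
  unfold svfExponent
  rw [Finset.sum_add_distrib, sum_clamp hs, Finset.sum_const, Finset.card_univ, Fintype.card_fin,
    nsmul_eq_mul]
  rcases le_total s d with h | h
  · have : s / d ≤ 1 := by rw [div_le_one hd0]; exact h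
    rw [min_eq_left h, max_eq_right (by linarith)]; ring
  · have : 1 ≤ s / d := by rw [le_div_iff₀ hd0]; linarith
    rw [min_eq_right h, max_eq_left (by linarith)]; field_simp; ring

lemma svfExponent_mono (d : ℕ) {s s' : ℝ} (h : s ≤ s') (k : ℕ) :
    svfExponent d s k ≤ svfExponent d s' k := by
  unfold svfExponent
  gcongr

lemma svfExponent_nonneg (d : ℕ) (s : ℝ) (k : ℕ) : 0 ≤ svfExponent d s k := by
  unfold svfExponent
  positivity

lemma prod_rpow_le_mul {ι : Type*} [Fintype ι] {a b : ℝ} (ha : 0 < a) {x e e' : ι → ℝ}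
    (hx : ∀ k, x k ∈ Set.Icc a b) (he : ∀ k, e k ≤ e' k) :
    ∏ k, x k ^ e' k ≤ b ^ (∑ k, (e' k - e k)) * ∏ k, x k ^ e k := by
  have hx0 : ∀ k, 0 < x k := fun k => ha.trans_le (hx k).1
  rcases isEmpty_or_nonempty ι with hι | ⟨⟨i⟩⟩
  · simp
  have hb : 0 < b := ha.trans_le ((hx i).1.trans (hx i).2)
  rw [Real.rpow_sum_of_pos hb, ← Finset.prod_mul_distrib]
  refine Finset.prod_le_prod (fun k _ => (Real.rpow_pos_of_pos (hx0 k) _).le) fun k _ => ?_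
  calc x k ^ e' k = x k ^ (e' k - e k) * x k ^ e k := by
        rw [← Real.rpow_add (hx0 k)]; congr 1; ring
    _ ≤ _ := by
        gcongr
        · exact (Real.rpow_pos_of_pos (hx0 k) _).le
        · exact (hx0 k).le
        · linarith [he k]
        · exact (hx k).2

lemma mul_le_prod_rpow {ι : Type*} [Fintype ι] {a b : ℝ} (ha : 0 < a) {x e e' : ι → ℝ}
    (hx : ∀ k, x k ∈ Set.Icc a b) (he : ∀ k, e k ≤ e' k) :
    a ^ (∑ k, (e' k - e k)) * ∏ k, x k ^ e k ≤ ∏ k, x k ^ e' k := by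
  have hx0 : ∀ k, 0 < x k := fun k => ha.trans_le (hx k).1
  rw [Real.rpow_sum_of_pos ha, ← Finset.prod_mul_distrib]
  refine Finset.prod_le_prod
    (fun k _ => mul_nonneg (Real.rpow_pos_of_pos ha _).le (Real.rpow_pos_of_pos (hx0 k) _).le)
    fun k _ => ?_
  calc a ^ (e' k - e k) * x k ^ e k ≤ x k ^ (e' k - e k) * x k ^ e k := by
        gcongr
        · exact (Real.rpow_pos_of_pos (hx0 k) _).le
        · linarith [he k]
        · exact (hx k).1
    _ = x k ^ e' k := by
        rw [← Real.rpow_add (hx0 k)]; congr 1; ring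

/-- A positive function on `[0, ∞)` that decays between two exponential rates takes the value `1`
exactly once, if it is at least `1` at the origin. -/
lemma exists_unique_eq_one_of_rpow_bounds {Φ : ℝ → ℝ} {a b : ℝ} (ha : 0 < a) (hab : a ≤ b)
    (hb : b < 1) (h0 : 1 ≤ Φ 0)
    (hlow : ∀ s s', 0 ≤ s → s ≤ s' → a ^ (s' - s) * Φ s ≤ Φ s')
    (hup : ∀ s s', 0 ≤ s → s ≤ s' → Φ s' ≤ b ^ (s' - s) * Φ s) :
    ∃ s₀, 0 ≤ s₀ ∧ Φ s₀ = 1 ∧ ∀ s, 0 ≤ s → Φ s = 1 → s = s₀ := by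
  have hb0 : 0 < b := ha.trans_le hab
  have hpos : ∀ s, 0 ≤ s → 0 < Φ s := fun s hs =>
    (mul_pos (Real.rpow_pos_of_pos ha _) (by linarith)).trans_le (hlow 0 s le_rfl hs)
  have hanti : ∀ s s', 0 ≤ s → s < s' → Φ s' < Φ s := fun s s' hs hss =>
    (hup s s' hs hss.le).trans_lt <| by
      have : b ^ (s' - s) < 1 := Real.rpow_lt_one hb0.le hb (by linarith)
      nlinarith [hpos s hs]
  have hcont : ContinuousOn Φ (Set.Ici 0) := by
    intro s hs
    have hs : 0 ≤ s := hs
    have e1 : ∀ s', 0 ≤ s' → a ^ |s' - s| * Φ s ≤ Φ s' := by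
      intro s' hs'
      rcases le_total s s' with h | h
      · rw [abs_of_nonneg (by linarith)]; exact hlow s s' hs h
      · have h1 : Φ s ≤ Φ s' := by
          rcases h.lt_or_eq with h | h
          · exact (hanti s' s hs' h).le
          · rw [h]
        have h2 : a ^ |s' - s| ≤ 1 := Real.rpow_le_one ha.le (by linarith) (abs_nonneg _)
        nlinarith [hpos s hs]
    have e2 : ∀ s', 0 ≤ s' → Φ s' ≤ (a ^ |s' - s|)⁻¹ * Φ s := by
      intro s' hs'
      rw [le_inv_mul_iff₀ (Real.rpow_pos_of_pos ha _)]
      rcases le_total s' s with h | h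
      · rw [abs_of_nonpos (by linarith), neg_sub]; exact hlow s' s hs' h
      · have h1 : Φ s' ≤ Φ s := by
          rcases h.lt_or_eq with h | h
          · exact (hanti s s' hs h).le
          · rw [h]
        have h2 : a ^ |s' - s| ≤ 1 := Real.rpow_le_one ha.le (by linarith) (abs_nonneg _)
        nlinarith [hpos s' hs']
    have c0 : Continuous fun s' : ℝ => a ^ |s' - s| :=
      Continuous.rpow continuous_const (by fun_prop) (fun _ => Or.inl ha.ne')
    have c1 : Tendsto (fun s' => a ^ |s' - s| * Φ s) (𝓝[Set.Ici 0] s) (𝓝 (Φ s)) := by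
      have : Continuous fun s' : ℝ => a ^ |s' - s| * Φ s := c0.mul continuous_const
      simpa using (this.tendsto s).mono_left nhdsWithin_le_nhds
    have c2 : Tendsto (fun s' => (a ^ |s' - s|)⁻¹ * Φ s) (𝓝[Set.Ici 0] s) (𝓝 (Φ s)) := by
      have : Continuous fun s' : ℝ => (a ^ |s' - s|)⁻¹ * Φ s :=
        (c0.inv₀ fun _ => (Real.rpow_pos_of_pos ha _).ne').mul continuous_const
      simpa using (this.tendsto s).mono_left nhdsWithin_le_nhds
    refine tendsto_of_tendsto_of_tendsto_of_le_of_le' c1 c2 ?_ ?_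
    · filter_upwards [self_mem_nhdsWithin] with s' hs' using e1 s' hs'
    · filter_upwards [self_mem_nhdsWithin] with s' hs' using e2 s' hs'
  obtain ⟨S, hS0, hS⟩ : ∃ S, 0 ≤ S ∧ Φ S ≤ 1 := by
    have ht : Tendsto (fun n : ℕ => b ^ n * Φ 0) atTop (𝓝 (0 * Φ 0)) :=
      (tendsto_pow_atTop_nhds_zero_of_lt_one hb0.le hb).mul_const _
    rw [zero_mul] at ht
    obtain ⟨n, hn⟩ := (ht.eventually (gt_mem_nhds zero_lt_one)).exists
    refine ⟨n, by positivity, (hup 0 n le_rfl (by positivity)).trans ?_⟩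
    rw [sub_zero, Real.rpow_natCast]
    exact hn.le
  obtain ⟨s₀, hs₀, h1⟩ := intermediate_value_Icc' hS0
    (hcont.mono (fun x hx => hx.1 : Set.Icc 0 S ⊆ Set.Ici 0)) ⟨hS, h0⟩
  refine ⟨s₀, hs₀.1, h1, fun s hs hs1 => ?_⟩
  rcases lt_trichotomy s s₀ with h | h | h
  · exact absurd (hanti s s₀ hs h) (by rw [h1, hs1]; exact lt_irrefl _)
  · exact h
  · exact absurd (hanti s₀ s hs₀.1 h) (by rw [h1, hs1]; exact lt_irrefl _)

section Expectation

variable {Ω : Type*} [MeasurableSpace Ω] {P : Measure Ω} [IsProbabilityMeasure P] {d N : ℕ}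
  {α : List (Fin N) → Fin d → Ω → ℝ} {a b : ℝ}

lemma measurable_prod_abs_rpow (hmeas : ∀ w : List (Fin N), w ≠ [] → ∀ k, Measurable (α w k))
    {w : List (Fin N)} (hw : w ≠ []) (σ : Equiv.Perm (Fin d)) (e : Fin d → ℝ) :
    Measurable fun ω => ∏ k, |α w (σ k) ω| ^ e k := by
  have := fun k => hmeas w hw k
  fun_prop

lemma integrable_prod_abs_rpow (hb : b < 1)
    (hmeas : ∀ w : List (Fin N), w ≠ [] → ∀ k, Measurable (α w k))
    (hbd : ∀ w : List (Fin N), w ≠ [] → ∀ k ω, |α w k ω| ∈ Set.Icc a b)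
    {w : List (Fin N)} (hw : w ≠ []) (σ : Equiv.Perm (Fin d)) {e : Fin d → ℝ} (he : ∀ k, 0 ≤ e k) :
    Integrable (fun ω => ∏ k, |α w (σ k) ω| ^ e k) P := by
  refine Integrable.of_bound (C := 1)
    (measurable_prod_abs_rpow hmeas hw σ e).aestronglyMeasurable (ae_of_all _ fun ω => ?_)
  rw [Real.norm_of_nonneg (by positivity)]
  refine Finset.prod_le_one (fun k _ => by positivity) fun k _ => ?_
  exact Real.rpow_le_one (abs_nonneg _) ((hbd w hw (σ k) ω).2.trans hb.le) (he k)

lemma integral_permSVF {P : Measure Ω} (hd : 1 ≤ d) (ha : 0 < a)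
    (hbd : ∀ w : List (Fin N), w ≠ [] → ∀ k ω, |α w k ω| ∈ Set.Icc a b)
    (σ : Equiv.Perm (Fin d)) {s : ℝ} (hs : 0 ≤ s) (i : Fin N) :
    ∫ ω, permSVF σ s (fun k => α [i] k ω) ∂P =
      ∫ ω, ∏ k, |α [i] (σ k) ω| ^ svfExponent d s k ∂P := by
  refine integral_congr_ae (ae_of_all _ fun ω => ?_)
  exact permSVF_eq_prod_rpow hd σ hs fun k => ha.trans_le (hbd [i] (by simp) k ω).1

lemma exists_unique_maxExpectedSVF_eq_one (hd : 1 ≤ d) (hN : 1 ≤ N) (ha : 0 < a) (hab : a ≤ b)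
    (hb : b < 1) (hmeas : ∀ w : List (Fin N), w ≠ [] → ∀ k, Measurable (α w k))
    (hbd : ∀ w : List (Fin N), w ≠ [] → ∀ k ω, |α w k ω| ∈ Set.Icc a b) :
    ∃ s₀, 0 ≤ s₀ ∧ maxExpectedSVF P α s₀ = 1 ∧
      ∀ s, 0 ≤ s → maxExpectedSVF P α s = 1 → s = s₀ := by
  have hint := fun σ {s : ℝ} (i : Fin N) => integrable_prod_abs_rpow (P := P) (α := α) hb hmeas
    hbd (w := [i]) (by simp) σ (e := fun k => svfExponent d s k) (fun k => svfExponent_nonneg _ _ _)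
  have hsum : ∀ s s' : ℝ, 0 ≤ s → s ≤ s' →
      ∑ k : Fin d, (svfExponent d s' k - svfExponent d s k) = s' - s := by
    intro s s' hs hss
    rw [Finset.sum_sub_distrib, sum_svfExponent hd hs, sum_svfExponent hd (hs.trans hss)]
  refine exists_unique_eq_one_of_rpow_bounds ha hab hb ?_ ?_ ?_
  · unfold maxExpectedSVF
    refine le_trans ?_ (Finset.le_sup' _ (Finset.mem_univ (Equiv.refl _)))
    have : ∀ i : Fin N, ∫ ω, permSVF (Equiv.refl (Fin d)) 0 (fun k => α [i] k ω) ∂P = 1 := by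
      intro i
      have h1 : ∀ ω, permSVF (Equiv.refl (Fin d)) 0 (fun k => α [i] k ω) = 1 := by
        intro ω
        rw [permSVF_eq_prod_rpow hd _ le_rfl fun k => ha.trans_le (hbd [i] (by simp) k ω).1]
        refine Finset.prod_eq_one fun k _ => ?_
        have : svfExponent d 0 k = 0 := by
          unfold svfExponent
          rw [max_eq_left, max_eq_right] <;> simp
        rw [this, Real.rpow_zero]
      simp [h1]
    simp only [this]
    simpa using hN
  · intro s s' hs hss
    obtain ⟨σ, -, hσ⟩ := Finset.exists_mem_eq_sup' Finset.univ_nonempty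
      (fun σ : Equiv.Perm (Fin d) => ∑ i : Fin N, ∫ ω, permSVF σ s (fun k => α [i] k ω) ∂P)
    unfold maxExpectedSVF
    rw [hσ]
    refine le_trans ?_ (Finset.le_sup' _ (Finset.mem_univ σ))
    rw [Finset.mul_sum]
    refine Finset.sum_le_sum fun i _ => ?_
    rw [integral_permSVF hd ha hbd σ hs, integral_permSVF hd ha hbd σ (hs.trans hss),
      ← integral_const_mul]
    refine integral_mono ((hint σ i).const_mul _) (hint σ i) fun ω => ?_
    simp only
    rw [← hsum s s' hs hss]
    exact mul_le_prod_rpow ha (fun k => hbd [i] (by simp) (σ k) ω)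
      fun k => svfExponent_mono d hss k
  · intro s s' hs hss
    unfold maxExpectedSVF
    refine Finset.sup'_le _ _ fun σ _ => ?_
    refine le_trans ?_ (mul_le_mul_of_nonneg_left
      (Finset.le_sup' (fun σ : Equiv.Perm (Fin d) =>
        ∑ i : Fin N, ∫ ω, permSVF σ s (fun k => α [i] k ω) ∂P) (Finset.mem_univ σ))
      (Real.rpow_nonneg (ha.le.trans hab) _))
    rw [Finset.mul_sum]
    refine Finset.sum_le_sum fun i _ => ?_
    rw [integral_permSVF hd ha hbd σ hs, integral_permSVF hd ha hbd σ (hs.trans hss),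
      ← integral_const_mul]
    refine integral_mono (hint σ i) ((hint σ i).const_mul _) fun ω => ?_
    simp only
    rw [← hsum s s' hs hss]
    exact prod_rpow_le_mul ha (fun k => hbd [i] (by simp) (σ k) ω)
      fun k => svfExponent_mono d hss k

end Expectation

/-! ### Covering numbers and Hausdorff dimension -/

lemma norm_le_of_forall_abs_le {d : ℕ} {x : EuclideanSpace ℝ (Fin d)} {r : ℝ} (hr : 0 ≤ r)
    (h : ∀ k, |x k| ≤ r / d) : ‖x‖ ≤ r := by
  rw [EuclideanSpace.norm_eq]
  apply Real.sqrt_le_iff.mpr ⟨hr, ?_⟩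
  rcases Nat.eq_zero_or_pos d with rfl | hd
  · simp [sq_nonneg]
  have hd1 : (1 : ℝ) ≤ d := by exact_mod_cast hd
  calc ∑ k, ‖x k‖ ^ 2 ≤ ∑ _k : Fin d, (r / d) ^ 2 := by
        refine Finset.sum_le_sum fun k _ => ?_
        rw [Real.norm_eq_abs]
        gcongr
        exact h k
    _ = r ^ 2 / d := by
        rw [Finset.sum_const, Finset.card_univ, Fintype.card_fin, nsmul_eq_mul]
        field_simp
    _ ≤ r ^ 2 := div_le_self (sq_nonneg _) hd1

lemma exists_finset_cover_box {d : ℕ} {r : ℝ} (hr : 0 < r) (c L : Fin d → ℝ) :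
    ∃ C : Finset (EuclideanSpace ℝ (Fin d)), C.card ≤ ∏ k, (⌊d * L k / r⌋₊ + 1) ∧
      {x : EuclideanSpace ℝ (Fin d) | ∀ k, x k ∈ Set.Icc (c k) (c k + L k)} ⊆
        ⋃ y ∈ C, Metric.closedBall y r := by
  classical
  rcases Nat.eq_zero_or_pos d with rfl | hd
  · refine ⟨{0}, by simp, fun x _ => ?_⟩
    simp [Subsingleton.elim x 0, hr.le]
  have hd0 : (0 : ℝ) < d := by exact_mod_cast hd
  refine ⟨(Fintype.piFinset fun k => Finset.range (⌊d * L k / r⌋₊ + 1)).image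
    fun m : Fin d → ℕ => WithLp.toLp 2 fun k => c k + m k * (r / d), ?_, ?_⟩
  · refine Finset.card_image_le.trans ?_
    rw [Fintype.card_piFinset]
    simp
  · intro x hx
    simp only [Set.mem_iUnion, exists_prop]
    refine ⟨_, Finset.mem_image_of_mem _ (a := fun k => ⌊d * (x k - c k) / r⌋₊) ?_, ?_⟩
    · rw [Fintype.mem_piFinset]
      intro k
      rw [Finset.mem_range, Nat.lt_succ_iff]
      apply Nat.floor_le_floor
      gcongr
      linarith [(hx k).2]
    · rw [Metric.mem_closedBall, dist_eq_norm]
      refine norm_le_of_forall_abs_le hr.le fun k => ?_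
      have h0 : 0 ≤ d * (x k - c k) / r := by
        have := (hx k).1
        have : 0 ≤ x k - c k := by linarith
        positivity
      have h1 := Nat.floor_le h0
      have h2 := Nat.lt_floor_add_one (d * (x k - c k) / r)
      rw [le_div_iff₀ hr] at h1
      rw [div_lt_iff₀ hr] at h2
      simp only [PiLp.sub_apply]
      have e : x k - (c k + ⌊d * (x k - c k) / r⌋₊ * (r / d)) =
          (d * (x k - c k) - ⌊d * (x k - c k) / r⌋₊ * r) / d := by field_simp; ring
      rw [e, abs_of_nonneg (div_nonneg (by linarith) hd0.le)]
      gcongr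
      linarith

lemma ballCoverNumber_le {d : ℕ} {r : ℝ} (hr : 0 ≤ r) {S : Set (EuclideanSpace ℝ (Fin d))}
    (C : Finset (EuclideanSpace ℝ (Fin d))) (h : S ⊆ ⋃ y ∈ C, Metric.closedBall y r) :
    ballCoverNumber r S ≤ C.card := by
  have hc : Metric.IsCover r.toNNReal S (C : Set (EuclideanSpace ℝ (Fin d))) := by
    rw [Metric.isCover_iff_subset_iUnion_closedBall, Real.coe_toNNReal _ hr]
    simpa using h
  have := hc.externalCoveringNumber_le_encard
  rw [Set.encard_coe_eq_coe_finsetCard] at this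
  exact ENat.toNat_le_of_le_natCast this

lemma exists_finset_card_eq_ballCoverNumber {d : ℕ} {r : ℝ} (hr : 0 < r)
    {S : Set (EuclideanSpace ℝ (Fin d))} (hS : Bornology.IsBounded S) :
    ∃ C : Finset (EuclideanSpace ℝ (Fin d)), C.card = ballCoverNumber r S ∧
      S ⊆ ⋃ y ∈ C, Metric.closedBall y r := by
  obtain ⟨C₀, -, hfin, hC₀⟩ := Metric.exists_finite_isCover_of_isCompact_closure
    (ε := r.toNNReal) (by simpa using hr) hS.isCompact_closure
  have : Nonempty {C : Set (EuclideanSpace ℝ (Fin d)) // Metric.IsCover r.toNNReal S C} :=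
    ⟨C₀, hC₀⟩
  obtain ⟨C, hC⟩ := ENat.exists_eq_iInf
    (fun C : {C : Set (EuclideanSpace ℝ (Fin d)) // Metric.IsCover r.toNNReal S C} => C.1.encard)
  have hC' : C.1.encard = Metric.externalCoveringNumber r.toNNReal S := by
    rw [hC, Metric.externalCoveringNumber, iInf_subtype]
  have hCfin : C.1.Finite := by
    rw [← Set.encard_lt_top_iff, hC']
    exact hC₀.externalCoveringNumber_le_encard.trans_lt (Set.encard_lt_top_iff.mpr hfin)
  refine ⟨hCfin.toFinset, ?_, ?_⟩
  · rw [ballCoverNumber, ← hC', hCfin.encard_eq_coe_toFinset_card, ENat.toNat_natCast]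
  · have := Metric.isCover_iff_subset_iUnion_closedBall.mp C.2
    rw [Real.coe_toNNReal _ hr.le] at this
    simpa using this

lemma one_le_ballCoverNumber {d : ℕ} {r : ℝ} (hr : 0 < r)
    {S : Set (EuclideanSpace ℝ (Fin d))} (hS : Bornology.IsBounded S) (hne : S.Nonempty) :
    1 ≤ ballCoverNumber r S := by
  obtain ⟨C, hC, hsub⟩ := exists_finset_card_eq_ballCoverNumber hr hS
  rw [← hC, Nat.one_le_iff_ne_zero, Finset.card_ne_zero]
  obtain ⟨x, hx⟩ := hne
  have := hsub hx
  simp only [Set.mem_iUnion] at this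
  obtain ⟨y, hy, -⟩ := this
  exact ⟨y, hy⟩

/-- A bound on the covering numbers along some sequence of radii tending to `0` bounds the
Hausdorff dimension. -/
lemma dimH_le_of_frequently_ballCoverNumber_le {d : ℕ} {S : Set (EuclideanSpace ℝ (Fin d))}
    (hS : Bornology.IsBounded S) {s K : ℝ} (hs : 0 ≤ s)
    (h : ∃ᶠ r in 𝓝[>] (0 : ℝ), (ballCoverNumber r S : ℝ) ≤ K * r ^ (-s)) :
    dimH S ≤ ENNReal.ofReal s := by
  obtain ⟨u, hu, hu'⟩ := exists_seq_forall_of_frequently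
    (h.and_eventually (self_mem_nhdsWithin : Set.Ioi (0 : ℝ) ∈ 𝓝[>] (0 : ℝ)))
  have hpos : ∀ n, 0 < u n := fun n => (hu' n).2
  choose C hC hsub using fun n => exists_finset_card_eq_ballCoverNumber (hpos n) hS
  have hu0 : Tendsto u atTop (𝓝 0) := hu.mono_right nhdsWithin_le_nhds
  have key : μH[s] S ≤ ENNReal.ofReal (K * 2 ^ s) := by
    refine (Measure.hausdorffMeasure_le_liminf_sum (ι := fun n => C n) s S
      (l := atTop) (fun n => ENNReal.ofReal (2 * u n)) ?_
      (fun n y => Metric.closedBall y.1 (u n)) ?_ ?_).trans ?_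
    · have : Tendsto (fun n => 2 * u n) atTop (𝓝 0) := by simpa using hu0.const_mul 2
      simpa using ENNReal.tendsto_ofReal this
    · refine Eventually.of_forall fun n y => ?_
      refine Metric.ediam_le_of_forall_dist_le fun x hx z hz => ?_
      rw [Metric.mem_closedBall] at hx hz
      linarith [dist_triangle_right x z y.1]
    · refine Eventually.of_forall fun n => (hsub n).trans ?_
      exact Set.iUnion₂_subset fun y hy =>
        Set.subset_iUnion (fun y : C n => Metric.closedBall y.1 (u n)) ⟨y, hy⟩
    · refine liminf_le_of_frequently_le' (Eventually.frequently (Eventually.of_forall fun n => ?_))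
      calc ∑ y : C n, Metric.ediam (Metric.closedBall y.1 (u n)) ^ s
          ≤ ∑ _y : C n, ENNReal.ofReal ((2 * u n) ^ s) := by
            refine Finset.sum_le_sum fun y _ => ?_
            rw [← ENNReal.ofReal_rpow_of_pos (by linarith [hpos n])]
            gcongr
            refine Metric.ediam_le_of_forall_dist_le fun x hx z hz => ?_
            rw [Metric.mem_closedBall] at hx hz
            linarith [dist_triangle_right x z y.1]
        _ = ENNReal.ofReal ((C n).card * (2 * u n) ^ s) := by
            rw [Finset.sum_const, Finset.card_univ, Fintype.card_coe, nsmul_eq_mul,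
              ENNReal.ofReal_mul (by positivity), ENNReal.ofReal_natCast]
        _ ≤ ENNReal.ofReal (K * 2 ^ s) := by
            apply ENNReal.ofReal_le_ofReal
            rw [hC n]
            have h2 := hpos n
            calc (ballCoverNumber (u n) S : ℝ) * (2 * u n) ^ s
                ≤ K * u n ^ (-s) * (2 * u n) ^ s := by
                  gcongr
                  · exact (hu' n).1
              _ = K * 2 ^ s * (u n ^ (-s) * u n ^ s) := by
                  rw [Real.mul_rpow (by norm_num) h2.le]; ring
              _ = K * 2 ^ s := by
                  rw [← Real.rpow_add h2]; simp
  have := dimH_le_of_hausdorffMeasure_ne_top (s := S) (d := s.toNNReal)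
    (by rw [Real.coe_toNNReal s hs]; exact ne_top_of_le_ne_top ENNReal.ofReal_ne_top key)
  exact this

/-! ### Energies of discrete mass distributions -/

/-- Cauchy–Schwarz over a partition into cells: if the kernel is at least `(E n)⁻¹` between points
of the same cell `n`, then the total energy is at least `(∑ i, q i) ^ 2 / ∑ n, E n`. -/
lemma sq_sum_le_sum_mul_energy {ι κ : Type*} [Fintype ι] [DecidableEq κ] (c : ι → κ)
    (J : Finset κ) (hc : ∀ i, c i ∈ J) {q : ι → ℝ} (hq : ∀ i, 0 ≤ q i) {k : ι → ι → ℝ}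
    (hk : ∀ i j, 0 ≤ k i j) {E : κ → ℝ} (hE : ∀ n, 0 < E n)
    (h : ∀ i j, c i = c j → 1 ≤ k i j * E (c i)) :
    (∑ i, q i) ^ 2 ≤ (∑ n ∈ J, E n) * ∑ i, ∑ j, q i * q j * k i j := by
  rcases isEmpty_or_nonempty ι with hι | ⟨⟨i₀⟩⟩
  · simp
  have hpos : 0 < ∑ n ∈ J, E n := Finset.sum_pos (fun n _ => hE n) ⟨_, hc i₀⟩
  rw [mul_comm, ← div_le_iff₀ hpos]
  have e1 : ∑ i, q i = ∑ n ∈ J, ∑ i with c i = n, q i :=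
    (Finset.sum_fiberwise_of_maps_to (fun i _ => hc i) q).symm
  rw [e1]
  refine (Finset.sq_sum_div_le_sum_sq_div J _ fun n _ => hE n).trans ?_
  rw [← Finset.sum_fiberwise_of_maps_to (s := Finset.univ) (t := J) (g := c) (fun i _ => hc i)]
  refine Finset.sum_le_sum fun n _ => ?_
  rw [sq, Finset.sum_mul_sum, Finset.sum_div]
  refine Finset.sum_le_sum fun i hi => ?_
  rw [Finset.mem_filter] at hi
  rw [Finset.sum_div]
  refine (Finset.sum_le_sum (g := fun j => q i * q j * k i j) fun j hj => ?_).trans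
    (Finset.sum_le_univ_sum_of_nonneg fun j => mul_nonneg (mul_nonneg (hq i) (hq j)) (hk i j))
  rw [Finset.mem_filter] at hj
  rw [div_le_iff₀ (hE n), mul_assoc]
  have := h i j (hi.2.trans hj.2.symm)
  rw [hi.2] at this
  exact le_mul_of_one_le_right (mul_nonneg (hq i) (hq j)) this

/-- Discrete mass distributions on `S`, with truncation scales `r` tending to `0` and with bounded
normalized energies for the kernel `∏ k, max |x k| r ^ (-p k)`, bound the Hausdorff dimension from
below. -/
lemma le_dimH_of_energy_le {d : ℕ} {S : Set (EuclideanSpace ℝ (Fin d))} (hS : IsCompact S)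
    {p : Fin d → ℝ} (hp : ∀ k, 0 ≤ p k) {K : ℝ}
    (h : ∀ ε > 0, ∃ r, 0 < r ∧ r < ε ∧ ∃ (ι : Type) (_ : Fintype ι)
      (z : ι → EuclideanSpace ℝ (Fin d)) (q : ι → ℝ), (∀ i, z i ∈ S) ∧ (∀ i, 0 ≤ q i) ∧
      0 < ∑ i, q i ∧ ∑ i, ∑ j, q i * q j * ∏ k, max |z i k - z j k| r ^ (-p k) ≤
        K * (∑ i, q i) ^ 2) :
    ENNReal.ofReal (∑ k, p k) ≤ dimH S := by
  classical
  by_contra hlt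
  push Not at hlt
  set t := ∑ k, p k with ht
  have ht0 : 0 < t := by
    rw [← ENNReal.ofReal_pos]
    exact bot_le.trans_lt hlt
  have h0 : μH[t] S = 0 := by
    have := hausdorffMeasure_of_dimH_lt (s := S) (d := t.toNNReal) hlt
    rwa [Real.coe_toNNReal _ ht0.le] at this
  set K' := max K 1
  have hK' : 0 < K' := lt_max_of_lt_right one_pos
  -- a countable cover with small `t`-dimensional content
  obtain ⟨T, hTS, hT1, hTsum⟩ : ∃ T : ℕ → Set (EuclideanSpace ℝ (Fin d)), S ⊆ ⋃ n, T n ∧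
      (∀ n, Metric.ediam (T n) ≤ 1) ∧
      ∑' n, Metric.ediam (T n) ^ t < ENNReal.ofReal (1 / (4 * K')) := by
    rw [Measure.hausdorffMeasure_apply] at h0
    simp only [ENNReal.iSup_eq_zero] at h0
    have h1 := h0 1 one_pos
    have : (0 : ENNReal) < ENNReal.ofReal (1 / (4 * K')) := by
      rw [ENNReal.ofReal_pos]; positivity
    rw [← h1] at this
    simp only [iInf_lt_iff] at this
    obtain ⟨T, hTS, hT1, hT⟩ := this
    refine ⟨T, hTS, hT1, lt_of_le_of_lt (ENNReal.tsum_le_tsum fun n => ?_) hT⟩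
    rcases (T n).eq_empty_or_nonempty with he | hne
    · simp [he, ht0]
    · simp [hne]
  obtain ⟨δ, hδ0, hδ⟩ := ENNReal.exists_pos_sum_of_countable'
    (ε := ENNReal.ofReal (1 / (4 * K'))) (by simp; positivity) ℕ
  -- enlarge the sets of the cover to open sets
  have hη : ∀ n, ∃ η > 0, ENNReal.ofReal ((Metric.diam (T n) + η) ^ t) ≤
      Metric.ediam (T n) ^ t + δ n := by
    intro n
    have hfin : Metric.ediam (T n) ≠ ⊤ := ne_top_of_le_ne_top ENNReal.one_ne_top (hT1 n)
    have hc : Tendsto (fun η : ℝ => ENNReal.ofReal ((Metric.diam (T n) + η) ^ t)) (𝓝[>] 0)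
        (𝓝 (ENNReal.ofReal ((Metric.diam (T n) + 0) ^ t))) := by
      refine ENNReal.tendsto_ofReal (Tendsto.mono_left ?_ nhdsWithin_le_nhds)
      exact (((continuous_const.add continuous_id).rpow_const
        fun _ => Or.inr ht0.le).tendsto (0 : ℝ))
    have hlt' : ENNReal.ofReal ((Metric.diam (T n) + 0) ^ t) < Metric.ediam (T n) ^ t + δ n := by
      rw [add_zero, Metric.diam, ← ENNReal.ofReal_rpow_of_nonneg ENNReal.toReal_nonneg ht0.le,
        ENNReal.ofReal_toReal hfin]
      exact ENNReal.lt_add_right (ENNReal.rpow_ne_top_of_nonneg ht0.le hfin) (hδ0 n).ne'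
    obtain ⟨η, h1, h2⟩ := ((hc.eventually (gt_mem_nhds hlt')).and self_mem_nhdsWithin).exists
    exact ⟨η, h2, h1.le⟩
  choose η hη0 hη1 using hη
  set D : ℕ → ℝ := fun n => Metric.diam (T n) + η n
  have hD : ∀ n, 0 < D n := fun n => add_pos_of_nonneg_of_pos Metric.diam_nonneg (hη0 n)
  have hUd : ∀ n, ∀ x ∈ Metric.thickening (η n / 2) (T n),
      ∀ y ∈ Metric.thickening (η n / 2) (T n), dist x y ≤ D n := by
    intro n x hx y hy
    rw [Metric.mem_thickening_iff] at hx hy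
    obtain ⟨x', hx', hx⟩ := hx
    obtain ⟨y', hy', hy⟩ := hy
    have hb : Bornology.IsBounded (T n) :=
      Metric.isBounded_iff_ediam_ne_top.mpr (ne_top_of_le_ne_top ENNReal.one_ne_top (hT1 n))
    have h1 := Metric.dist_le_diam_of_mem hb hx' hy'
    have h2 := dist_triangle4 x x' y' y
    rw [dist_comm y' y] at h2
    simp only [D]
    linarith
  obtain ⟨J, hJ⟩ := hS.elim_finite_subcover (fun n => Metric.thickening (η n / 2) (T n))
    (fun n => Metric.isOpen_thickening) (hTS.trans (Set.iUnion_mono fun n =>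
      Metric.self_subset_thickening (half_pos (hη0 n)) _))
  obtain ⟨ε, hε0, hε⟩ : ∃ ε > 0, ∀ n ∈ J, ε ≤ D n := by
    clear hJ
    induction J using Finset.induction_on with
    | empty => exact ⟨1, one_pos, by simp⟩
    | insert m J _ ih =>
      obtain ⟨ε, h1, h2⟩ := ih
      refine ⟨min ε (D m), lt_min h1 (hD m), fun n hn => ?_⟩
      rcases Finset.mem_insert.mp hn with rfl | hn
      · exact min_le_right _ _
      · exact (min_le_left _ _).trans (h2 n hn)
  obtain ⟨r, hr0, hrε, ι, _, z, q, hz, hq, hqpos, hen⟩ := h ε hε0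
  have hcell : ∀ i, ∃ n ∈ J, z i ∈ Metric.thickening (η n / 2) (T n) := by
    intro i
    simpa using hJ (hz i)
  choose c hcJ hcz using hcell
  have key := sq_sum_le_sum_mul_energy c J hcJ hq
    (k := fun i j => ∏ k, max |z i k - z j k| r ^ (-p k)) (fun i j => by positivity)
    (E := fun n => D n ^ t) (fun n => Real.rpow_pos_of_pos (hD n) _) (by
      intro i j hij
      rw [ht, Real.rpow_sum_of_pos (hD _), ← Finset.prod_mul_distrib]
      refine Finset.one_le_prod fun k _ => ?_
      rw [Real.rpow_neg (by positivity), inv_mul_eq_div, one_le_div (by positivity)]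
      refine Real.rpow_le_rpow (by positivity) (max_le ?_ (hrε.le.trans (hε _ (hcJ i)))) (hp k)
      refine le_trans ?_ (hUd _ _ (hcz i) _ (hij ▸ hcz j))
      rw [dist_eq_norm]
      exact PiLp.norm_apply_le (z i - z j) k)
  have hsum : ∑ n ∈ J, D n ^ t < 1 / (2 * K') := by
    have h1 : ENNReal.ofReal (∑ n ∈ J, D n ^ t) < ENNReal.ofReal (1 / (2 * K')) := by
      rw [ENNReal.ofReal_sum_of_nonneg fun n _ => (Real.rpow_pos_of_pos (hD n) _).le]
      calc ∑ n ∈ J, ENNReal.ofReal (D n ^ t)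
          ≤ ∑ n ∈ J, (Metric.ediam (T n) ^ t + δ n) := Finset.sum_le_sum fun n _ => hη1 n
        _ ≤ ∑' n, (Metric.ediam (T n) ^ t + δ n) := ENNReal.sum_le_tsum J
        _ = ∑' n, Metric.ediam (T n) ^ t + ∑' n, δ n := ENNReal.tsum_add
        _ < ENNReal.ofReal (1 / (4 * K')) + ENNReal.ofReal (1 / (4 * K')) :=
            ENNReal.add_lt_add hTsum hδ
        _ = ENNReal.ofReal (1 / (2 * K')) := by
            rw [← ENNReal.ofReal_add (by positivity) (by positivity)]
            congr 1; field_simp; norm_num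
    exact (ENNReal.ofReal_lt_ofReal_iff (by positivity)).mp h1
  have hq2 : 0 < (∑ i, q i) ^ 2 := by positivity
  have hE0 : 0 ≤ ∑ n ∈ J, D n ^ t :=
    Finset.sum_nonneg fun n _ => (Real.rpow_pos_of_pos (hD n) _).le
  have : (∑ i, q i) ^ 2 ≤ 1 / (2 * K') * (K' * (∑ i, q i) ^ 2) := by
    refine key.trans (mul_le_mul hsum.le (hen.trans ?_) ?_ (by positivity))
    · gcongr
      exact le_max_left _ _
    · exact Finset.sum_nonneg fun i _ => Finset.sum_nonneg fun j _ =>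
        mul_nonneg (mul_nonneg (hq i) (hq j)) (by positivity)
  have e : 1 / (2 * K') * (K' * (∑ i, q i) ^ 2) = (∑ i, q i) ^ 2 / 2 := by field_simp
  rw [e] at this
  linarith

lemma volume_floor_cell {d : ℕ} {r : ℝ} (hr : 0 < r) (n : Fin d → ℤ) :
    volume {x : EuclideanSpace ℝ (Fin d) | ∀ k, ⌊x k / r⌋ = n k} = ENNReal.ofReal (r ^ d) := by
  have e : {x : EuclideanSpace ℝ (Fin d) | ∀ k, ⌊x k / r⌋ = n k} =
      (MeasurableEquiv.toLp 2 (Fin d → ℝ)).symm ⁻¹'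
        (Set.univ.pi fun k => Set.Ico (n k * r) ((n k + 1) * r)) := by
    ext x
    simp only [Set.mem_ofPred_eq, Set.mem_preimage, Set.mem_pi, Set.mem_univ, true_imp_iff]
    refine forall_congr' fun k => ?_
    rw [Int.floor_eq_iff, le_div_iff₀ hr, div_lt_iff₀ hr]
    rfl
  rw [e, (EuclideanSpace.volume_preserving_symm_measurableEquiv_toLp (Fin d)).measure_preimage
    (MeasurableSet.univ_pi fun k => measurableSet_Ico).nullMeasurableSet, Real.volume_pi_Ico]
  have : ∀ k, ((n k : ℝ) + 1) * r - n k * r = r := fun k => by ring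
  simp [this, ENNReal.ofReal_pow hr.le]

/-- Discrete mass distributions on `S`, with scales `r` tending to `0` and with bounded normalized
energies for the kernel `r ^ (-d)` on `[-r, r] ^ d`, force `S` to have positive volume. -/
lemma volume_pos_of_energy_le {d : ℕ} {S : Set (EuclideanSpace ℝ (Fin d))} (hS : IsCompact S)
    {K : ℝ}
    (h : ∀ ε > 0, ∃ r, 0 < r ∧ r < ε ∧ ∃ (ι : Type) (_ : Fintype ι)
      (z : ι → EuclideanSpace ℝ (Fin d)) (q : ι → ℝ), (∀ i, z i ∈ S) ∧ (∀ i, 0 ≤ q i) ∧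
      0 < ∑ i, q i ∧
      ∑ i, ∑ j, q i * q j * ∏ k, (if |z i k - z j k| ≤ r then r⁻¹ else 0) ≤
        K * (∑ i, q i) ^ 2) :
    0 < volume S := by
  classical
  set K' := max K 1
  have hK' : 0 < K' := lt_max_of_lt_right one_pos
  refine lt_of_lt_of_le (b := ENNReal.ofReal K'⁻¹) (by simpa using hK') ?_
  refine ge_of_tendsto_of_frequently
    (tendsto_measure_cthickening_of_isCompact (μ := volume) hS) ?_
  rw [Filter.frequently_iff]
  intro U hU
  obtain ⟨ε, hε, hεU⟩ := Metric.mem_nhds_iff.mp hU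
  obtain ⟨r, hr0, hrε, ι, _, z, q, hz, hq, hqpos, hen⟩ := h (ε / (d + 1)) (by positivity)
  refine ⟨d * r, hεU ?_, ?_⟩
  · rw [Metric.mem_ball, dist_zero_right, Real.norm_of_nonneg (by positivity)]
    rw [lt_div_iff₀ (by positivity)] at hrε
    linarith
  set c : ι → Fin d → ℤ := fun i k => ⌊z i k / r⌋
  set J := Finset.univ.image c
  have key := sq_sum_le_sum_mul_energy c J (fun i => Finset.mem_image_of_mem _ (Finset.mem_univ i))
    hq (k := fun i j => ∏ k, (if |z i k - z j k| ≤ r then r⁻¹ else 0))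
    (fun i j => Finset.prod_nonneg fun k _ => by split_ifs <;> positivity)
    (E := fun _ => r ^ d) (fun n => by positivity) (by
      intro i j hij
      have : ∀ k, |z i k - z j k| ≤ r := by
        intro k
        have h1 : ⌊z i k / r⌋ = ⌊z j k / r⌋ := congrFun hij k
        have h2 := Int.abs_sub_lt_one_of_floor_eq_floor h1
        rw [← sub_div, abs_div, abs_of_pos hr0, div_lt_one hr0] at h2
        exact h2.le
      simp only [this, if_true, Finset.prod_const, Finset.card_univ, Fintype.card_fin]
      rw [inv_pow, inv_mul_cancel₀ (by positivity)])
  have hJ : K'⁻¹ ≤ J.card * r ^ d := by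
    rw [Finset.sum_const, nsmul_eq_mul] at key
    have h1 : (∑ i, q i) ^ 2 ≤ J.card * r ^ d * (K' * (∑ i, q i) ^ 2) :=
      key.trans (mul_le_mul_of_nonneg_left (hen.trans
        (mul_le_mul_of_nonneg_right (le_max_left _ _) (sq_nonneg _))) (by positivity))
    have hq2 : 0 < (∑ i, q i) ^ 2 := by positivity
    rw [inv_le_iff_one_le_mul₀ hK']
    nlinarith
  calc ENNReal.ofReal K'⁻¹ ≤ ENNReal.ofReal (J.card * r ^ d) := ENNReal.ofReal_le_ofReal hJ
    _ = ∑ n ∈ J, volume {x : EuclideanSpace ℝ (Fin d) | ∀ k, ⌊x k / r⌋ = n k} := by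
        simp_rw [volume_floor_cell hr0]
        rw [Finset.sum_const, nsmul_eq_mul, ENNReal.ofReal_mul (by positivity),
          ENNReal.ofReal_natCast]
    _ = volume (⋃ n ∈ J, {x : EuclideanSpace ℝ (Fin d) | ∀ k, ⌊x k / r⌋ = n k}) := by
        rw [measure_biUnion_finset]
        · intro n _ m _ hnm
          refine Set.disjoint_left.mpr fun x hx hx' => hnm ?_
          funext k
          exact (hx k).symm.trans (hx' k)
        · intro n _
          have : {x : EuclideanSpace ℝ (Fin d) | ∀ k, ⌊x k / r⌋ = n k} =
              ⋂ k, (fun x : EuclideanSpace ℝ (Fin d) => ⌊x k / r⌋) ⁻¹' {n k} := by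
            ext x; simp
          rw [this]
          refine MeasurableSet.iInter fun k => ?_
          refine measurableSet_preimage ?_ (measurableSet_singleton _)
          fun_prop
    _ ≤ volume (Metric.cthickening (d * r) S) := by
        refine measure_mono (Set.iUnion₂_subset fun n hn x hx => ?_)
        obtain ⟨i, -, rfl⟩ := Finset.mem_image.mp hn
        refine Metric.mem_cthickening_of_dist_le x (z i) _ _ (hz i) ?_
        rw [dist_eq_norm]
        refine norm_le_of_forall_abs_le (by positivity) fun k => ?_
        have hd : (0 : ℝ) < d := by exact_mod_cast k.pos
        rw [mul_div_cancel_left₀ _ hd.ne']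
        have h2 := Int.abs_sub_lt_one_of_floor_eq_floor (hx k)
        rw [← sub_div, abs_div, abs_of_pos hr0, div_lt_one hr0] at h2
        exact h2.le

/-! ### Products and compositions along words -/

section Words

variable {N : ℕ}

/-- The product of the ratios met when the word in the second argument is read below the word in
the first one; `e w i` is the ratio attached to the word `w ++ [i]`. -/
def wordProd (e : List (Fin N) → Fin N → ℝ) : List (Fin N) → List (Fin N) → ℝ
  | _, [] => 1
  | w, i :: x => e w i * wordProd e (w ++ [i]) x

/-- The composition, along the word in the second argument read below the word in the first one,
of the affine maps of the line with ratios `e w i` and fixed points `c i`. -/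
def wordMap (c : Fin N → ℝ) (e : List (Fin N) → Fin N → ℝ) :
    List (Fin N) → List (Fin N) → ℝ → ℝ
  | _, [], q => q
  | w, i :: x, q => e w i * wordMap c e (w ++ [i]) x q + (1 - e w i) * c i

variable (c : Fin N → ℝ) (e : List (Fin N) → Fin N → ℝ)

lemma wordProd_append (w x y : List (Fin N)) :
    wordProd e w (x ++ y) = wordProd e w x * wordProd e (w ++ x) y := by
  induction x generalizing w with
  | nil => simp [wordProd]
  | cons i x ih => simp [wordProd, ih, mul_assoc]

lemma wordMap_append (w x y : List (Fin N)) (q : ℝ) :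
    wordMap c e w (x ++ y) q = wordMap c e w x (wordMap c e (w ++ x) y q) := by
  induction x generalizing w with
  | nil => simp [wordMap]
  | cons i x ih => simp [wordMap, ih]

lemma wordMap_sub (w x : List (Fin N)) (q q' : ℝ) :
    wordMap c e w x q - wordMap c e w x q' = wordProd e w x * (q - q') := by
  induction x generalizing w with
  | nil => simp [wordMap, wordProd]
  | cons i x ih =>
    simp only [wordMap, wordProd]
    linear_combination e w i * ih (w ++ [i])

lemma wordMap_replicate (w : List (Fin N)) (n : ℕ) (l : Fin N) (q : ℝ) :
    wordMap c e w (List.replicate n l) q =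
      c l + wordProd e w (List.replicate n l) * (q - c l) := by
  induction n generalizing w with
  | zero => simp [wordMap, wordProd]
  | succ n ih =>
    simp only [List.replicate_succ, wordMap, wordProd, ih]
    ring

variable {c e} {a b : ℝ} (ha : 0 < a) (hb : b < 1) (he : ∀ w i, |e w i| ∈ Set.Icc a b)

include ha he in
lemma pow_le_abs_wordProd (w x : List (Fin N)) : a ^ x.length ≤ |wordProd e w x| := by
  induction x generalizing w with
  | nil => simp [wordProd]
  | cons i x ih =>
    rw [wordProd, abs_mul, List.length_cons, pow_succ']
    exact mul_le_mul (he w i).1 (ih _) (by positivity) (abs_nonneg _)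

include ha he in
lemma abs_wordProd_pos (w x : List (Fin N)) : 0 < |wordProd e w x| :=
  (pow_pos ha _).trans_le (pow_le_abs_wordProd ha he w x)

include he in
lemma abs_wordProd_le_pow (w x : List (Fin N)) : |wordProd e w x| ≤ b ^ x.length := by
  induction x generalizing w with
  | nil => simp [wordProd]
  | cons i x ih =>
    rw [wordProd, abs_mul, List.length_cons, pow_succ']
    exact mul_le_mul (he w i).2 (ih _) (abs_nonneg _) ((abs_nonneg _).trans (he w i).2)

include hb he in
lemma abs_wordProd_le_one (w x : List (Fin N)) : |wordProd e w x| ≤ 1 := by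
  induction x generalizing w with
  | nil => simp [wordProd]
  | cons i x ih =>
    rw [wordProd, abs_mul]
    exact mul_le_one₀ ((he w i).2.trans hb.le) (abs_nonneg _) (ih _)

include he in
lemma abs_wordMap_le {T R : ℝ} (hT : ∀ i, |c i| ≤ T) (hTR : b * R + (1 + b) * T ≤ R)
    (w x : List (Fin N)) {q : ℝ} (hq : |q| ≤ R) : |wordMap c e w x q| ≤ R := by
  induction x generalizing w with
  | nil => simpa [wordMap]
  | cons i x ih =>
    rw [wordMap]
    have hR : 0 ≤ R := (abs_nonneg _).trans hq
    have hb0 : 0 ≤ b := (abs_nonneg _).trans (he w i).2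
    calc |e w i * wordMap c e (w ++ [i]) x q + (1 - e w i) * c i|
        ≤ |e w i| * |wordMap c e (w ++ [i]) x q| + |1 - e w i| * |c i| := by
          rw [← abs_mul, ← abs_mul]; exact abs_add_le _ _
      _ ≤ b * R + (1 + b) * T := by
          gcongr
          · exact (he w i).2
          · exact ih _
          · calc |1 - e w i| ≤ |1| + |e w i| := abs_sub _ _
              _ ≤ 1 + b := by rw [abs_one]; linarith [(he w i).2]
          · exact hT i
      _ ≤ R := hTR

end Words

/-! ### Sub-σ-algebras generated by parts of an independent family -/

section SigmaOf

variable {ι Ω β : Type*} [MeasurableSpace β]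

/-- The σ-algebra generated by the variables `ξ i` with `i ∈ S`. -/
abbrev sigmaOf (ξ : ι → Ω → β) (S : Set ι) : MeasurableSpace Ω :=
  ⨆ i ∈ S, MeasurableSpace.comap (ξ i) inferInstance

lemma measurable_sigmaOf (ξ : ι → Ω → β) {S : Set ι} {i : ι} (hi : i ∈ S) :
    Measurable[sigmaOf ξ S] (ξ i) :=
  (comap_measurable (ξ i)).mono (le_iSup₂_of_le i hi le_rfl) le_rfl

lemma sigmaOf_mono (ξ : ι → Ω → β) {S T : Set ι} (h : S ⊆ T) : sigmaOf ξ S ≤ sigmaOf ξ T :=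
  biSup_mono h

variable [mΩ : MeasurableSpace Ω] {P : Measure Ω} {ξ : ι → Ω → β}

lemma sigmaOf_le (hξ : ∀ i, Measurable (ξ i)) (S : Set ι) : sigmaOf ξ S ≤ mΩ :=
  iSup₂_le fun i _ => (hξ i).comap_le

lemma indep_sigmaOf (hξ : ∀ i, Measurable (ξ i)) (hind : iIndepFun ξ P) {S T : Set ι}
    (hST : Disjoint S T) : Indep (sigmaOf ξ S) (sigmaOf ξ T) P :=
  indep_iSup_of_disjoint (fun i => (hξ i).comap_le) hind hST

lemma lintegral_mul_of_disjoint (hξ : ∀ i, Measurable (ξ i)) (hind : iIndepFun ξ P) {S T : Set ι}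
    (hST : Disjoint S T) {f g : Ω → ENNReal} (hf : Measurable[sigmaOf ξ S] f)
    (hg : Measurable[sigmaOf ξ T] g) :
    ∫⁻ ω, f ω * g ω ∂P = (∫⁻ ω, f ω ∂P) * ∫⁻ ω, g ω ∂P :=
  lintegral_mul_eq_lintegral_mul_lintegral_of_independent_measurableSpace (sigmaOf_le hξ S)
    (sigmaOf_le hξ T) (indep_sigmaOf hξ hind hST) hf hg

lemma lintegral_comp_of_disjoint [IsProbabilityMeasure P] (hξ : ∀ i, Measurable (ξ i))
    (hind : iIndepFun ξ P) {S T : Set ι} (hST : Disjoint S T) {γ δ : Type*} [MeasurableSpace γ]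
    [MeasurableSpace δ] {X : Ω → γ} {Y : Ω → δ} (hX : Measurable[sigmaOf ξ S] X)
    (hY : Measurable[sigmaOf ξ T] Y) {F : γ × δ → ENNReal} (hF : Measurable F) :
    ∫⁻ ω, F (X ω, Y ω) ∂P = ∫⁻ ω', ∫⁻ ω, F (X ω, Y ω') ∂P ∂P := by
  have hX' : Measurable X := hX.mono (sigmaOf_le hξ S) le_rfl
  have hY' : Measurable Y := hY.mono (sigmaOf_le hξ T) le_rfl
  have hi : IndepFun X Y P := by
    rw [IndepFun_iff_Indep]
    exact indep_of_indep_of_le_right (indep_of_indep_of_le_left (indep_sigmaOf hξ hind hST)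
      hX.comap_le) hY.comap_le
  have e := (indepFun_iff_map_prod_eq_prod_map_map hX'.aemeasurable hY'.aemeasurable).mp hi
  rw [← lintegral_map (f := F) (g := fun ω => (X ω, Y ω)) hF (hX'.prodMk hY'), e,
    lintegral_prod_symm' _ hF, lintegral_map (by fun_prop) hY']
  refine lintegral_congr fun ω' => ?_
  rw [lintegral_map (by fun_prop) hX']

end SigmaOf

/-! ### Random ratios on the tree of words: one coordinate -/

section RatioField

variable {N : ℕ} {Ω : Type*}

/-- The nodes of the tree of words at which a ratio is read when the word `x` is read below `w`. -/
def pathSet (w x : List (Fin N)) : Set (List (Fin N)) :=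
  {z | w <+: z ∧ z <+: w ++ x ∧ z.length < (w ++ x).length}

lemma mem_pathSet_cons (w : List (Fin N)) (i : Fin N) (x : List (Fin N)) :
    w ∈ pathSet w (i :: x) := by
  refine ⟨List.prefix_rfl, List.prefix_append _ _, ?_⟩
  simp

lemma pathSet_subset_cons (w : List (Fin N)) (i : Fin N) (x : List (Fin N)) :
    pathSet (w ++ [i]) x ⊆ pathSet w (i :: x) := by
  rintro z ⟨h1, h2, h3⟩
  refine ⟨(List.prefix_append w [i]).trans h1, by simpa using h2, by simpa using h3⟩

lemma measurable_wordProd (ξ : List (Fin N) → Ω → Fin N → ℝ) {S : Set (List (Fin N))}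
    {w x : List (Fin N)} (h : pathSet w x ⊆ S) :
    Measurable[sigmaOf ξ S] fun ω => wordProd (fun z => ξ z ω) w x := by
  induction x generalizing w with
  | nil => exact measurable_const
  | cons i x ih =>
    have h1 : Measurable[sigmaOf ξ S] fun ω => ξ w ω i :=
      (measurable_pi_apply i).comp (measurable_sigmaOf ξ (h (mem_pathSet_cons w i x)))
    exact h1.mul (ih ((pathSet_subset_cons w i x).trans h))

lemma measurable_wordMap (ξ : List (Fin N) → Ω → Fin N → ℝ) (c : Fin N → ℝ)
    {S : Set (List (Fin N))} {w x : List (Fin N)} (h : pathSet w x ⊆ S) (q : ℝ) :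
    Measurable[sigmaOf ξ S] fun ω => wordMap c (fun z => ξ z ω) w x q := by
  induction x generalizing w with
  | nil => exact measurable_const
  | cons i x ih =>
    have h1 : Measurable[sigmaOf ξ S] fun ω => ξ w ω i :=
      (measurable_pi_apply i).comp (measurable_sigmaOf ξ (h (mem_pathSet_cons w i x)))
    have h2 := ih ((pathSet_subset_cons w i x).trans h)
    exact (h1.mul h2).add ((measurable_const.sub h1).mul measurable_const)

/-- The weight `|product of ratios| ^ p` of the word `x` read below `w`. -/
noncomputable def weight (ξ : List (Fin N) → Ω → Fin N → ℝ) (p : ℝ) (w x : List (Fin N)) (ω : Ω) :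
    ENNReal :=
  ENNReal.ofReal (|wordProd (fun z => ξ z ω) w x| ^ p)

lemma weight_append (ξ : List (Fin N) → Ω → Fin N → ℝ) (p : ℝ) (w x y : List (Fin N)) (ω : Ω) :
    weight ξ p w (x ++ y) ω = weight ξ p w x ω * weight ξ p (w ++ x) y ω := by
  unfold weight
  rw [wordProd_append, abs_mul, Real.mul_rpow (abs_nonneg _) (abs_nonneg _),
    ENNReal.ofReal_mul (by positivity)]

lemma measurable_weight (ξ : List (Fin N) → Ω → Fin N → ℝ) (p : ℝ) {S : Set (List (Fin N))}
    {w x : List (Fin N)} (h : pathSet w x ⊆ S) : Measurable[sigmaOf ξ S] (weight ξ p w x) := by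
  have h1 := measurable_wordProd ξ h
  have : Measurable fun y : ℝ => ENNReal.ofReal (|y| ^ p) := by fun_prop
  exact this.comp h1

variable [MeasurableSpace Ω]

/-- Random ratios on the tree of words, for one coordinate: the vectors of ratios of the children
of the nodes are independent and identically distributed, and the ratios have modulus in
`[a, b] ⊆ (0, 1)`. -/
structure IsRatioField (P : Measure Ω) (a b : ℝ) (ξ : List (Fin N) → Ω → Fin N → ℝ) : Prop where
  pos : 0 < a
  le : a ≤ b
  lt_one : b < 1
  measurable : ∀ w, Measurable (ξ w)
  indep : iIndepFun ξ P
  ident : ∀ w w', IdentDistrib (ξ w) (ξ w') P P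
  bound : ∀ w ω i, |ξ w ω i| ∈ Set.Icc a b

/-- The expected weight of a word. -/
noncomputable def wordMoment (P : Measure Ω) (ξ : List (Fin N) → Ω → Fin N → ℝ) (p : ℝ)
    (x : List (Fin N)) : ENNReal :=
  (x.map fun i => ∫⁻ ω, ENNReal.ofReal (|ξ [] ω i| ^ p) ∂P).prod

lemma wordMoment_append (P : Measure Ω) (ξ : List (Fin N) → Ω → Fin N → ℝ) (p : ℝ)
    (x y : List (Fin N)) : wordMoment P ξ p (x ++ y) = wordMoment P ξ p x * wordMoment P ξ p y := by
  simp [wordMoment]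

variable {P : Measure Ω} {a b : ℝ} {ξ : List (Fin N) → Ω → Fin N → ℝ} (h : IsRatioField P a b ξ)
include h

lemma weight_le_one {p : ℝ} (hp : 0 ≤ p) (w x : List (Fin N)) (ω : Ω) :
    weight ξ p w x ω ≤ 1 := by
  unfold weight
  rw [← ENNReal.ofReal_one]
  exact ENNReal.ofReal_le_ofReal (Real.rpow_le_one (abs_nonneg _)
    (abs_wordProd_le_one h.lt_one (fun w i => h.bound w ω i) w x) hp)

lemma lintegral_weight (p : ℝ) (w x : List (Fin N)) :
    ∫⁻ ω, weight ξ p w x ω ∂P = wordMoment P ξ p x := by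
  have := h.indep.isProbabilityMeasure
  induction x generalizing w with
  | nil => simp [weight, wordProd, wordMoment]
  | cons i x ih =>
    have e1 : ∀ ω, weight ξ p w (i :: x) ω =
        weight ξ p w [i] ω * weight ξ p (w ++ [i]) x ω := fun ω =>
      weight_append ξ p w [i] x ω
    have hd : Disjoint (pathSet w [i]) (pathSet (w ++ [i]) x) := by
      refine Set.disjoint_left.mpr fun z hz hz' => ?_
      have h1 := hz.2.2
      have h2 := hz'.1.length_le
      omega
    simp_rw [e1]
    rw [lintegral_mul_of_disjoint h.measurable h.indep hd (measurable_weight ξ p subset_rfl)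
      (measurable_weight ξ p subset_rfl), ih]
    have e2 : ∫⁻ ω, weight ξ p w [i] ω ∂P = ∫⁻ ω, ENNReal.ofReal (|ξ [] ω i| ^ p) ∂P := by
      have hm : Measurable fun y : Fin N → ℝ => ENNReal.ofReal (|y i| ^ p) := by fun_prop
      simpa [weight, wordProd] using ((h.ident w []).comp hm).lintegral_eq
    rw [e2]
    simp [wordMoment]

/-- The logarithm of the modulus of the product along a run `l ⋯ l` of length `n` is distributed
as the `n`-fold convolution of the law of `log |ξ ∅ l|`. -/
lemma map_log_wordProd_replicate (w : List (Fin N)) (n : ℕ) (l : Fin N) :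
    P.map (fun ω => Real.log |wordProd (fun z => ξ z ω) w (List.replicate n l)|) =
      convPow (P.map fun ω => Real.log |ξ [] ω l|) n := by
  have := h.indep.isProbabilityMeasure
  induction n with
  | zero => simp [wordProd, convPow]
  | succ n ih =>
    set X : Ω → ℝ := fun ω => Real.log |wordProd (fun z => ξ z ω) w (List.replicate n l)|
    set Y : Ω → ℝ := fun ω => Real.log |ξ (w ++ List.replicate n l) ω l|
    have hXm : Measurable[sigmaOf ξ (pathSet w (List.replicate n l))] X :=
      (measurable_norm.comp (measurable_wordProd ξ subset_rfl)).log
    have hYm : Measurable[sigmaOf ξ {w ++ List.replicate n l}] Y := by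
      have : Measurable fun y : Fin N → ℝ => Real.log |y l| := by fun_prop
      exact this.comp (measurable_sigmaOf ξ rfl)
    have hXY : IndepFun X Y P := by
      rw [IndepFun_iff_Indep]
      refine indep_of_indep_of_le_right (indep_of_indep_of_le_left
        (indep_sigmaOf h.measurable h.indep ?_) hXm.comap_le) hYm.comap_le
      rw [Set.disjoint_singleton_right]
      exact fun hz => lt_irrefl _ hz.2.2
    have e : (fun ω => Real.log |wordProd (fun z => ξ z ω) w (List.replicate (n + 1) l)|) =
        X + Y := by
      funext ω
      have h1 := abs_wordProd_pos h.pos (fun w i => h.bound w ω i) w (List.replicate n l)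
      have h2 := h.pos.trans_le (h.bound (w ++ List.replicate n l) ω l).1
      rw [List.replicate_succ', wordProd_append, abs_mul, Real.log_mul]
      · simp [wordProd, X, Y]
      · exact h1.ne'
      · simpa [wordProd] using h2.ne'
    have hX' := hXm.mono (sigmaOf_le h.measurable _) le_rfl
    have hY' := hYm.mono (sigmaOf_le h.measurable _) le_rfl
    rw [e, hXY.map_add_eq_map_conv_map₀ hX'.aemeasurable hY'.aemeasurable, ih, convPow]
    congr 1
    have hm : Measurable fun y : Fin N → ℝ => Real.log |y l| := by fun_prop
    exact ((h.ident (w ++ List.replicate n l) []).comp hm).map_eq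

/-- Eventual smoothness bounds the density of the logarithm of the product along a long run: the
density is continuous and only its values on a compact interval matter. -/
lemma exists_map_log_le (l : Fin N)
    (hl : EventuallySmooth (P.map fun ω => Real.log |ξ [] ω l|)) :
    ∃ n : ℕ, ∃ C : ℝ, 0 ≤ C ∧ ∀ w : List (Fin N),
      P.map (fun ω => Real.log |wordProd (fun z => ξ z ω) w (List.replicate n l)|) ≤
        ENNReal.ofReal C • volume := by
  obtain ⟨n, -, g, hg, hg0, hconv⟩ := hl
  set I := Set.Icc (n * Real.log a) 0
  obtain ⟨C, hC⟩ := (isCompact_Icc (a := n * Real.log a) (b := 0)).bddAbove_image hg.continuousOn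
  refine ⟨n, max C 0, le_max_right _ _, fun w => ?_⟩
  have hm : Measurable fun ω => Real.log |wordProd (fun z => ξ z ω) w (List.replicate n l)| :=
    ((measurable_norm.comp (measurable_wordProd ξ subset_rfl)).log).mono
      (sigmaOf_le h.measurable _) le_rfl
  refine Measure.le_iff.mpr fun E hE => ?_
  have h1 : P.map (fun ω => Real.log |wordProd (fun z => ξ z ω) w (List.replicate n l)|) E =
      P.map (fun ω => Real.log |wordProd (fun z => ξ z ω) w (List.replicate n l)|) (E ∩ I) := by
    rw [Measure.map_apply hm hE, Measure.map_apply hm (hE.inter measurableSet_Icc)]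
    congr 1
    ext ω
    have hlow := pow_le_abs_wordProd h.pos (fun w i => h.bound w ω i) w (List.replicate n l)
    have hup := abs_wordProd_le_one h.lt_one (fun w i => h.bound w ω i) w (List.replicate n l)
    have hpos := abs_wordProd_pos h.pos (fun w i => h.bound w ω i) w (List.replicate n l)
    simp only [Set.mem_preimage, Set.mem_inter_iff, iff_self_and]
    intro _
    refine ⟨?_, Real.log_nonpos hpos.le hup⟩
    rw [← Real.log_pow]
    refine Real.log_le_log (pow_pos h.pos _) ?_
    simpa using hlow
  rw [h1, map_log_wordProd_replicate h, hconv, withDensity_apply _ (hE.inter measurableSet_Icc)]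
  calc ∫⁻ x in E ∩ I, ENNReal.ofReal (g x) ≤ ∫⁻ _x in E ∩ I, ENNReal.ofReal (max C 0) := by
        refine setLIntegral_mono measurable_const fun x hx => ENNReal.ofReal_le_ofReal ?_
        exact (hC (Set.mem_image_of_mem g hx.2)).trans (le_max_left _ _)
    _ = ENNReal.ofReal (max C 0) * volume (E ∩ I) := setLIntegral_const _ _
    _ ≤ _ := by
        rw [Measure.smul_apply, smul_eq_mul]
        gcongr
        exact Set.inter_subset_left

end RatioField

/-! ### Transversality in one coordinate -/

lemma lintegral_affine_exp_le {κ : ℝ → ENNReal} {A D : ℝ} (hA : A ≠ 0) (hD : D ≠ 0)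
    (c s₀ R : ℝ) :
    ∫⁻ s in {s | s₀ ≤ s ∧ |c + D * Real.exp s| ≤ R}, κ (A * (c + D * Real.exp s)) ≤
      ENNReal.ofReal (1 / (|A| * |D| * Real.exp s₀)) *
        ∫⁻ z in Set.Icc (-(|A| * R)) (|A| * R), κ z := by
  set E := {s | s₀ ≤ s ∧ |c + D * Real.exp s| ≤ R}
  have hE : MeasurableSet E := by
    apply IsClosed.measurableSet
    have h1 : IsClosed {s : ℝ | s₀ ≤ s} := isClosed_le continuous_const continuous_id
    have h2 : IsClosed {s : ℝ | |c + D * Real.exp s| ≤ R} :=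
      isClosed_le (by fun_prop) continuous_const
    exact h1.inter h2
  set f : ℝ → ℝ := fun s => A * (c + D * Real.exp s)
  have hf : ∀ s ∈ E, HasDerivWithinAt f (A * (D * Real.exp s)) E s := fun s _ =>
    ((((Real.hasDerivAt_exp s).const_mul D).const_add c).const_mul A).hasDerivWithinAt
  have hinj : Set.InjOn f E := by
    intro s _ s' _ hss
    have : A * (c + D * Real.exp s) = A * (c + D * Real.exp s') := hss
    simpa [hA, hD] using this
  have hpos : 0 < |A| * |D| * Real.exp s₀ :=
    mul_pos (mul_pos (abs_pos.mpr hA) (abs_pos.mpr hD)) (Real.exp_pos _)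
  have h1 := lintegral_image_eq_lintegral_abs_deriv_mul hE hf hinj κ
  have h2 : ENNReal.ofReal (|A| * |D| * Real.exp s₀) * ∫⁻ s in E, κ (f s) ≤
      ∫⁻ z in Set.Icc (-(|A| * R)) (|A| * R), κ z := by
    rw [← lintegral_const_mul' _ _ ENNReal.ofReal_ne_top]
    calc ∫⁻ s in E, ENNReal.ofReal (|A| * |D| * Real.exp s₀) * κ (f s)
        ≤ ∫⁻ s in E, ENNReal.ofReal |A * (D * Real.exp s)| * κ (f s) := by
          refine setLIntegral_mono' hE fun s hs => ?_
          gcongr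
          rw [abs_mul, abs_mul, abs_of_pos (Real.exp_pos s), mul_assoc]
          gcongr
          exact hs.1
      _ = ∫⁻ z in f '' E, κ z := h1.symm
      _ ≤ _ := by
          refine lintegral_mono_set ?_
          rintro _ ⟨s, hs, rfl⟩
          refine Set.mem_Icc.mpr (abs_le.mp ?_)
          rw [abs_mul]
          gcongr
          exact hs.2
  calc ∫⁻ s in E, κ (f s) = ENNReal.ofReal (1 / (|A| * |D| * Real.exp s₀)) *
        (ENNReal.ofReal (|A| * |D| * Real.exp s₀) * ∫⁻ s in E, κ (f s)) := by
        rw [← mul_assoc, ← ENNReal.ofReal_mul (by positivity), one_div_mul_cancel hpos.ne',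
          ENNReal.ofReal_one, one_mul]
    _ ≤ _ := by gcongr

section RatioField

variable {N : ℕ} {Ω : Type*} [MeasurableSpace Ω]
variable {P : Measure Ω} {a b : ℝ} {ξ : List (Fin N) → Ω → Fin N → ℝ} (h : IsRatioField P a b ξ)
include h

lemma lintegral_weight_mul_weight_mul_weight (p : ℝ) (w₀ w u u' x y : List (Fin N))
    (hlen : u.length = u'.length) (hne : u ≠ u') (v : List (Fin N)) :
    ∫⁻ ω, weight ξ p w₀ w ω * (weight ξ p (w₀ ++ w ++ u ++ v) x ω *
        weight ξ p (w₀ ++ w ++ u' ++ v) y ω) ∂P =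
      wordMoment P ξ p w * (wordMoment P ξ p x * wordMoment P ξ p y) := by
  have hpre : ∀ z, w₀ ++ w ++ u <+: z → w₀ ++ w ++ u' <+: z → False := by
    intro z h1 h2
    have h3 := (List.prefix_of_prefix_length_le h1 h2 (by simp [hlen])).eq_of_length
      (by simp [hlen])
    exact hne (List.append_cancel_left h3)
  have d1 : Disjoint (pathSet w₀ w) {z | (w₀ ++ w).length ≤ z.length} :=
    Set.disjoint_left.mpr fun z hz hz' => absurd hz.2.2 (not_lt.mpr hz')
  have d2 : Disjoint (pathSet (w₀ ++ w ++ u ++ v) x) (pathSet (w₀ ++ w ++ u' ++ v) y) :=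
    Set.disjoint_left.mpr fun z hz hz' =>
      hpre z ((List.prefix_append _ _).trans hz.1) ((List.prefix_append _ _).trans hz'.1)
  have s1 : ∀ u x : List (Fin N), pathSet (w₀ ++ w ++ u ++ v) x ⊆
      {z | (w₀ ++ w).length ≤ z.length} := by
    intro u x z hz
    have := hz.1.length_le
    simp only [List.length_append] at this
    simp only [Set.mem_ofPred_eq, List.length_append]
    omega
  rw [lintegral_mul_of_disjoint h.measurable h.indep d1 (measurable_weight ξ p subset_rfl)
    ((measurable_weight ξ p (s1 u x)).fun_mul (measurable_weight ξ p (s1 u' y))),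
    lintegral_mul_of_disjoint h.measurable h.indep d2 (measurable_weight ξ p subset_rfl)
    (measurable_weight ξ p subset_rfl), lintegral_weight h, lintegral_weight h, lintegral_weight h]

/-- The key estimate for two words that separate after `w`, at distinct continuations `u`, `u'` of
equal length, each followed by a word containing a run of the letter `l`. Conditionally on all
other ratios, the logarithm of the product along the run below `u` has a bounded density, so
that the difference of the two points is spread over an interval whose length is comparable to the
ratio of `w`. -/
lemma lintegral_weight_mul_kernel_le {p : ℝ} (hp : 0 ≤ p) {c : Fin N → ℝ} {T R : ℝ}
    (hT : ∀ i, |c i| ≤ T) (hTR : b * R + (1 + b) * T ≤ R) {n : ℕ} {l : Fin N} {C : ℝ} (hC : 0 ≤ C)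
    (hdens : ∀ w : List (Fin N),
      P.map (fun ω => Real.log |wordProd (fun z => ξ z ω) w (List.replicate n l)|) ≤
        ENNReal.ofReal C • volume)
    {v₁ v₂ : List (Fin N)} {δ : ℝ} (hδ : 0 < δ)
    (hv₂ : ∀ w ω q, |q| ≤ R → δ ≤ |wordMap c (fun z => ξ z ω) w v₂ q - c l|)
    {κ : ℝ → ENNReal} (hκ : Measurable κ) {K : ENNReal}
    (hK : ∀ A : ℝ, 0 < A → A ≤ 1 → ∫⁻ z in Set.Icc (-(A * (2 * R))) (A * (2 * R)), κ z ≤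
      K * ENNReal.ofReal (A ^ (1 - p)))
    (w₀ w u u' x y : List (Fin N)) (hlen : u.length = u'.length) (hne : u ≠ u') {q : ℝ}
    (hq : |q| ≤ R) (v : List (Fin N)) (hv : v = v₁ ++ (List.replicate n l ++ v₂)) :
    ∫⁻ ω, weight ξ p w₀ (w ++ (u ++ v ++ x)) ω * weight ξ p w₀ (w ++ (u' ++ v ++ y)) ω *
      κ (wordMap c (fun z => ξ z ω) w₀ (w ++ (u ++ v ++ x)) q -
        wordMap c (fun z => ξ z ω) w₀ (w ++ (u' ++ v ++ y)) q) ∂P ≤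
      2 * ENNReal.ofReal (C / (a ^ (u.length + v₁.length) * δ * a ^ n)) * K *
        (wordMoment P ξ p w * (wordMoment P ξ p x * wordMoment P ξ p y)) := by
  have := h.indep.isProbabilityMeasure
  have hbd := fun ω w i => h.bound w ω i
  set w₁ := w₀ ++ w
  set w₂ := w₁ ++ (u ++ v₁)
  set w₃ := w₂ ++ List.replicate n l
  set run : Set (List (Fin N)) := pathSet w₂ (List.replicate n l)
  set A : Ω → ℝ := fun ω => wordProd (fun z => ξ z ω) w₀ w
  set Q : Ω → ℝ := fun ω => wordProd (fun z => ξ z ω) w₂ (List.replicate n l)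
  set S : Ω → ℝ := fun ω => Real.log |Q ω|
  set Z : Ω → ℝ := fun ω => wordMap c (fun z => ξ z ω) w₃ (v₂ ++ x) q
  set D : Ω → ℝ := fun ω => wordProd (fun z => ξ z ω) w₁ (u ++ v₁) * (Z ω - c l)
  set c' : Ω → ℝ := fun ω => wordMap c (fun z => ξ z ω) w₁ (u ++ v₁) (c l) -
    wordMap c (fun z => ξ z ω) w₁ (u' ++ v ++ y) q
  set H : Ω → ENNReal := fun ω => weight ξ p w₀ w ω * (weight ξ p w₀ w ω *
    (weight ξ p (w₁ ++ u ++ v) x ω * weight ξ p (w₁ ++ u' ++ v) y ω))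
  set s₀ : ℝ := n * Real.log a
  have hes₀ : Real.exp s₀ = a ^ n := by
    simp only [s₀, ← Real.log_pow, Real.exp_log (pow_pos h.pos _)]
  -- nodes met outside the run
  have hpre : ∀ z, w₁ ++ u <+: z → z <+: w₁ ++ (u' ++ v ++ y) → False := by
    intro z h1 h2
    have h3 := (List.prefix_append_right_inj w₁).mp (h1.trans h2)
    rw [List.append_assoc] at h3
    have h4 := (List.prefix_of_prefix_length_le h3 (List.prefix_append u' _) hlen.le).eq_of_length
      hlen
    exact hne h4
  have hrun : ∀ z ∈ run, w₁ ++ u <+: z := fun z hz =>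
    (by simp [w₂] : w₁ ++ u <+: w₂).trans hz.1
  have hrunlen : ∀ z ∈ run, w₂.length ≤ z.length := fun z hz => hz.1.length_le
  have m1 : pathSet w₀ w ⊆ runᶜ := fun z hz hz' => by
    have h1 := hz.2.2
    have h2 := hrunlen z hz'
    simp only [w₂, w₁, List.length_append] at h1 h2
    omega
  have m2 : pathSet w₁ (u ++ v₁) ⊆ runᶜ := fun z hz hz' =>
    absurd hz.2.2 (not_lt.mpr (hrunlen z hz'))
  have m3 : pathSet w₃ (v₂ ++ x) ⊆ runᶜ := fun z hz hz' =>
    absurd hz'.2.2 (not_lt.mpr hz.1.length_le)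
  have m4 : pathSet w₁ (u' ++ v ++ y) ⊆ runᶜ := fun z hz hz' =>
    hpre z (hrun z hz') hz.2.1
  have m5 : pathSet (w₁ ++ u ++ v) x ⊆ runᶜ := fun z hz hz' => by
    have h1 := hz'.2.2
    have h2 := hz.1.length_le
    simp only [hv, w₂, List.length_append] at h1 h2
    omega
  have m6 : pathSet (w₁ ++ u' ++ v) y ⊆ runᶜ := fun z hz hz' =>
    hpre z (hrun z hz') (by simpa using hz.2.1)
  have mS : Measurable[sigmaOf ξ run] S :=
    (measurable_norm.comp (measurable_wordProd ξ subset_rfl)).log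
  have mA : Measurable[sigmaOf ξ runᶜ] A := measurable_wordProd ξ m1
  have mD : Measurable[sigmaOf ξ runᶜ] D :=
    (measurable_wordProd ξ m2).mul ((measurable_wordMap ξ c m3 q).sub measurable_const)
  have mc' : Measurable[sigmaOf ξ runᶜ] c' :=
    (measurable_wordMap ξ c m2 _).sub (measurable_wordMap ξ c m4 _)
  have mH : Measurable[sigmaOf ξ runᶜ] H :=
    (measurable_weight ξ p m1).mul ((measurable_weight ξ p m1).mul
      ((measurable_weight ξ p m5).mul (measurable_weight ξ p m6)))
  have mY : Measurable[sigmaOf ξ runᶜ] fun ω => (A ω, c' ω, D ω, H ω) :=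
    mA.prodMk (mc'.prodMk (mD.prodMk mH))
  -- the integrand as a function of the run and of the remaining ratios
  set G : ℝ → ℝ → ℝ → ℝ → ENNReal := fun s A c' D =>
    Set.indicator {s | s₀ ≤ s ∧ |c' + D * Real.exp s| ≤ 2 * R}
      (fun s => κ (A * (c' + D * Real.exp s))) s
  set F : ℝ × ℝ × ℝ × ℝ × ENNReal → ENNReal := fun y =>
    y.2.2.2.2 * (G y.1 y.2.1 y.2.2.1 y.2.2.2.1 + G y.1 y.2.1 y.2.2.1 (-y.2.2.2.1))
  have mG : ∀ σ : ℝ, Measurable fun y : ℝ × ℝ × ℝ × ℝ × ENNReal =>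
      G y.1 y.2.1 y.2.2.1 (σ * y.2.2.2.1) := by
    intro σ
    have hs : MeasurableSet {y : ℝ × ℝ × ℝ × ℝ × ENNReal |
        s₀ ≤ y.1 ∧ |y.2.2.1 + σ * y.2.2.2.1 * Real.exp y.1| ≤ 2 * R} := by
      have h1 : MeasurableSet {y : ℝ × ℝ × ℝ × ℝ × ENNReal | s₀ ≤ y.1} :=
        measurableSet_le (by fun_prop) (by fun_prop)
      have h2 : MeasurableSet {y : ℝ × ℝ × ℝ × ℝ × ENNReal |
          |y.2.2.1 + σ * y.2.2.2.1 * Real.exp y.1| ≤ 2 * R} :=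
        measurableSet_le (by fun_prop) (by fun_prop)
      exact h1.inter h2
    exact Measurable.indicator (f := fun y : ℝ × ℝ × ℝ × ℝ × ENNReal =>
      κ (y.2.1 * (y.2.2.1 + σ * y.2.2.2.1 * Real.exp y.1))) (hκ.comp (by fun_prop)) hs
  have mF : Measurable F := by
    have h1 := mG 1
    have h2 := mG (-1)
    simp only [one_mul, neg_one_mul] at h1 h2
    exact Measurable.mul (by fun_prop) (h1.add h2)
  have hQpos : ∀ ω, 0 < |Q ω| := fun ω => abs_wordProd_pos h.pos (hbd ω) _ _
  have hApos : ∀ ω, 0 < |A ω| := fun ω => abs_wordProd_pos h.pos (hbd ω) _ _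
  have hZ : ∀ ω, δ ≤ |Z ω - c l| := by
    intro ω
    simp only [Z, wordMap_append]
    exact hv₂ _ _ _ (abs_wordMap_le (hbd ω) hT hTR _ _ hq)
  have hDlow : ∀ ω, a ^ (u.length + v₁.length) * δ ≤ |D ω| := by
    intro ω
    simp only [D, abs_mul]
    have h1 := pow_le_abs_wordProd h.pos (hbd ω) w₁ (u ++ v₁)
    rw [List.length_append] at h1
    exact mul_le_mul h1 (hZ ω) hδ.le (abs_nonneg _)
  have hdiff : ∀ ω, wordMap c (fun z => ξ z ω) w₀ (w ++ (u ++ v ++ x)) q -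
      wordMap c (fun z => ξ z ω) w₀ (w ++ (u' ++ v ++ y)) q = A ω * (c' ω + D ω * Q ω) ∧
      |c' ω + D ω * Q ω| ≤ 2 * R := by
    intro ω
    have e0 : c' ω + D ω * Q ω = wordMap c (fun z => ξ z ω) w₁ (u ++ v ++ x) q -
        wordMap c (fun z => ξ z ω) w₁ (u' ++ v ++ y) q := by
      have e1 : u ++ v ++ x = (u ++ v₁) ++ (List.replicate n l ++ (v₂ ++ x)) := by
        simp [hv]
      rw [e1, wordMap_append _ _ w₁ (u ++ v₁), wordMap_append _ _ _ (List.replicate n l),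
        wordMap_replicate]
      have e2 := wordMap_sub c (fun z => ξ z ω) w₁ (u ++ v₁) (c l + Q ω * (Z ω - c l)) (c l)
      simp only [c', D]
      linear_combination -e2
    refine ⟨?_, ?_⟩
    · rw [e0, wordMap_append, wordMap_append _ _ w₀ w, wordMap_sub]
    · rw [e0]
      have h1 := abs_wordMap_le (hbd ω) hT hTR w₁ (u ++ v ++ x) hq
      have h2 := abs_wordMap_le (hbd ω) hT hTR w₁ (u' ++ v ++ y) hq
      exact (abs_sub _ _).trans (by linarith)
  have hpt : ∀ ω, weight ξ p w₀ (w ++ (u ++ v ++ x)) ω * weight ξ p w₀ (w ++ (u' ++ v ++ y)) ω *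
      κ (wordMap c (fun z => ξ z ω) w₀ (w ++ (u ++ v ++ x)) q -
        wordMap c (fun z => ξ z ω) w₀ (w ++ (u' ++ v ++ y)) q) ≤ F (S ω, A ω, c' ω, D ω, H ω) := by
    intro ω
    obtain ⟨e1, e2⟩ := hdiff ω
    rw [e1]
    simp only [F]
    refine mul_le_mul' ?_ ?_
    · have e3 : ∀ (u x : List (Fin N)), weight ξ p w₀ (w ++ (u ++ v ++ x)) ω =
          weight ξ p w₀ w ω * (weight ξ p w₁ (u ++ v) ω * weight ξ p (w₁ ++ u ++ v) x ω) := by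
        intro u x
        rw [weight_append, weight_append, List.append_assoc w₁ u v]
      rw [e3, e3]
      have l1 := weight_le_one h hp w₁ (u ++ v) ω
      have l2 := weight_le_one h hp w₁ (u' ++ v) ω
      calc _ ≤ weight ξ p w₀ w ω * (1 * weight ξ p (w₁ ++ u ++ v) x ω) *
            (weight ξ p w₀ w ω * (1 * weight ξ p (w₁ ++ u' ++ v) y ω)) := by gcongr
        _ = H ω := by simp only [H]; ring
    · have hS : Real.exp (S ω) = |Q ω| := Real.exp_log (hQpos ω)
      have hs : s₀ ≤ S ω := by
        simp only [s₀, S, ← Real.log_pow]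
        refine Real.log_le_log (pow_pos h.pos _) ?_
        simpa using pow_le_abs_wordProd h.pos (hbd ω) w₂ (List.replicate n l)
      rcases le_total 0 (Q ω) with h0 | h0
      · refine le_trans ?_ le_self_add
        have e : D ω * Q ω = D ω * Real.exp (S ω) := by rw [hS, abs_of_nonneg h0]
        simp only [G]
        rw [e] at e2 ⊢
        rw [Set.indicator_of_mem (by exact ⟨hs, e2⟩)]
      · refine le_trans ?_ le_add_self
        have e : D ω * Q ω = -D ω * Real.exp (S ω) := by rw [hS, abs_of_nonpos h0]; ring
        simp only [G]
        rw [e] at e2 ⊢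
        rw [Set.indicator_of_mem (by exact ⟨hs, e2⟩)]
  -- integration over the run
  have hGint : ∀ A c' D : ℝ, 0 < |A| → |A| ≤ 1 → a ^ (u.length + v₁.length) * δ ≤ |D| →
      ∫⁻ ω, G (S ω) A c' D ∂P ≤
        ENNReal.ofReal (C / (a ^ (u.length + v₁.length) * δ * a ^ n)) * K *
          ENNReal.ofReal (|A| ^ (-p)) := by
    intro A c' D hA hA1 hD
    have hδ' : 0 < a ^ (u.length + v₁.length) * δ := mul_pos (pow_pos h.pos _) hδ
    have hD0 : 0 < |D| := hδ'.trans_le hD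
    have mG1 : Measurable fun s => G s A c' D := by
      have := (mG 1).comp (measurable_id.prodMk measurable_const :
        Measurable fun s : ℝ => (s, A, c', D, (0 : ENNReal)))
      simpa [Function.comp_def] using this
    have hms : MeasurableSet {s | s₀ ≤ s ∧ |c' + D * Real.exp s| ≤ 2 * R} := by
      have h1 : MeasurableSet {s : ℝ | s₀ ≤ s} := measurableSet_le (by fun_prop) (by fun_prop)
      have h2 : MeasurableSet {s : ℝ | |c' + D * Real.exp s| ≤ 2 * R} :=
        measurableSet_le (by fun_prop) (by fun_prop)
      exact h1.inter h2
    rw [← lintegral_map (f := fun s => G s A c' D) mG1 (mS.mono (sigmaOf_le h.measurable _) le_rfl)]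
    calc ∫⁻ s, G s A c' D ∂(P.map S)
        ≤ ∫⁻ s, G s A c' D ∂(ENNReal.ofReal C • volume) := lintegral_mono' (hdens w₂) le_rfl
      _ = ENNReal.ofReal C * ∫⁻ s in {s | s₀ ≤ s ∧ |c' + D * Real.exp s| ≤ 2 * R},
            κ (A * (c' + D * Real.exp s)) := by
          rw [lintegral_smul_measure, smul_eq_mul, ← lintegral_indicator hms]
      _ ≤ ENNReal.ofReal C * (ENNReal.ofReal (1 / (|A| * |D| * Real.exp s₀)) *
            (K * ENNReal.ofReal (|A| ^ (1 - p)))) := by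
          gcongr
          refine (lintegral_affine_exp_le (abs_pos.mp hA) (abs_pos.mp hD0) c' s₀ (2 * R)).trans ?_
          gcongr
          exact hK |A| hA hA1
      _ = ENNReal.ofReal (C * (1 / (|A| * |D| * Real.exp s₀)) * |A| ^ (1 - p)) * K := by
          rw [ENNReal.ofReal_mul (by positivity), ENNReal.ofReal_mul hC]
          ring
      _ ≤ ENNReal.ofReal (C / (a ^ (u.length + v₁.length) * δ * a ^ n) * |A| ^ (-p)) * K := by
          gcongr ENNReal.ofReal ?_ * K
          have e : |A| ^ (1 - p) = |A| * |A| ^ (-p) := by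
            rw [sub_eq_add_neg, Real.rpow_add hA, Real.rpow_one]
          have e' : C * (1 / (|A| * |D| * Real.exp s₀)) * (|A| * |A| ^ (-p)) =
              C / (|D| * a ^ n) * |A| ^ (-p) := by
            rw [hes₀]; field_simp
          rw [e, e']
          have := pow_pos h.pos n
          gcongr
      _ = _ := by
          rw [ENNReal.ofReal_mul (by positivity [pow_pos h.pos n])]
          ring
  calc _ ≤ ∫⁻ ω, F (S ω, A ω, c' ω, D ω, H ω) ∂P := lintegral_mono hpt
    _ = ∫⁻ ω', ∫⁻ ω, F (S ω, A ω', c' ω', D ω', H ω') ∂P ∂P :=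
        lintegral_comp_of_disjoint h.measurable h.indep disjoint_compl_right mS mY mF
    _ ≤ ∫⁻ ω', 2 * ENNReal.ofReal (C / (a ^ (u.length + v₁.length) * δ * a ^ n)) * K *
          (weight ξ p w₀ w ω' * (weight ξ p (w₀ ++ w ++ u ++ v) x ω' *
            weight ξ p (w₀ ++ w ++ u' ++ v) y ω')) ∂P := by
        refine lintegral_mono fun ω' => ?_
        have hA1 : |A ω'| ≤ 1 := abs_wordProd_le_one h.lt_one (hbd ω') _ _
        have g1 := hGint (A ω') (c' ω') (D ω') (hApos ω') hA1 (hDlow ω')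
        have g2 := hGint (A ω') (c' ω') (-D ω') (hApos ω') hA1 (by rw [abs_neg]; exact hDlow ω')
        have mS' : Measurable S := mS.mono (sigmaOf_le h.measurable _) le_rfl
        have mGS : ∀ σ : ℝ, Measurable fun ω => G (S ω) (A ω') (c' ω') (σ * D ω') := by
          intro σ
          exact (mG σ).comp (mS'.prodMk measurable_const :
            Measurable fun ω => (S ω, A ω', c' ω', D ω', (0 : ENNReal)))
        have mGS1 := mGS 1
        have mGS2 := mGS (-1)
        simp only [one_mul, neg_one_mul] at mGS1 mGS2
        simp only [F]
        rw [lintegral_const_mul _ (mGS1.fun_add mGS2), lintegral_add_left mGS1]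
        have hw : weight ξ p w₀ w ω' * ENNReal.ofReal (|A ω'| ^ (-p)) = 1 := by
          unfold weight
          rw [← ENNReal.ofReal_mul (by positivity), ← Real.rpow_add (hApos ω')]
          simp
        calc _ ≤ H ω' * (ENNReal.ofReal (C / (a ^ (u.length + v₁.length) * δ * a ^ n)) * K *
              ENNReal.ofReal (|A ω'| ^ (-p)) +
              ENNReal.ofReal (C / (a ^ (u.length + v₁.length) * δ * a ^ n)) * K *
              ENNReal.ofReal (|A ω'| ^ (-p))) := by gcongr
          _ = 2 * ENNReal.ofReal (C / (a ^ (u.length + v₁.length) * δ * a ^ n)) * K *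
              ((weight ξ p w₀ w ω' * ENNReal.ofReal (|A ω'| ^ (-p))) *
              (weight ξ p w₀ w ω' * (weight ξ p (w₀ ++ w ++ u ++ v) x ω' *
            weight ξ p (w₀ ++ w ++ u' ++ v) y ω'))) := by
              simp only [H, w₁]; ring
          _ = _ := by rw [hw, one_mul]
    _ = _ := by
        have mm : ∀ w x : List (Fin N), Measurable (weight ξ p w x) := fun w x =>
          (measurable_weight ξ p subset_rfl).mono (sigmaOf_le h.measurable _) le_rfl
        rw [lintegral_const_mul _ ((mm _ _).fun_mul ((mm _ _).fun_mul (mm _ _))),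
          lintegral_weight_mul_weight_mul_weight h p w₀ w u u' x y hlen hne v]

end RatioField

/-! ### Separating words -/

section Separation

variable {N : ℕ} {Ω : Type*} [MeasurableSpace Ω]

/-- The transversality property of a word `v`: if two words separate at distinct words `u`, `u'` of
length `h`, both followed by `v`, then the difference of the corresponding points is spread out as
if it were uniformly distributed, up to a constant, over an interval of length comparable to the
ratio of the common prefix `w`. -/
def IsSeparating (P : Measure Ω) (ξ : List (Fin N) → Ω → Fin N → ℝ) (c : Fin N → ℝ) (R : ℝ)
    (v : List (Fin N)) : Prop :=
  ∀ p : ℝ, 0 ≤ p → ∀ h : ℕ, ∃ C : ENNReal, C ≠ ⊤ ∧ ∀ κ : ℝ → ENNReal, Measurable κ →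
    ∀ K : ENNReal, (∀ A : ℝ, 0 < A → A ≤ 1 →
      ∫⁻ z in Set.Icc (-(A * (2 * R))) (A * (2 * R)), κ z ≤ K * ENNReal.ofReal (A ^ (1 - p))) →
    ∀ w₀ w u u' x y : List (Fin N), u.length = h → u'.length = h → u ≠ u' → ∀ q : ℝ, |q| ≤ R →
      ∫⁻ ω, weight ξ p w₀ (w ++ (u ++ v ++ x)) ω * weight ξ p w₀ (w ++ (u' ++ v ++ y)) ω *
        κ (wordMap c (fun z => ξ z ω) w₀ (w ++ (u ++ v ++ x)) q -
          wordMap c (fun z => ξ z ω) w₀ (w ++ (u' ++ v ++ y)) q) ∂P ≤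
        C * K * (wordMoment P ξ p w * (wordMoment P ξ p x * wordMoment P ξ p y))

/-- A separating word consists of a long run of a letter `l` with eventually smooth logarithmic
ratio, and a run of a letter `i` with another fixed point, which keeps the points below the first
run away from the fixed point of `l`. -/
lemma exists_isSeparating {P : Measure Ω} {a b : ℝ} {ξ : List (Fin N) → Ω → Fin N → ℝ}
    (h : IsRatioField P a b ξ) {c : Fin N → ℝ} {T R : ℝ} (hT : ∀ i, |c i| ≤ T) (hTle : T ≤ R)
    (hTR : b * R + (1 + b) * T ≤ R) {l i : Fin N} (hil : c i ≠ c l)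
    (hl : EventuallySmooth (P.map fun ω => Real.log |ξ [] ω l|)) :
    ∃ s : List (Fin N), ∀ v₁ v₃ : List (Fin N), IsSeparating P ξ c R (v₁ ++ s ++ v₃) := by
  obtain ⟨n, C, hC, hdens⟩ := exists_map_log_le h l hl
  have hb0 : 0 ≤ b := h.pos.le.trans h.le
  have hpos : 0 < |c i - c l| := abs_pos.mpr (sub_ne_zero.mpr hil)
  obtain ⟨m, hm⟩ : ∃ m : ℕ, b ^ m * (2 * R) < |c i - c l| / 2 := by
    have : Tendsto (fun m : ℕ => b ^ m * (2 * R)) atTop (𝓝 (0 * (2 * R))) :=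
      (tendsto_pow_atTop_nhds_zero_of_lt_one hb0 h.lt_one).mul_const _
    rw [zero_mul] at this
    exact (this.eventually (gt_mem_nhds (half_pos hpos))).exists
  refine ⟨List.replicate n l ++ List.replicate m i, fun v₁ v₃ p hp k => ?_⟩
  refine ⟨2 * ENNReal.ofReal (C / (a ^ (k + v₁.length) * (|c i - c l| / 2) * a ^ n)),
    ENNReal.mul_ne_top (by simp) ENNReal.ofReal_ne_top, ?_⟩
  intro κ hκ K hK w₀ w u u' x y hu hu' hne q hq
  have := lintegral_weight_mul_kernel_le h hp hT hTR hC hdens (v₁ := v₁)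
    (v₂ := List.replicate m i ++ v₃) (half_pos hpos) (fun w ω q hq => ?_) hκ hK w₀ w u u' x y
    (hu.trans hu'.symm) hne hq (v₁ ++ (List.replicate n l ++ List.replicate m i) ++ v₃) (by simp)
  · rw [hu] at this
    exact this
  · rw [wordMap_append, wordMap_replicate]
    set Z := wordMap c (fun z => ξ z ω) (w ++ List.replicate m i) v₃ q
    set A := wordProd (fun z => ξ z ω) w (List.replicate m i)
    have h1 : |Z| ≤ R := abs_wordMap_le (fun w i => h.bound w ω i) hT hTR _ _ hq
    have h2 : |A| ≤ b ^ m := by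
      simpa using abs_wordProd_le_pow (fun w i => h.bound w ω i) w (List.replicate m i)
    have h3 : |Z - c i| ≤ 2 * R := by
      have := abs_sub Z (c i)
      linarith [hT i]
    have h4 : |A * (Z - c i)| ≤ |c i - c l| / 2 := by
      rw [abs_mul]
      exact (mul_le_mul h2 h3 (abs_nonneg _) (pow_nonneg hb0 _)).trans hm.le
    have h5 := abs_sub_abs_le_abs_sub (c i - c l) (-(A * (Z - c i)))
    rw [abs_neg] at h5
    rw [show c i + A * (Z - c i) - c l = c i - c l - -(A * (Z - c i)) by ring]
    linarith

end Separation

/-! ### Second moments over all coordinates -/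

/-- The bound for the mixed moment of a pair of block words: the moment of the common prefix times
the moments of the remainders after the separation. -/
noncomputable def pairBound {U : Type*} [DecidableEq U] (e : U → ENNReal) (C κ₀ : ENNReal) :
    List U → List U → ENNReal
  | u :: x, u' :: y =>
    if u = u' then e u * pairBound e C κ₀ x y else C * ((x.map e).prod * (y.map e).prod)
  | _, _ => κ₀

section VectorField

variable {N d : ℕ} {Ω : Type*}

/-- The word spelled by a list of words of length `h`, each of them followed by `v`. -/
def blockWord {h : ℕ} (v : List (Fin N)) (x : List (Fin h → Fin N)) : List (Fin N) :=
  x.flatMap fun u => List.ofFn u ++ v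

lemma blockWord_cons {h : ℕ} (v : List (Fin N)) (u : Fin h → Fin N) (x : List (Fin h → Fin N)) :
    blockWord v (u :: x) = List.ofFn u ++ v ++ blockWord v x := by
  simp [blockWord]

/-- The product over the coordinates of the weights of a word, with exponents `p k`. -/
noncomputable def vecWeight (ξ : List (Fin N) × Fin d → Ω → Fin N → ℝ) (p : Fin d → ℝ)
    (w x : List (Fin N)) (ω : Ω) : ENNReal :=
  ∏ k, weight (fun z => ξ (z, k)) (p k) w x ω

/-- The product kernel, evaluated at the difference of the points coded by `x` and `y` below `w`. -/
noncomputable def vecKernel (ξ : List (Fin N) × Fin d → Ω → Fin N → ℝ) (c : Fin d → Fin N → ℝ)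
    (q : Fin d → ℝ) (κ : Fin d → ℝ → ENNReal) (w x y : List (Fin N)) (ω : Ω) : ENNReal :=
  ∏ k, κ k (wordMap (c k) (fun z => ξ (z, k) ω) w x (q k) -
    wordMap (c k) (fun z => ξ (z, k) ω) w y (q k))

/-- The total weight of the words of `n` blocks below `w`. -/
noncomputable def mass (h : ℕ) (v : List (Fin N)) (ξ : List (Fin N) × Fin d → Ω → Fin N → ℝ)
    (p : Fin d → ℝ) (n : ℕ) (w : List (Fin N)) (ω : Ω) : ENNReal :=
  ∑ X : Fin n → Fin h → Fin N, vecWeight ξ p w (blockWord v (List.ofFn X)) ω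

/-- The energy of the weighted point configuration of the words of `n` blocks below `w`. -/
noncomputable def energy (h : ℕ) (v : List (Fin N)) (ξ : List (Fin N) × Fin d → Ω → Fin N → ℝ)
    (p : Fin d → ℝ) (c : Fin d → Fin N → ℝ) (q : Fin d → ℝ) (κ : Fin d → ℝ → ENNReal) (n : ℕ)
    (w : List (Fin N)) (ω : Ω) : ENNReal :=
  ∑ X : Fin n → Fin h → Fin N, ∑ Y : Fin n → Fin h → Fin N,
    vecWeight ξ p w (blockWord v (List.ofFn X)) ω * vecWeight ξ p w (blockWord v (List.ofFn Y)) ω *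
      vecKernel ξ c q κ w (blockWord v (List.ofFn X)) (blockWord v (List.ofFn Y)) ω

lemma energy_one (h : ℕ) (v : List (Fin N)) (ξ : List (Fin N) × Fin d → Ω → Fin N → ℝ)
    (p : Fin d → ℝ) (c : Fin d → Fin N → ℝ) (q : Fin d → ℝ) (n : ℕ) (w : List (Fin N)) (ω : Ω) :
    energy h v ξ p c q (fun _ _ => 1) n w ω = mass h v ξ p n w ω ^ 2 := by
  simp [energy, mass, vecKernel, sq, Finset.sum_mul_sum]

lemma sigmaOf_coord_le (ξ : List (Fin N) × Fin d → Ω → Fin N → ℝ) (k : Fin d)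
    {S : Set (List (Fin N))} {T : Set (List (Fin N) × Fin d)} (h : ∀ w ∈ S, (w, k) ∈ T) :
    sigmaOf (fun w => ξ (w, k)) S ≤ sigmaOf ξ T :=
  iSup₂_le fun w hw => le_iSup₂_of_le (w, k) (h w hw) le_rfl

lemma measurable_vecWeight (ξ : List (Fin N) × Fin d → Ω → Fin N → ℝ) (p : Fin d → ℝ)
    (w x : List (Fin N)) :
    Measurable[sigmaOf ξ {z | w.length ≤ z.1.length}] (vecWeight ξ p w x) := by
  refine Finset.measurable_fun_prod _ fun k _ => ?_
  exact (measurable_weight (fun z => ξ (z, k)) (p k) subset_rfl).mono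
    (sigmaOf_coord_le ξ k fun z hz => hz.1.length_le) le_rfl

lemma measurable_vecKernel (ξ : List (Fin N) × Fin d → Ω → Fin N → ℝ) (c : Fin d → Fin N → ℝ)
    (q : Fin d → ℝ) {κ : Fin d → ℝ → ENNReal} (hκ : ∀ k, Measurable (κ k))
    (w x y : List (Fin N)) :
    Measurable[sigmaOf ξ {z | w.length ≤ z.1.length}] (vecKernel ξ c q κ w x y) := by
  refine Finset.measurable_fun_prod _ fun k _ => ?_
  have h1 : ∀ x, Measurable[sigmaOf ξ {z | w.length ≤ z.1.length}]
      fun ω => wordMap (c k) (fun z => ξ (z, k) ω) w x (q k) := fun x =>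
    (measurable_wordMap (fun z => ξ (z, k)) (c k) subset_rfl (q k)).mono
      (sigmaOf_coord_le ξ k fun z hz => hz.1.length_le) le_rfl
  exact (hκ k).comp ((h1 x).sub (h1 y))

lemma measurable_mass (h : ℕ) (v : List (Fin N)) (ξ : List (Fin N) × Fin d → Ω → Fin N → ℝ)
    (p : Fin d → ℝ) (n : ℕ) (w : List (Fin N)) :
    Measurable[sigmaOf ξ {z | w.length ≤ z.1.length}] (mass h v ξ p n w) :=
  Finset.measurable_fun_sum _ fun _ _ => measurable_vecWeight ξ p w _

lemma measurable_energy (h : ℕ) (v : List (Fin N)) (ξ : List (Fin N) × Fin d → Ω → Fin N → ℝ)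
    (p : Fin d → ℝ) (c : Fin d → Fin N → ℝ) (q : Fin d → ℝ) {κ : Fin d → ℝ → ENNReal}
    (hκ : ∀ k, Measurable (κ k)) (n : ℕ) (w : List (Fin N)) :
    Measurable[sigmaOf ξ {z | w.length ≤ z.1.length}] (energy h v ξ p c q κ n w) :=
  Finset.measurable_fun_sum _ fun _ _ => Finset.measurable_fun_sum _ fun _ _ =>
    ((measurable_vecWeight ξ p w _).mul (measurable_vecWeight ξ p w _)).mul
      (measurable_vecKernel ξ c q hκ w _ _)

variable [MeasurableSpace Ω]

/-- Random ratios on the tree of words, for `d` independent coordinates. -/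
structure IsVecRatioField (P : Measure Ω) (a b : ℝ) (ξ : List (Fin N) × Fin d → Ω → Fin N → ℝ) :
    Prop where
  indep : iIndepFun ξ P
  coord : ∀ k, IsRatioField P a b fun w => ξ (w, k)

/-- The expected weight of a word. -/
noncomputable def vecMoment (P : Measure Ω) (ξ : List (Fin N) × Fin d → Ω → Fin N → ℝ)
    (p : Fin d → ℝ) (x : List (Fin N)) : ENNReal :=
  ∏ k, wordMoment P (fun w => ξ (w, k)) (p k) x

lemma vecMoment_append (P : Measure Ω) (ξ : List (Fin N) × Fin d → Ω → Fin N → ℝ)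
    (p : Fin d → ℝ) (x y : List (Fin N)) :
    vecMoment P ξ p (x ++ y) = vecMoment P ξ p x * vecMoment P ξ p y := by
  simp [vecMoment, wordMoment_append, Finset.prod_mul_distrib]

lemma vecMoment_blockWord (P : Measure Ω) (ξ : List (Fin N) × Fin d → Ω → Fin N → ℝ)
    (p : Fin d → ℝ) {h : ℕ} (v : List (Fin N)) (x : List (Fin h → Fin N)) :
    vecMoment P ξ p (blockWord v x) =
      (x.map fun u => vecMoment P ξ p (List.ofFn u ++ v)).prod := by
  induction x with
  | nil => simp [blockWord, vecMoment, wordMoment]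
  | cons u x ih => rw [blockWord_cons, vecMoment_append, ih]; simp

variable {P : Measure Ω} {a b : ℝ} {ξ : List (Fin N) × Fin d → Ω → Fin N → ℝ}

variable (H : IsVecRatioField P a b ξ)
include H

lemma IsVecRatioField.measurable (z : List (Fin N) × Fin d) : Measurable (ξ z) :=
  (H.coord z.2).measurable z.1

/-- Functions of different coordinates are independent. -/
lemma lintegral_prod_coord {F : Fin d → Ω → ENNReal}
    (hF : ∀ k, Measurable[sigmaOf (fun w => ξ (w, k)) Set.univ] (F k)) :
    ∫⁻ ω, ∏ k, F k ω ∂P = ∏ k, ∫⁻ ω, F k ω ∂P := by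
  classical
  have := H.indep.isProbabilityMeasure
  suffices ∀ s : Finset (Fin d), ∫⁻ ω, ∏ k ∈ s, F k ω ∂P = ∏ k ∈ s, ∫⁻ ω, F k ω ∂P from this _
  intro s
  induction s using Finset.induction_on with
  | empty => simp
  | insert k s hk ih =>
    have h1 : Measurable[sigmaOf ξ {z | z.2 = k}] (F k) :=
      (hF k).mono (sigmaOf_coord_le ξ k fun w _ => rfl) le_rfl
    have h2 : Measurable[sigmaOf ξ {z | z.2 ∈ s}] fun ω => ∏ j ∈ s, F j ω :=
      Finset.measurable_fun_prod _ fun j hj =>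
        (hF j).mono (sigmaOf_coord_le ξ j fun w _ => hj) le_rfl
    have hd : Disjoint {z : List (Fin N) × Fin d | z.2 = k} {z | z.2 ∈ s} :=
      Set.disjoint_left.mpr fun z hz hz' => hk (by
        have h3 : z.2 = k := hz
        rw [← h3]; exact hz')
    simp_rw [Finset.prod_insert hk]
    rw [lintegral_mul_of_disjoint H.measurable H.indep hd h1 h2, ih]

lemma lintegral_vecWeight (p : Fin d → ℝ) (w x : List (Fin N)) :
    ∫⁻ ω, vecWeight ξ p w x ω ∂P = vecMoment P ξ p x := by
  unfold vecWeight vecMoment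
  rw [lintegral_prod_coord H fun k => measurable_weight _ (p k) (Set.subset_univ _)]
  exact Finset.prod_congr rfl fun k _ => lintegral_weight (H.coord k) (p k) w x

lemma vecWeight_le_one {p : Fin d → ℝ} (hp : ∀ k, 0 ≤ p k) (w x : List (Fin N)) (ω : Ω) :
    vecWeight ξ p w x ω ≤ 1 :=
  Finset.prod_le_one' fun k _ => weight_le_one (H.coord k) (hp k) w x ω

lemma lintegral_mass (h : ℕ) (v : List (Fin N)) (p : Fin d → ℝ) (n : ℕ) (w : List (Fin N)) :
    ∫⁻ ω, mass h v ξ p n w ω ∂P =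
      (∑ u : Fin h → Fin N, vecMoment P ξ p (List.ofFn u ++ v)) ^ n := by
  unfold mass
  rw [lintegral_finsetSum _ fun X _ => (measurable_vecWeight ξ p w _).mono
    (sigmaOf_le H.measurable _) le_rfl, Fintype.sum_pow]
  refine Finset.sum_congr rfl fun X _ => ?_
  rw [lintegral_vecWeight H, vecMoment_blockWord, List.map_ofFn, List.prod_ofFn]
  rfl

lemma lintegral_pair_le {p : Fin d → ℝ} (hp : ∀ k, 0 ≤ p k) {c : Fin d → Fin N → ℝ}
    {q : Fin d → ℝ} {κ : Fin d → ℝ → ENNReal} (hκ : ∀ k, Measurable (κ k)) {h : ℕ}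
    {v : List (Fin N)} {C : Fin d → ENNReal} (w₀ : List (Fin N))
    (hsep : ∀ k, ∀ w u u' x y : List (Fin N), u.length = h → u'.length = h → u ≠ u' →
      ∫⁻ ω, weight (fun z => ξ (z, k)) (p k) w₀ (w ++ (u ++ v ++ x)) ω *
        weight (fun z => ξ (z, k)) (p k) w₀ (w ++ (u' ++ v ++ y)) ω *
        κ k (wordMap (c k) (fun z => ξ (z, k) ω) w₀ (w ++ (u ++ v ++ x)) (q k) -
          wordMap (c k) (fun z => ξ (z, k) ω) w₀ (w ++ (u' ++ v ++ y)) (q k)) ∂P ≤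
        C k * (wordMoment P (fun z => ξ (z, k)) (p k) w *
          (wordMoment P (fun z => ξ (z, k)) (p k) x * wordMoment P (fun z => ξ (z, k)) (p k) y)))
    (x y : List (Fin h → Fin N)) (hxy : x.length = y.length) (w : List (Fin N)) :
    ∫⁻ ω, vecWeight ξ p w₀ (w ++ blockWord v x) ω * vecWeight ξ p w₀ (w ++ blockWord v y) ω *
        vecKernel ξ c q κ w₀ (w ++ blockWord v x) (w ++ blockWord v y) ω ∂P ≤
      vecMoment P ξ p w * pairBound (fun u => vecMoment P ξ p (List.ofFn u ++ v)) (∏ k, C k)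
        (∏ k, κ k 0) x y := by
  induction x generalizing y w with
  | nil =>
    obtain rfl : y = [] := List.length_eq_zero_iff.mp hxy.symm
    calc _ ≤ ∫⁻ ω, vecWeight ξ p w₀ w ω * ∏ k, κ k 0 ∂P := by
          refine lintegral_mono fun ω => ?_
          simp only [blockWord, List.flatMap_nil, List.append_nil, vecKernel, sub_self]
          gcongr
          exact mul_le_of_le_one_right' (vecWeight_le_one H hp w₀ w ω)
      _ = _ := by
          rw [lintegral_mul_const _ ((measurable_vecWeight ξ p w₀ w).mono
            (sigmaOf_le H.measurable _) le_rfl), lintegral_vecWeight H]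
          simp [pairBound]
  | cons u x ih =>
    obtain _ | ⟨u', y⟩ := y
    · simp at hxy
    rw [pairBound]
    split_ifs with huu
    · subst huu
      have := ih y (by simpa using hxy) (w ++ (List.ofFn u ++ v))
      simp only [blockWord_cons, vecMoment_append, List.append_assoc] at this ⊢
      rw [← mul_assoc, ← mul_assoc]
      simpa only [mul_assoc] using this
    · have hne : List.ofFn u ≠ List.ofFn u' := fun hh => huu (List.ofFn_injective hh)
      have hm : ∀ k, Measurable[sigmaOf (fun z => ξ (z, k)) Set.univ] fun ω =>
          weight (fun z => ξ (z, k)) (p k) w₀ (w ++ blockWord v (u :: x)) ω *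
          weight (fun z => ξ (z, k)) (p k) w₀ (w ++ blockWord v (u' :: y)) ω *
          κ k (wordMap (c k) (fun z => ξ (z, k) ω) w₀ (w ++ blockWord v (u :: x)) (q k) -
            wordMap (c k) (fun z => ξ (z, k) ω) w₀ (w ++ blockWord v (u' :: y)) (q k)) := by
        intro k
        exact ((measurable_weight _ (p k) (Set.subset_univ _)).mul
          (measurable_weight _ (p k) (Set.subset_univ _))).mul ((hκ k).comp
          ((measurable_wordMap _ (c k) (Set.subset_univ _) (q k)).sub
            (measurable_wordMap _ (c k) (Set.subset_univ _) (q k))))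
      calc _ = ∏ k, ∫⁻ ω, weight (fun z => ξ (z, k)) (p k) w₀ (w ++ blockWord v (u :: x)) ω *
          weight (fun z => ξ (z, k)) (p k) w₀ (w ++ blockWord v (u' :: y)) ω *
          κ k (wordMap (c k) (fun z => ξ (z, k) ω) w₀ (w ++ blockWord v (u :: x)) (q k) -
            wordMap (c k) (fun z => ξ (z, k) ω) w₀ (w ++ blockWord v (u' :: y)) (q k)) ∂P := by
            rw [← lintegral_prod_coord H hm]
            refine lintegral_congr fun ω => ?_
            simp only [vecWeight, vecKernel, Finset.prod_mul_distrib]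
        _ ≤ ∏ k, C k * (wordMoment P (fun z => ξ (z, k)) (p k) w *
              (wordMoment P (fun z => ξ (z, k)) (p k) (blockWord v x) *
                wordMoment P (fun z => ξ (z, k)) (p k) (blockWord v y))) := by
            refine Finset.prod_le_prod' fun k _ => ?_
            rw [blockWord_cons, blockWord_cons]
            exact hsep k w _ _ _ _ (by simp) (by simp) hne
        _ = _ := by
            rw [← vecMoment_blockWord, ← vecMoment_blockWord]
            simp only [Finset.prod_mul_distrib, vecMoment]
            ring

end VectorField

/-- Summation of the pair bounds over all pairs of words of `n` letters: the geometric series in the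
length of the common prefix converges as `r > 1`. -/
lemma sum_pairBound_le {U : Type*} [Fintype U] [DecidableEq U] {e : U → ENNReal} {r : ℝ}
    (hr : 1 < r) (he : ∑ u, e u = ENNReal.ofReal r) (C κ₀ : ENNReal) (n : ℕ) :
    ∑ X : Fin n → U, ∑ Y : Fin n → U, pairBound e C κ₀ (List.ofFn X) (List.ofFn Y) ≤
      ENNReal.ofReal r ^ n * κ₀ + C * Fintype.card U ^ 2 * ENNReal.ofReal (1 / (r ^ 2 - r)) *
        ENNReal.ofReal r ^ (2 * n) := by
  have hr2 : 0 < r ^ 2 - r := by nlinarith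
  set C' := C * Fintype.card U ^ 2 * ENNReal.ofReal (1 / (r ^ 2 - r))
  have hC' : ENNReal.ofReal r * C' + Fintype.card U ^ 2 * C ≤ C' * ENNReal.ofReal r ^ 2 := by
    have e1 : ENNReal.ofReal r * ENNReal.ofReal (1 / (r ^ 2 - r)) + 1 =
        ENNReal.ofReal (1 / (r ^ 2 - r)) * ENNReal.ofReal r ^ 2 := by
      rw [← ENNReal.ofReal_mul (by linarith), ← ENNReal.ofReal_pow (by linarith),
        ← ENNReal.ofReal_mul (by positivity), ← ENNReal.ofReal_one,
        ← ENNReal.ofReal_add (by positivity) (by norm_num)]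
      congr 1
      have hr1 : r - 1 ≠ 0 := by linarith
      have hr0 : r ≠ 0 := by linarith
      rw [show r ^ 2 - r = r * (r - 1) by ring]
      field_simp
      ring
    apply le_of_eq
    calc _ = C * Fintype.card U ^ 2 *
          (ENNReal.ofReal r * ENNReal.ofReal (1 / (r ^ 2 - r)) + 1) := by
          simp only [C']; ring
      _ = _ := by rw [e1]; simp only [C']; ring
  have hpow : ∀ n : ℕ, ∑ X : Fin n → U, ((List.ofFn X).map e).prod = ENNReal.ofReal r ^ n := by
    intro n
    rw [← he, Fintype.sum_pow]
    refine Finset.sum_congr rfl fun X _ => ?_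
    rw [List.map_ofFn, List.prod_ofFn]
    rfl
  have hcons : ∀ (n : ℕ) (f : (Fin (n + 1) → U) → ENNReal),
      ∑ X, f X = ∑ u : U, ∑ X : Fin n → U, f (Fin.cons u X) := by
    intro n f
    rw [← (Fin.consEquiv fun _ : Fin (n + 1) => U).sum_comp, Fintype.sum_prod_type]
    rfl
  induction n with
  | zero =>
    simp [pairBound]
  | succ n ih =>
    rw [hcons]
    simp_rw [hcons]
    simp only [List.ofFn_cons, pairBound]
    calc _ ≤ ∑ u : U, ∑ X : Fin n → U, ∑ u' : U, ∑ Y : Fin n → U,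
          ((if u = u' then e u * pairBound e C κ₀ (List.ofFn X) (List.ofFn Y) else 0) +
            C * (((List.ofFn X).map e).prod * ((List.ofFn Y).map e).prod)) := by
          gcongr with u _ X _ u' _ Y _
          split_ifs
          · exact le_self_add
          · exact le_add_self
      _ = ENNReal.ofReal r * (∑ X : Fin n → U, ∑ Y : Fin n → U,
            pairBound e C κ₀ (List.ofFn X) (List.ofFn Y)) +
          Fintype.card U ^ 2 * C * (ENNReal.ofReal r ^ n) ^ 2 := by
          simp only [Finset.sum_add_distrib]
          congr 1
          · rw [← he, Finset.sum_mul]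
            refine Finset.sum_congr rfl fun u _ => ?_
            rw [Finset.mul_sum]
            refine Finset.sum_congr rfl fun X _ => ?_
            rw [Finset.sum_eq_single u]
            · simp [Finset.mul_sum]
            · intro u' _ hu'
              simp [hu'.symm]
            · simp
          · simp only [← Finset.mul_sum, ← Finset.sum_mul, hpow, Finset.sum_const, Finset.card_univ,
              nsmul_eq_mul]
            ring
      _ ≤ ENNReal.ofReal r * (ENNReal.ofReal r ^ n * κ₀ + C' * ENNReal.ofReal r ^ (2 * n)) +
          Fintype.card U ^ 2 * C * (ENNReal.ofReal r ^ n) ^ 2 := by gcongr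
      _ = ENNReal.ofReal r ^ (n + 1) * κ₀ +
          (ENNReal.ofReal r * C' + Fintype.card U ^ 2 * C) * ENNReal.ofReal r ^ (2 * n) := by ring
      _ ≤ ENNReal.ofReal r ^ (n + 1) * κ₀ +
          (C' * ENNReal.ofReal r ^ 2) * ENNReal.ofReal r ^ (2 * n) := by gcongr
      _ = _ := by ring

/-! ### Positive probability and the zero-one law -/

lemma le_measure_limsup {Ω : Type*} [MeasurableSpace Ω] {P : Measure Ω} [IsFiniteMeasure P]
    {A : ℕ → Set Ω} (hA : ∀ n, MeasurableSet (A n)) {c : ENNReal} (hc : ∀ n, c ≤ P (A n)) :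
    c ≤ P {ω | ∃ᶠ n in atTop, ω ∈ A n} := by
  have e : {ω | ∃ᶠ n in atTop, ω ∈ A n} = ⋂ m, ⋃ n ≥ m, A n := by
    ext ω
    simp [frequently_atTop]
  rw [e]
  have ht := tendsto_measure_iInter_atTop (μ := P) (s := fun m => ⋃ n ≥ m, A n)
    (fun m => (MeasurableSet.iUnion fun n => MeasurableSet.iUnion fun _ => hA n).nullMeasurableSet)
    (fun m m' hm => Set.biUnion_mono (fun n hn => le_trans hm hn) fun _ _ => le_rfl)
    ⟨0, measure_ne_top _ _⟩
  exact ge_of_tendsto' ht fun m => (hc m).trans (measure_mono fun ω hω => by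
    simp only [Set.mem_iUnion]
    exact ⟨m, le_rfl, hω⟩)

/-- A form of the Paley–Zygmund inequality: a variable `f` of mean one with second moment at most
`C` is at least `1 / 2`, while another one of mean at most `C` is at most `8 C ^ 2`, with
probability at least `1 / (8 C)`. -/
lemma le_measure_of_second_moment {Ω : Type*} [MeasurableSpace Ω] {P : Measure Ω}
    [IsProbabilityMeasure P] {f g : Ω → ENNReal} (hf : Measurable f) (hg : Measurable g) {C : ℝ}
    (hC : 0 < C) (hf1 : ∫⁻ ω, f ω ∂P = 1) (hf2 : ∫⁻ ω, f ω ^ 2 ∂P ≤ ENNReal.ofReal C)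
    (hg1 : ∫⁻ ω, g ω ∂P ≤ ENNReal.ofReal C) :
    ENNReal.ofReal (1 / (8 * C)) ≤
      P {ω | 1 ≤ 2 * f ω ∧ g ω ≤ ENNReal.ofReal (8 * C ^ 2)} := by
  set A := {ω | 1 ≤ 2 * f ω}
  set B := {ω | g ω ≤ ENNReal.ofReal (8 * C ^ 2)}
  have hA : MeasurableSet A := measurableSet_le measurable_const (hf.const_mul 2)
  have hB : MeasurableSet B := measurableSet_le hg measurable_const
  have h1 : ∀ x : ENNReal, x ≤ ENNReal.ofReal (1 / (4 * C)) * x ^ 2 + ENNReal.ofReal C := by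
    intro x
    induction x with
    | top =>
      rw [ENNReal.top_pow (by norm_num), ENNReal.mul_top (by simpa using hC)]
      simp
    | coe x =>
      rw [← ENNReal.ofReal_coe_nnreal, ← ENNReal.ofReal_pow x.coe_nonneg,
        ← ENNReal.ofReal_mul (by positivity), ← ENNReal.ofReal_add (by positivity) hC.le]
      apply ENNReal.ofReal_le_ofReal
      have : 0 ≤ (x - 2 * C) ^ 2 / (4 * C) := by positivity
      have e : 1 / (4 * C) * (x : ℝ) ^ 2 + C - x = (x - 2 * C) ^ 2 / (4 * C) := by
        field_simp; ring
      linarith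
  have h2 : (1 : ENNReal) ≤ ENNReal.ofReal (1 / 2) + (ENNReal.ofReal (1 / 4) +
      ENNReal.ofReal C * P A) := by
    calc (1 : ENNReal) = ∫⁻ ω in Aᶜ, f ω ∂P + ∫⁻ ω in A, f ω ∂P := by
          rw [add_comm, lintegral_add_compl _ hA, hf1]
      _ ≤ ∫⁻ _ω in Aᶜ, ENNReal.ofReal (1 / 2) ∂P +
            ∫⁻ ω in A, (ENNReal.ofReal (1 / (4 * C)) * f ω ^ 2 + ENNReal.ofReal C) ∂P := by
          refine add_le_add (setLIntegral_mono' hA.compl fun ω hω => ?_)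
            (lintegral_mono fun ω => h1 _)
          have hlt : 2 * f ω < 1 := not_le.mp hω
          have : f ω ≤ 1 / 2 := by
            rw [ENNReal.le_div_iff_mul_le (by simp) (by simp), mul_comm]
            exact hlt.le
          refine this.trans (le_of_eq ?_)
          rw [ENNReal.ofReal_div_of_pos (by norm_num)]
          simp
      _ ≤ ENNReal.ofReal (1 / 2) + (ENNReal.ofReal (1 / 4) + ENNReal.ofReal C * P A) := by
          gcongr
          · rw [setLIntegral_const]
            exact mul_le_of_le_one_right' prob_le_one
          · rw [lintegral_add_right _ measurable_const, setLIntegral_const]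
            gcongr
            calc ∫⁻ ω in A, ENNReal.ofReal (1 / (4 * C)) * f ω ^ 2 ∂P
                ≤ ∫⁻ ω, ENNReal.ofReal (1 / (4 * C)) * f ω ^ 2 ∂P := setLIntegral_le_lintegral _ _
              _ ≤ ENNReal.ofReal (1 / (4 * C)) * ENNReal.ofReal C := by
                  rw [lintegral_const_mul _ (hf.pow_const 2)]
                  gcongr
              _ = ENNReal.ofReal (1 / 4) := by
                  rw [← ENNReal.ofReal_mul (by positivity)]
                  congr 1; field_simp
  have hPA : 1 / (4 * C) ≤ P.real A := by
    have e : P A = ENNReal.ofReal (P.real A) := (ofReal_measureReal).symm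
    rw [e, ← ENNReal.ofReal_mul hC.le, ← ENNReal.ofReal_add (by norm_num) (by positivity),
      ← ENNReal.ofReal_add (by norm_num) (by positivity), ← ENNReal.ofReal_one,
      ENNReal.ofReal_le_ofReal_iff (by positivity)] at h2
    rw [div_le_iff₀ (by positivity)]
    linarith
  have hPB : P.real Bᶜ ≤ 1 / (8 * C) := by
    have h3 : ENNReal.ofReal (8 * C ^ 2) * P Bᶜ ≤ ENNReal.ofReal C := by
      refine le_trans ?_ hg1
      refine le_trans ?_ (mul_meas_ge_le_lintegral hg (ENNReal.ofReal (8 * C ^ 2)))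
      gcongr
      intro ω hω
      have hω : ¬ g ω ≤ ENNReal.ofReal (8 * C ^ 2) := hω
      exact (not_le.mp hω).le
    have e : P Bᶜ = ENNReal.ofReal (P.real Bᶜ) := (ofReal_measureReal).symm
    rw [e, ← ENNReal.ofReal_mul (by positivity), ENNReal.ofReal_le_ofReal_iff hC.le] at h3
    rw [le_div_iff₀ (by positivity)]
    have : C * (P.real Bᶜ * (8 * C)) ≤ C * 1 := by linarith
    exact le_of_mul_le_mul_left this hC
  have hsub : P.real A ≤ P.real (A ∩ B) + P.real Bᶜ := by
    refine (measureReal_mono ?_).trans (measureReal_union_le _ _)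
    intro ω hω
    by_cases hb : ω ∈ B
    · exact Or.inl ⟨hω, hb⟩
    · exact Or.inr hb
  have : 1 / (8 * C) ≤ P.real (A ∩ B) := by
    have : 1 / (4 * C) = 1 / (8 * C) + 1 / (8 * C) := by field_simp; norm_num
    linarith
  calc ENNReal.ofReal (1 / (8 * C)) ≤ ENNReal.ofReal (P.real (A ∩ B)) :=
        ENNReal.ofReal_le_ofReal this
    _ = P (A ∩ B) := ofReal_measureReal

section VectorField

variable {N d : ℕ} {Ω : Type*} [MeasurableSpace Ω] {P : Measure Ω} {a b : ℝ}
  {ξ : List (Fin N) × Fin d → Ω → Fin N → ℝ} (H : IsVecRatioField P a b ξ)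
include H

/-- Kolmogorov's zero-one law for a sequence of events depending on ever later generations. -/
lemma ae_frequently_of_le_measure {A : ℕ → Set Ω}
    (hA : ∀ m, MeasurableSet[sigmaOf ξ {z | m ≤ z.1.length}] (A m)) {c : ENNReal} (hc0 : 0 < c)
    (hc : ∀ m, c ≤ P (A m)) : ∀ᵐ ω ∂P, ∃ᶠ m in atTop, ω ∈ A m := by
  have := H.indep.isProbabilityMeasure
  set s : List (Fin N) × Fin d → MeasurableSpace Ω := fun z =>
    MeasurableSpace.comap (ξ z) inferInstance
  set E := {ω | ∃ᶠ m in atTop, ω ∈ A m}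
  have hAm : ∀ m, MeasurableSet (A m) := fun m => sigmaOf_le H.measurable _ _ (hA m)
  have hcE : c ≤ P E := le_measure_limsup hAm hc
  set f : Filter (List (Fin N) × Fin d) := comap (fun z => z.1.length) atTop
  have hbasis : f.HasBasis (fun _ : ℕ => True) fun M => {z | M ≤ z.1.length} :=
    atTop_basis.comap _
  have hE : MeasurableSet[limsup s f] E := by
    rw [hbasis.limsup_eq_iInf_iSup, MeasurableSpace.measurableSet_iInf]
    intro M
    rw [MeasurableSpace.measurableSet_iInf]
    intro _
    have e : E = ⋂ m₀, ⋃ m ≥ max m₀ M, A m := by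
      ext ω
      simp only [E, Set.mem_ofPred_eq, frequently_atTop, Set.mem_iInter, Set.mem_iUnion,
        exists_prop]
      refine ⟨fun hω m₀ => hω _, fun hω m₀ => ?_⟩
      obtain ⟨m, hm, hmA⟩ := hω m₀
      exact ⟨m, (le_max_left _ _).trans hm, hmA⟩
    rw [e]
    refine MeasurableSet.iInter fun m₀ => MeasurableSet.iUnion fun m => MeasurableSet.iUnion
      fun hm => ?_
    exact sigmaOf_mono ξ (fun z hz => ((le_max_right m₀ M).trans hm).trans hz) _ (hA m)
  have h01 := measure_zero_or_one_of_measurableSet_limsup (μ := P) (s := s) (f := f)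
    (p := fun S => ∃ M : ℕ, S ⊆ {z | z.1.length < M}) (ns := fun M : ℕ => {z | z.1.length < M})
    (fun z => (H.measurable z).comap_le) H.indep
    (by
      rintro S ⟨M, hM⟩
      refine hbasis.mem_iff.mpr ⟨M, trivial, fun z hz hzS => ?_⟩
      have h1 : z.1.length < M := hM hzS
      have h2 : M ≤ z.1.length := hz
      omega)
    (directed_of_isDirected_le fun M M' hM z hz => lt_of_lt_of_le hz hM)
    (fun M => ⟨M, subset_rfl⟩) (fun z => ⟨z.1.length + 1, Nat.lt_succ_self _⟩) hE
  rcases h01 with h0 | h1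
  · rw [h0] at hcE
    exact absurd hcE (not_le.mpr hc0)
  · rw [ae_iff, ← Set.compl_ofPred]
    refine (prob_compl_eq_zero_iff ?_).mpr h1
    have e : E = ⋂ m₀, ⋃ m ≥ m₀, A m := by
      ext ω
      simp [E, frequently_atTop]
    change MeasurableSet E
    rw [e]
    exact MeasurableSet.iInter fun _ => MeasurableSet.iUnion fun m => MeasurableSet.iUnion
      fun _ => hAm m

/-- For supercritical weights and separating blocks, the expected energy is at most a constant times
the square of the expected mass. -/
lemma lintegral_energy_le {p : Fin d → ℝ} (hp : ∀ k, 0 ≤ p k) {c : Fin d → Fin N → ℝ}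
    {R : ℝ} {q : Fin d → ℝ} (hq : ∀ k, |q k| ≤ R) {h : ℕ} {v : List (Fin N)}
    (hsep : ∀ k, IsSeparating P (fun w => ξ (w, k)) (c k) R v) {r : ℝ} (hr : 1 < r)
    (hrv : ∑ u : Fin h → Fin N, vecMoment P ξ p (List.ofFn u ++ v) = ENNReal.ofReal r)
    {κ : ℕ → Fin d → ℝ → ENNReal} (hκ : ∀ n k, Measurable (κ n k)) {K : ENNReal} (hKtop : K ≠ ⊤)
    (hK : ∀ n k, ∀ A : ℝ, 0 < A → A ≤ 1 →
      ∫⁻ z in Set.Icc (-(A * (2 * R))) (A * (2 * R)), κ n k z ≤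
        K * ENNReal.ofReal (A ^ (1 - p k)))
    (hκ0 : ∀ n, ∏ k, κ n k 0 ≤ ENNReal.ofReal r ^ n) :
    ∃ C : ENNReal, C ≠ ⊤ ∧ ∀ n w₀, ∫⁻ ω, energy h v ξ p c q (κ n) n w₀ ω ∂P ≤
      C * ENNReal.ofReal r ^ (2 * n) := by
  choose C hCtop hC using fun k => hsep k (p k) (hp k) h
  set C' := (∏ k, C k * K) * Fintype.card (Fin h → Fin N) ^ 2 * ENNReal.ofReal (1 / (r ^ 2 - r))
  refine ⟨1 + C', ?_, fun n w₀ => ?_⟩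
  · refine ENNReal.add_ne_top.mpr ⟨ENNReal.one_ne_top, ENNReal.mul_ne_top (ENNReal.mul_ne_top ?_
      (by simp)) ENNReal.ofReal_ne_top⟩
    exact ENNReal.prod_ne_top fun k _ => ENNReal.mul_ne_top (hCtop k) hKtop
  · have hm : ∀ X Y : Fin n → Fin h → Fin N, Measurable fun ω =>
        vecWeight ξ p w₀ (blockWord v (List.ofFn X)) ω *
        vecWeight ξ p w₀ (blockWord v (List.ofFn Y)) ω *
        vecKernel ξ c q (κ n) w₀ (blockWord v (List.ofFn X)) (blockWord v (List.ofFn Y)) ω :=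
      fun X Y => (((measurable_vecWeight ξ p w₀ _).mul (measurable_vecWeight ξ p w₀ _)).mul
        (measurable_vecKernel ξ c q (hκ n) w₀ _ _)).mono (sigmaOf_le H.measurable _) le_rfl
    have hpair : ∀ X Y : Fin n → Fin h → Fin N, ∫⁻ ω,
        vecWeight ξ p w₀ (blockWord v (List.ofFn X)) ω *
        vecWeight ξ p w₀ (blockWord v (List.ofFn Y)) ω *
        vecKernel ξ c q (κ n) w₀ (blockWord v (List.ofFn X)) (blockWord v (List.ofFn Y)) ω ∂P ≤
        pairBound (fun u => vecMoment P ξ p (List.ofFn u ++ v)) (∏ k, C k * K)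
          (∏ k, κ n k 0) (List.ofFn X) (List.ofFn Y) := by
      intro X Y
      have := lintegral_pair_le H hp (hκ n) (C := fun k => C k * K) w₀
        (fun k w u u' x y hu hu' hne => hC k (κ n k) (hκ n k) K (hK n k) w₀ w u u' x y hu hu' hne
          (q k) (hq k)) (List.ofFn X) (List.ofFn Y) (by simp) []
      simpa [vecMoment, wordMoment] using this
    calc _ ≤ ∑ X : Fin n → Fin h → Fin N, ∑ Y : Fin n → Fin h → Fin N,
          pairBound (fun u => vecMoment P ξ p (List.ofFn u ++ v)) (∏ k, C k * K)
            (∏ k, κ n k 0) (List.ofFn X) (List.ofFn Y) := by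
          unfold energy
          rw [lintegral_finsetSum _ fun X _ => Finset.measurable_fun_sum _ fun Y _ => hm X Y]
          refine Finset.sum_le_sum fun X _ => ?_
          rw [lintegral_finsetSum _ fun Y _ => hm X Y]
          exact Finset.sum_le_sum fun Y _ => hpair X Y
      _ ≤ ENNReal.ofReal r ^ n * ∏ k, κ n k 0 + C' * ENNReal.ofReal r ^ (2 * n) :=
          sum_pairBound_le hr hrv _ _ n
      _ ≤ ENNReal.ofReal r ^ n * ENNReal.ofReal r ^ n + C' * ENNReal.ofReal r ^ (2 * n) := by
          gcongr
          exact hκ0 n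
      _ = _ := by ring

/-- Almost surely, below some word, the normalized energies are bounded along a sequence of
generations. -/
theorem ae_frequently_energy_le (hN : 0 < N) {p : Fin d → ℝ} (hp : ∀ k, 0 ≤ p k)
    {c : Fin d → Fin N → ℝ} {R : ℝ} (hR : 0 ≤ R) {q : Fin d → ℝ}
    (hq : ∀ k, |q k| ≤ R) {h : ℕ} {v : List (Fin N)}
    (hsep : ∀ k, IsSeparating P (fun w => ξ (w, k)) (c k) R v) {r : ℝ} (hr : 1 < r)
    (hrv : ∑ u : Fin h → Fin N, vecMoment P ξ p (List.ofFn u ++ v) = ENNReal.ofReal r)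
    {κ : ℕ → Fin d → ℝ → ENNReal} (hκ : ∀ n k, Measurable (κ n k)) {K : ENNReal} (hKtop : K ≠ ⊤)
    (hK : ∀ n k, ∀ A : ℝ, 0 < A → A ≤ 1 →
      ∫⁻ z in Set.Icc (-(A * (2 * R))) (A * (2 * R)), κ n k z ≤
        K * ENNReal.ofReal (A ^ (1 - p k)))
    (hκ0 : ∀ n, ∏ k, κ n k 0 ≤ ENNReal.ofReal r ^ n) :
    ∃ C : ℝ, 0 ≤ C ∧ ∀ᵐ ω ∂P, ∃ w₀ : List (Fin N), ∃ᶠ n in atTop,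
      0 < mass h v ξ p n w₀ ω ∧
      energy h v ξ p c q (κ n) n w₀ ω ≤ ENNReal.ofReal C * mass h v ξ p n w₀ ω ^ 2 := by
  have := H.indep.isProbabilityMeasure
  obtain ⟨C₁, hC₁, hen⟩ := lintegral_energy_le H hp hq hsep hr hrv hκ hKtop hK hκ0
  obtain ⟨C₂, hC₂, hmass⟩ := lintegral_energy_le H hp hq hsep hr hrv (κ := fun _ _ _ => 1)
    (fun _ _ => measurable_const) (K := ENNReal.ofReal (4 * R)) ENNReal.ofReal_ne_top
    (fun n k A hA hA1 => by
      rw [setLIntegral_const, one_mul, Real.volume_Icc, ← ENNReal.ofReal_mul (by positivity)]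
      apply ENNReal.ofReal_le_ofReal
      have : A ≤ A ^ (1 - p k) := by
        calc A = A ^ (1 : ℝ) := (Real.rpow_one A).symm
          _ ≤ A ^ (1 - p k) := Real.rpow_le_rpow_of_exponent_ge hA hA1 (by linarith [hp k])
      nlinarith)
    (fun n => by
      rw [Finset.prod_const_one]
      exact one_le_pow₀ (by simpa using hr.le))
  simp only [energy_one] at hmass
  set C : ℝ := max C₁.toReal C₂.toReal + 1
  have hCpos : 0 < C := by
    have : 0 ≤ C₁.toReal := ENNReal.toReal_nonneg
    have := le_max_left C₁.toReal C₂.toReal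
    simp only [C]; linarith
  have h1C : C₁ ≤ ENNReal.ofReal C := by
    rw [← ENNReal.ofReal_toReal hC₁]
    apply ENNReal.ofReal_le_ofReal
    have := le_max_left C₁.toReal C₂.toReal
    simp only [C]; linarith
  have h2C : C₂ ≤ ENNReal.ofReal C := by
    rw [← ENNReal.ofReal_toReal hC₂]
    apply ENNReal.ofReal_le_ofReal
    have := le_max_right C₁.toReal C₂.toReal
    simp only [C]; linarith
  set ρ : ENNReal := ENNReal.ofReal r
  have hρ0 : ρ ≠ 0 := by simp [ρ]; linarith
  have hρt : ρ ≠ ⊤ := ENNReal.ofReal_ne_top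
  have hinv : ∀ m : ℕ, (ρ ^ m)⁻¹ * ρ ^ m = 1 := fun m =>
    ENNReal.inv_mul_cancel (pow_ne_zero _ hρ0) (ENNReal.pow_ne_top hρt)
  set f : ℕ → List (Fin N) → Ω → ENNReal := fun n w₀ ω => (ρ ^ n)⁻¹ * mass h v ξ p n w₀ ω
  set g : ℕ → List (Fin N) → Ω → ENNReal := fun n w₀ ω =>
    (ρ ^ (2 * n))⁻¹ * energy h v ξ p c q (κ n) n w₀ ω
  set G : ℕ → List (Fin N) → Set Ω := fun n w₀ =>
    {ω | 1 ≤ 2 * f n w₀ ω ∧ g n w₀ ω ≤ ENNReal.ofReal (8 * C ^ 2)}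
  have mf : ∀ n w₀, Measurable[sigmaOf ξ {z | w₀.length ≤ z.1.length}] (f n w₀) := fun n w₀ =>
    measurable_const.mul (measurable_mass h v ξ p n w₀)
  have mg : ∀ n w₀, Measurable[sigmaOf ξ {z | w₀.length ≤ z.1.length}] (g n w₀) := fun n w₀ =>
    measurable_const.mul (measurable_energy h v ξ p c q (hκ n) n w₀)
  have mG : ∀ n w₀, MeasurableSet[sigmaOf ξ {z | w₀.length ≤ z.1.length}] (G n w₀) := fun n w₀ =>
    (mf n w₀ (measurableSet_le measurable_const (measurable_id.const_mul 2) :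
      MeasurableSet {x : ENNReal | 1 ≤ 2 * x})).inter (mg n w₀ measurableSet_Iic)
  have hG : ∀ n w₀, ENNReal.ofReal (1 / (8 * C)) ≤ P (G n w₀) := by
    intro n w₀
    have mm : Measurable (mass h v ξ p n w₀) :=
      (measurable_mass h v ξ p n w₀).mono (sigmaOf_le H.measurable _) le_rfl
    have me : Measurable (energy h v ξ p c q (κ n) n w₀) :=
      (measurable_energy h v ξ p c q (hκ n) n w₀).mono (sigmaOf_le H.measurable _) le_rfl
    refine le_measure_of_second_moment ((mf n w₀).mono (sigmaOf_le H.measurable _) le_rfl)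
      ((mg n w₀).mono (sigmaOf_le H.measurable _) le_rfl) hCpos ?_ ?_ ?_
    · rw [lintegral_const_mul _ mm, lintegral_mass H, hrv, hinv]
    · simp only [f, mul_pow]
      rw [lintegral_const_mul _ (mm.pow_const 2)]
      calc ((ρ ^ n)⁻¹) ^ 2 * ∫⁻ ω, mass h v ξ p n w₀ ω ^ 2 ∂P
          ≤ ((ρ ^ n)⁻¹) ^ 2 * (C₂ * ρ ^ (2 * n)) := by gcongr; exact hmass n w₀
        _ = C₂ * ((ρ ^ n)⁻¹ * ρ ^ n) ^ 2 := by ring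
        _ ≤ _ := by rw [hinv, one_pow, mul_one]; exact h2C
    · simp only [g]
      rw [lintegral_const_mul _ me]
      calc (ρ ^ (2 * n))⁻¹ * ∫⁻ ω, energy h v ξ p c q (κ n) n w₀ ω ∂P
          ≤ (ρ ^ (2 * n))⁻¹ * (C₁ * ρ ^ (2 * n)) := by gcongr; exact hen n w₀
        _ = C₁ * ((ρ ^ (2 * n))⁻¹ * ρ ^ (2 * n)) := by ring
        _ ≤ _ := by rw [hinv, mul_one]; exact h1C
  -- the zero-one law along the ray of words `i₀ i₀ ⋯ i₀`
  set A : ℕ → Set Ω := fun m =>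
    {ω | ∃ᶠ n in atTop, ω ∈ G n (List.replicate m (⟨0, hN⟩ : Fin N))}
  have hA : ∀ m, MeasurableSet[sigmaOf ξ {z | m ≤ z.1.length}] (A m) := by
    intro m
    have e : A m = ⋂ n₀, ⋃ n ≥ n₀, G n (List.replicate m (⟨0, hN⟩ : Fin N)) := by
      ext ω
      simp [A, frequently_atTop]
    rw [e]
    refine MeasurableSet.iInter fun n₀ => MeasurableSet.iUnion fun n => MeasurableSet.iUnion
      fun hn => ?_
    have h1 := mG n (List.replicate m (⟨0, hN⟩ : Fin N))
    rw [List.length_replicate] at h1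
    exact h1
  have hAc : ∀ m, ENNReal.ofReal (1 / (8 * C)) ≤ P (A m) := fun m =>
    le_measure_limsup (fun n => sigmaOf_le H.measurable _ _ (mG n _)) fun n => hG n _
  have hae := ae_frequently_of_le_measure H hA (by simpa using hCpos) hAc
  refine ⟨32 * C ^ 2, by positivity, ?_⟩
  filter_upwards [hae] with ω hω
  obtain ⟨m, hm⟩ := hω.exists
  refine ⟨List.replicate m ⟨0, hN⟩, hm.mono ?_⟩
  rintro n ⟨h1, h2⟩
  set w₀ := List.replicate m (⟨0, hN⟩ : Fin N)
  have hpos : 0 < mass h v ξ p n w₀ ω := by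
    rw [pos_iff_ne_zero]
    intro h0
    simp [f, h0] at h1
  refine ⟨hpos, ?_⟩
  calc energy h v ξ p c q (κ n) n w₀ ω
      = ρ ^ (2 * n) * g n w₀ ω := by
        simp only [g]
        rw [← mul_assoc, mul_comm (ρ ^ (2 * n)), hinv, one_mul]
    _ ≤ ρ ^ (2 * n) * (ENNReal.ofReal (8 * C ^ 2) * (2 * f n w₀ ω) ^ 2) := by
        gcongr
        refine h2.trans (le_mul_of_one_le_right' (one_le_pow₀ h1))
    _ = ENNReal.ofReal (8 * C ^ 2) * 4 * (((ρ ^ n)⁻¹ * ρ ^ n) ^ 2 * mass h v ξ p n w₀ ω ^ 2) := by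
        simp only [f]; ring
    _ = _ := by
        rw [hinv, one_pow, one_mul]
        congr 1
        rw [show (4 : ENNReal) = ENNReal.ofReal 4 by simp, ← ENNReal.ofReal_mul (by positivity)]
        congr 1; ring

end VectorField

/-! ### Cylinders of the sponge -/

section Geometry

variable {N d : ℕ}

/-- The composition, along the word `w`, of the affine maps with ratios `e k` in the coordinate `k`;
see `prefixComp_eq_cylinderMap`. -/
def cylinderMap (t : Fin N → EuclideanSpace ℝ (Fin d)) (e : Fin d → List (Fin N) → Fin N → ℝ)
    (w : List (Fin N)) (x : EuclideanSpace ℝ (Fin d)) : EuclideanSpace ℝ (Fin d) :=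
  WithLp.toLp 2 fun k => wordMap (fun i => t i k) (e k) [] w (x k)

/-- The ratios met below each word, in the coordinate `k`. -/
def ratios {Ω : Type*} (α : List (Fin N) → Fin d → Ω → ℝ) (ω : Ω) (k : Fin d) (w : List (Fin N))
    (i : Fin N) : ℝ :=
  α (w ++ [i]) k ω

variable {t : Fin N → EuclideanSpace ℝ (Fin d)} {B : Set (EuclideanSpace ℝ (Fin d))}

lemma affMap_nil {Ω : Type*} (α : List (Fin N) → Fin d → Ω → ℝ) (ω : Ω)
    (x : EuclideanSpace ℝ (Fin d)) : affMap t α ω [] x = x := by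
  simp [affMap, diagMatrix]

lemma affMap_append_apply {Ω : Type*} (α : List (Fin N) → Fin d → Ω → ℝ) (ω : Ω)
    (w : List (Fin N)) (i : Fin N) (x : EuclideanSpace ℝ (Fin d)) (k : Fin d) :
    affMap t α ω (w ++ [i]) x k =
      ratios α ω k w i * x k + (1 - ratios α ω k w i) * t i k := by
  have h1 : (1 : Matrix (Fin d) (Fin d) ℝ) - Matrix.diagonal (fun k => α (w ++ [i]) k ω) =
      Matrix.diagonal (fun k => 1 - α (w ++ [i]) k ω) := by
    rw [← Matrix.diagonal_one, Matrix.diagonal_sub]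
  simp [affMap, diagMatrix, lastPoint, ratios, h1, Matrix.mulVec_diagonal]

lemma cylinderMap_append (e : Fin d → List (Fin N) → Fin N → ℝ) (w : List (Fin N)) (i : Fin N)
    (x : EuclideanSpace ℝ (Fin d)) : cylinderMap t e (w ++ [i]) x =
      cylinderMap t e w (WithLp.toLp 2 fun k => e k w i * x k + (1 - e k w i) * t i k) := by
  ext k
  simp [cylinderMap, wordMap_append, wordMap]

lemma prefixComp_eq_cylinderMap {Ω : Type*} (α : List (Fin N) → Fin d → Ω → ℝ) (ω : Ω)
    (w : List (Fin N)) (n : ℕ) (hn : n ≤ w.length) :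
    prefixComp t α ω w n = cylinderMap t (ratios α ω) (w.take n) := by
  induction n with
  | zero =>
    funext x
    ext k
    simp [prefixComp, affMap_nil, cylinderMap, wordMap]
  | succ n ih =>
    have hlt : n < w.length := hn
    funext x
    rw [prefixComp, Function.comp_apply, ih hlt.le, List.take_succ_eq_append_getElem hlt,
      cylinderMap_append]
    congr 1
    ext k
    rw [affMap_append_apply]

/-- The sponge as an intersection of unions of cylinders. -/
lemma sponge_eq {Ω : Type*} (α : List (Fin N) → Fin d → Ω → ℝ) (ω : Ω) :
    sponge t α B ω = ⋂ n : ℕ, ⋃ w : List (Fin N), ⋃ _ : w.length = n,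
      cylinderMap t (ratios α ω) w '' B := by
  unfold sponge
  refine Set.iInter_congr fun n => Set.iUnion_congr fun w => Set.iUnion_congr fun hw => ?_
  rw [prefixComp_eq_cylinderMap α ω w n hw.ge, ← hw, List.take_length]

lemma continuous_cylinderMap (e : Fin d → List (Fin N) → Fin N → ℝ) (w : List (Fin N)) :
    Continuous (cylinderMap t e w) := by
  unfold cylinderMap
  refine (PiLp.continuous_toLp 2 _).comp (continuous_pi fun k => ?_)
  have : ∀ y : ℝ, wordMap (fun i => t i k) (e k) [] w y =
      wordMap (fun i => t i k) (e k) [] w 0 + wordProd (e k) [] w * y := by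
    intro y
    have := wordMap_sub (fun i => t i k) (e k) [] w y 0
    linarith
  have h2 : (fun x : EuclideanSpace ℝ (Fin d) => wordMap (fun i => t i k) (e k) [] w (x k)) =
      fun x => wordMap (fun i => t i k) (e k) [] w 0 + wordProd (e k) [] w * x k :=
    funext fun x => this (x k)
  rw [h2]
  fun_prop

lemma isCompact_iInter_cylinders (hB : IsCompact B) (e : Fin d → List (Fin N) → Fin N → ℝ) :
    IsCompact (⋂ n : ℕ, ⋃ w : List (Fin N), ⋃ _ : w.length = n, cylinderMap t e w '' B) := by
  have h1 : ∀ n : ℕ,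
      IsCompact (⋃ w : List (Fin N), ⋃ _ : w.length = n, cylinderMap t e w '' B) := by
    intro n
    exact (List.finite_length_eq (Fin N) n).isCompact_biUnion fun w _ =>
      hB.image (continuous_cylinderMap e w)
  refine (h1 0).of_isClosed_subset (isClosed_iInter fun n => (h1 n).isClosed) ?_
  exact Set.iInter_subset _ 0

variable {e : Fin d → List (Fin N) → Fin N → ℝ}
  (hinv : ∀ w i, ∀ x ∈ B,
    (WithLp.toLp 2 fun k => e k w i * x k + (1 - e k w i) * t i k : EuclideanSpace ℝ (Fin d)) ∈ B)
include hinv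

lemma cylinderMap_image_subset_of_prefix {w w' : List (Fin N)} (h : w <+: w') :
    cylinderMap t e w' '' B ⊆ cylinderMap t e w '' B := by
  obtain ⟨x, rfl⟩ := h
  induction x using List.reverseRecOn with
  | nil => simp
  | append_singleton x i ih =>
    refine Set.Subset.trans ?_ ih
    rintro _ ⟨y, hy, rfl⟩
    rw [← List.append_assoc, cylinderMap_append]
    exact Set.mem_image_of_mem _ (hinv _ i y hy)

/-- The fixed points belong to every compact set that is invariant under the maps. -/
lemma fixedPoint_mem (hB : IsCompact B) (hne : B.Nonempty) {a b : ℝ} (hb : b < 1)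
    (he : ∀ k w i, |e k w i| ∈ Set.Icc a b) (i : Fin N) : t i ∈ B := by
  obtain ⟨x, hx⟩ := hne
  have hmem : ∀ w : List (Fin N), cylinderMap t e w x ∈ B := by
    intro w
    obtain ⟨y, hy, hyx⟩ := cylinderMap_image_subset_of_prefix hinv (List.nil_prefix (l := w))
      (Set.mem_image_of_mem (cylinderMap t e w) hx)
    have : cylinderMap t e [] y = y := by
      ext k; simp [cylinderMap, wordMap]
    rw [this] at hyx
    rwa [← hyx]
  refine hB.isClosed.mem_of_tendsto (f := fun n : ℕ => cylinderMap t e (List.replicate n i) x)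
    (b := atTop) ?_ (Eventually.of_forall fun n => hmem _)
  have h1 : Tendsto (fun n : ℕ => fun k => wordMap (fun i => t i k) (e k) []
      (List.replicate n i) (x k)) atTop (𝓝 fun k => t i k) := by
    rw [tendsto_pi_nhds]
    intro k
    simp_rw [wordMap_replicate]
    have hb0 : 0 ≤ b := (abs_nonneg _).trans (he k [] i).2
    have h2 : Tendsto (fun n : ℕ => wordProd (e k) [] (List.replicate n i)) atTop (𝓝 0) := by
      refine squeeze_zero_norm (fun n => ?_) (tendsto_pow_atTop_nhds_zero_of_lt_one hb0 hb)
      rw [Real.norm_eq_abs]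
      simpa using abs_wordProd_le_pow (he k) [] (List.replicate n i)
    simpa using (h2.mul_const (x k - t i k)).const_add (t i k)
  exact ((PiLp.continuous_toLp 2 _).tendsto _).comp h1

lemma cylinderMap_fixedPoint_mem {i : Fin N} (hi : t i ∈ B) (w : List (Fin N)) :
    cylinderMap t e w (t i) ∈
      ⋂ n : ℕ, ⋃ w : List (Fin N), ⋃ _ : w.length = n, cylinderMap t e w '' B := by
  have key : ∀ m : ℕ, cylinderMap t e (w ++ List.replicate m i) (t i) = cylinderMap t e w (t i) := by
    intro m
    ext k
    simp [cylinderMap, wordMap_append, wordMap_replicate]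
  simp only [Set.mem_iInter, Set.mem_iUnion, exists_prop]
  intro n
  refine ⟨(w ++ List.replicate n i).take n, by simp, ?_⟩
  refine cylinderMap_image_subset_of_prefix hinv (List.take_prefix n _) ?_
  rw [← key n]
  exact Set.mem_image_of_mem _ hi

end Geometry

/-! ### The upper bound for the box dimension -/

section Covering

/-- For an admissible scale `r`, the number of boxes of side `r` needed for a box with sides `y k`
is bounded by `r ^ (-s)` times a singular value function. -/
lemma exists_perm_prod_max_le {d : ℕ} (hd : 1 ≤ d) {a r s : ℝ} (ha : 0 < a) (ha1 : a < 1)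
    (hr : 0 < r) (hs : 0 < s) (hsd : s ≤ d) {y : Fin d → ℝ} (hy : ∀ k, 0 < y k)
    (h1 : (Finset.univ.filter fun k => r < y k).card < ⌈s⌉₊)
    (h2 : ⌈s⌉₊ ≤ (Finset.univ.filter fun k => a * r < y k).card) :
    ∃ σ : Equiv.Perm (Fin d), ∏ k, max 1 (y k / r) ≤
      (a * r) ^ (-s) * ∏ k, y (σ k) ^ svfExponent d s k := by
  have har : 0 < a * r := mul_pos ha hr
  have hd0 : (0 : ℝ) < d := by exact_mod_cast hd
  set σ := Tuple.sort fun k => -y k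
  have hanti : ∀ i j, i ≤ j → y (σ j) ≤ y (σ i) := by
    intro i j hij
    have := Tuple.monotone_sort (fun k => -y k) hij
    simpa using this
  refine ⟨σ, ?_⟩
  have hsmall : ∀ j : Fin d, ⌈s⌉₊ ≤ j.val + 1 → y (σ j) ≤ r := by
    intro j hj
    by_contra hlt
    push Not at hlt
    have hsub : (Finset.Iic j).map σ.toEmbedding ⊆ Finset.univ.filter fun k => r < y k := by
      intro k hk
      obtain ⟨i, hi, rfl⟩ := Finset.mem_map.mp hk
      rw [Finset.mem_filter]
      exact ⟨Finset.mem_univ _, hlt.trans_le (hanti i j (Finset.mem_Iic.mp hi))⟩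
    have := Finset.card_le_card hsub
    rw [Finset.card_map, Fin.card_Iic] at this
    omega
  have hlarge : ∀ j : Fin d, j.val + 1 ≤ ⌈s⌉₊ → a * r < y (σ j) := by
    intro j hj
    by_contra hle
    push Not at hle
    have hsub : (Finset.univ.filter fun k => a * r < y k) ⊆ (Finset.Iio j).map σ.toEmbedding := by
      intro k hk
      rw [Finset.mem_filter] at hk
      rw [Finset.mem_map]
      refine ⟨σ.symm k, ?_, by simp⟩
      rw [Finset.mem_Iio]
      by_contra hjk
      push Not at hjk
      have := hanti j (σ.symm k) hjk
      rw [Equiv.apply_symm_apply] at this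
      linarith [hk.2]
    have := Finset.card_le_card hsub
    rw [Finset.card_map, Fin.card_Iio] at this
    omega
  have hsc : s ≤ ⌈s⌉₊ := Nat.le_ceil s
  have hsc' : (⌈s⌉₊ : ℝ) < s + 1 := Nat.ceil_lt_add_one hs.le
  have hsvf : ∀ j : ℕ, svfExponent d s j = max 0 (min (s - j) 1) := by
    intro j
    have : s / d ≤ 1 := by rw [div_le_one hd0]; exact hsd
    rw [svfExponent, max_eq_right (a := s / d - 1) (by linarith), add_zero]
  rw [← Equiv.prod_comp σ fun k => max 1 (y k / r)]
  calc ∏ j, max 1 (y (σ j) / r) ≤ ∏ j : Fin d, (y (σ j) / (a * r)) ^ svfExponent d s j := by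
        refine Finset.prod_le_prod (fun j _ => by positivity) fun j _ => ?_
        rcases lt_trichotomy (j.val + 1) ⌈s⌉₊ with hj | hj | hj
        · have hj' : (j.val : ℝ) + 1 + 1 ≤ ⌈s⌉₊ := by exact_mod_cast hj
          have e1 : svfExponent d s j = 1 := by
            rw [hsvf, min_eq_right (by linarith), max_eq_right zero_le_one]
          have hl := hlarge j hj.le
          rw [e1, Real.rpow_one]
          refine max_le ((one_le_div har).mpr hl.le) ?_
          refine div_le_div_of_nonneg_left (hy _).le har ?_
          nlinarith
        · have hl := hlarge j hj.le
          rw [max_eq_left ((div_le_one hr).mpr (hsmall j hj.ge))]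
          exact Real.one_le_rpow ((one_le_div har).mpr hl.le) (svfExponent_nonneg _ _ _)
        · have hj' : (⌈s⌉₊ : ℝ) ≤ j.val := by exact_mod_cast Nat.lt_succ_iff.mp hj
          have e1 : svfExponent d s j = 0 := by
            rw [hsvf, min_eq_left (by linarith), max_eq_left (by linarith)]
          rw [e1, Real.rpow_zero, max_eq_left ((div_le_one hr).mpr (hsmall j hj.le))]
    _ = (a * r) ^ (-s) * ∏ j : Fin d, y (σ j) ^ svfExponent d s j := by
        have e1 : (a * r) ^ (-s) = ∏ j : Fin d, (a * r) ^ (-svfExponent d s j) := by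
          rw [← Real.rpow_sum_of_pos har, Finset.sum_neg_distrib, sum_svfExponent hd hs.le]
        rw [e1, ← Finset.prod_mul_distrib]
        refine Finset.prod_congr rfl fun j _ => ?_
        rw [Real.div_rpow (hy _).le har.le, Real.rpow_neg har.le]
        field_simp

variable {N d : ℕ} {t : Fin N → EuclideanSpace ℝ (Fin d)} {B : Set (EuclideanSpace ℝ (Fin d))}
  {e : Fin d → List (Fin N) → Fin N → ℝ}

/-- The first prefix of a word at which a property of words, true at the end, becomes true. -/
lemma exists_prefix_append_singleton {p : List (Fin N) → Prop} (h0 : ¬ p []) (w : List (Fin N))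
    (hw : p w) : ∃ u i, u ++ [i] <+: w ∧ ¬ p u ∧ p (u ++ [i]) := by
  induction w using List.reverseRecOn with
  | nil => exact absurd hw h0
  | append_singleton w i ih =>
    by_cases h : p w
    · obtain ⟨u, j, h1, h2⟩ := ih h
      exact ⟨u, j, h1.trans (List.prefix_append _ _), h2⟩
    · exact ⟨w, i, List.prefix_rfl, h, hw⟩

/-- The covering numbers of the sponge are controlled by the sums of the singular value functions
over finitely many words. -/
lemma exists_ballCoverNumber_le (hd : 1 ≤ d)
    (hinv : ∀ w i, ∀ x ∈ B,
      (WithLp.toLp 2 fun k => e k w i * x k + (1 - e k w i) * t i k : EuclideanSpace ℝ (Fin d)) ∈ B)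
    {R : ℝ} (hR : 0 ≤ R) (hBR : ∀ x ∈ B, ∀ k, |x k| ≤ R) {a b : ℝ} (ha : 0 < a) (hab : a ≤ b)
    (hb : b < 1) (he : ∀ k w i, |e k w i| ∈ Set.Icc a b) {s : ℝ} (hs : 0 < s) (hsd : s ≤ d) {r : ℝ}
    (hr : 0 < r) (hr1 : r < 1) :
    ∃ W : Finset (List (Fin N)), (ballCoverNumber r (⋂ n : ℕ, ⋃ w : List (Fin N),
      ⋃ _ : w.length = n, cylinderMap t e w '' B) : ℝ) ≤
      (2 * d * R + 1) ^ d * (a * r) ^ (-s) * ∑ w ∈ W, ∑ σ : Equiv.Perm (Fin d),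
        ∏ k, |wordProd (e (σ k)) [] w| ^ svfExponent d s k := by
  classical
  have ha1 : a < 1 := hab.trans_lt hb
  have hb0 : 0 < b := ha.trans_le hab
  set y : List (Fin N) → Fin d → ℝ := fun w k => |wordProd (e k) [] w|
  have hy : ∀ w k, 0 < y w k := fun w k => abs_wordProd_pos ha (he k) [] w
  set p : List (Fin N) → Prop := fun w => (Finset.univ.filter fun k => r < y w k).card < ⌈s⌉₊
  have hp0 : ¬ p [] := by
    have h1 : (Finset.univ.filter fun k => r < y [] k) = Finset.univ := by
      rw [Finset.filter_true_of_mem]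
      intro k _
      simpa [y, wordProd] using hr1
    simp only [p, h1, Finset.card_univ, Fintype.card_fin, not_lt]
    exact Nat.ceil_le.mpr hsd
  -- the words at which the number of sides longer than `r` first drops below `⌈s⌉`
  obtain ⟨n, hn⟩ := exists_pow_lt_of_lt_one hr hb
  have hpn : ∀ w : List (Fin N), w.length = n → p w := by
    intro w hw
    have h1 : (Finset.univ.filter fun k => r < y w k) = ∅ := by
      rw [Finset.filter_false_of_mem]
      intro k _
      have := abs_wordProd_le_pow (he k) [] w
      rw [hw] at this
      exact not_lt.mpr (this.trans hn.le)
    simp only [p, h1, Finset.card_empty]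
    exact Nat.ceil_pos.mpr hs
  choose u i hpre hu hui using fun w : Fin n → Fin N =>
    exists_prefix_append_singleton hp0 (List.ofFn w) (hpn _ (by simp))
  set W : Finset (List (Fin N)) := Finset.univ.image fun w => u w ++ [i w]
  have hW : ∀ w ∈ W, (Finset.univ.filter fun k => r < y w k).card < ⌈s⌉₊ ∧
      ⌈s⌉₊ ≤ (Finset.univ.filter fun k => a * r < y w k).card := by
    intro w hw
    obtain ⟨w', -, rfl⟩ := Finset.mem_image.mp hw
    refine ⟨hui w', (not_lt.mp (hu w')).trans (Finset.card_le_card ?_)⟩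
    intro k hk
    rw [Finset.mem_filter] at hk ⊢
    refine ⟨hk.1, ?_⟩
    simp only [y, wordProd_append, abs_mul]
    have h1 : a ≤ |wordProd (e k) ([] ++ u w') [i w']| := by
      simpa [wordProd] using (he k (u w') (i w')).1
    have h2 : r < |wordProd (e k) [] (u w')| := hk.2
    nlinarith
  choose C hCcard hCcov using fun w : List (Fin N) => exists_finset_cover_box (d := d) hr
    (fun k => wordMap (fun i => t i k) (e k) [] w 0 - y w k * R) (fun k => 2 * R * y w k)
  have hcyl : ∀ w, cylinderMap t e w '' B ⊆ ⋃ c ∈ C w, Metric.closedBall c r := by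
    intro w
    refine Set.Subset.trans ?_ (hCcov w)
    rintro _ ⟨x, hx, rfl⟩ k
    have h1 := wordMap_sub (fun i => t i k) (e k) [] w (x k) 0
    have h2 : |wordMap (fun i => t i k) (e k) [] w (x k) - wordMap (fun i => t i k) (e k) [] w 0| ≤
        y w k * R := by
      rw [h1, sub_zero, abs_mul]
      exact mul_le_mul_of_nonneg_left (hBR x hx k) (abs_nonneg _)
    rw [abs_le] at h2
    simp only [cylinderMap]
    constructor <;> linarith
  refine ⟨W, ?_⟩
  have hcover : (⋂ n : ℕ, ⋃ w : List (Fin N), ⋃ _ : w.length = n, cylinderMap t e w '' B) ⊆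
      ⋃ c ∈ W.biUnion C, Metric.closedBall c r := by
    intro x hx
    have h1 := Set.mem_iInter.mp hx n
    simp only [Set.mem_iUnion, exists_prop] at h1
    obtain ⟨w, hw, hxw⟩ := h1
    obtain ⟨w', rfl⟩ : ∃ w' : Fin n → Fin N, List.ofFn w' = w := by
      subst hw
      exact ⟨fun i => w.get i, List.ofFn_get w⟩
    have h2 := hcyl _ (cylinderMap_image_subset_of_prefix hinv (hpre w') hxw)
    simp only [Set.mem_iUnion, exists_prop] at h2 ⊢
    obtain ⟨c, hc, hxc⟩ := h2
    exact ⟨c, Finset.mem_biUnion.mpr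
      ⟨_, Finset.mem_image_of_mem _ (Finset.mem_univ w'), hc⟩, hxc⟩
  have hN1 : (ballCoverNumber r (⋂ n : ℕ, ⋃ w : List (Fin N),
      ⋃ _ : w.length = n, cylinderMap t e w '' B) : ℝ) ≤
      ∑ w ∈ W, ((∏ k, (⌊d * (2 * R * y w k) / r⌋₊ + 1) : ℕ) : ℝ) := by
    have h1 := (ballCoverNumber_le hr.le _ hcover).trans
      (Finset.card_biUnion_le.trans (Finset.sum_le_sum fun w _ => hCcard w))
    exact_mod_cast h1
  refine hN1.trans ?_
  rw [Finset.mul_sum]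
  refine Finset.sum_le_sum fun w hw => ?_
  obtain ⟨σ, hσ⟩ := exists_perm_prod_max_le hd ha ha1 hr hs hsd (hy w) (hW w hw).1 (hW w hw).2
  push_cast
  calc ∏ k, ((⌊d * (2 * R * y w k) / r⌋₊ : ℝ) + 1)
      ≤ ∏ k, (2 * d * R + 1) * max 1 (y w k / r) := by
        refine Finset.prod_le_prod (fun k _ => by positivity) fun k _ => ?_
        have h0 : 0 ≤ d * (2 * R * y w k) / r := by have := hy w k; positivity
        have h1 := Nat.floor_le h0
        have h2 : d * (2 * R * y w k) / r = 2 * d * R * (y w k / r) := by ring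
        have h3 : y w k / r ≤ max 1 (y w k / r) := le_max_right _ _
        have h4 : 1 ≤ max 1 (y w k / r) := le_max_left _ _
        have h5 : 0 ≤ 2 * d * R := by positivity
        nlinarith
    _ = (2 * d * R + 1) ^ d * ∏ k, max 1 (y w k / r) := by
        rw [Finset.prod_mul_distrib]; simp
    _ ≤ (2 * d * R + 1) ^ d * ((a * r) ^ (-s) * ∏ k, y w (σ k) ^ svfExponent d s k) := by
        gcongr
    _ = (2 * d * R + 1) ^ d * (a * r) ^ (-s) * ∏ k, y w (σ k) ^ svfExponent d s k := by ring
    _ ≤ _ := by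
        gcongr
        exact Finset.single_le_sum (f := fun σ : Equiv.Perm (Fin d) =>
          ∏ k, |wordProd (e (σ k)) [] w| ^ svfExponent d s k)
          (fun σ _ => Finset.prod_nonneg fun k _ => by positivity) (Finset.mem_univ σ)

end Covering

/-! ### Moments of words -/

section Moments

variable {N d : ℕ} {Ω : Type*} [MeasurableSpace Ω] {P : Measure Ω} {a b : ℝ}

/-- The ratio vectors of the field `α`, indexed by the parent word and the coordinate. -/
def ratioField (α : List (Fin N) → Fin d → Ω → ℝ) (z : List (Fin N) × Fin d) (ω : Ω)
    (j : Fin N) : ℝ :=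
  α (z.1 ++ [j]) z.2 ω

lemma isVecRatioField_ratioField {α : List (Fin N) → Fin d → Ω → ℝ} (ha : 0 < a) (hab : a ≤ b)
    (hb : b < 1) (hmeas : ∀ w : List (Fin N), w ≠ [] → ∀ k, Measurable (α w k))
    (hindep : iIndepFun (ratioField α) P)
    (hident : ∀ k w w', IdentDistrib (ratioField α (w, k)) (ratioField α (w', k)) P P)
    (hbd : ∀ w : List (Fin N), w ≠ [] → ∀ k ω, |α w k ω| ∈ Set.Icc a b) :
    IsVecRatioField P a b (ratioField α) where
  indep := hindep
  coord k :=
    { pos := ha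
      le := hab
      lt_one := hb
      measurable := fun w => measurable_pi_lambda _ fun j => hmeas _ (by simp) k
      indep := hindep.precomp (g := fun w => (w, k)) fun w w' h => (Prod.ext_iff.mp h).1
      ident := hident k
      bound := fun w ω i => hbd _ (by simp) k ω }

lemma vecMoment_ofFn (ξ : List (Fin N) × Fin d → Ω → Fin N → ℝ) (p : Fin d → ℝ) {h : ℕ}
    (u : Fin h → Fin N) : vecMoment P ξ p (List.ofFn u) = ∏ j, vecMoment P ξ p [u j] := by
  simp only [vecMoment, wordMoment, List.map_ofFn, List.prod_ofFn, List.map_cons, List.map_nil,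
    List.prod_cons, List.prod_nil, mul_one, Function.comp_apply]
  exact Finset.prod_comm

lemma sum_vecMoment_ofFn_append (ξ : List (Fin N) × Fin d → Ω → Fin N → ℝ) (p : Fin d → ℝ) (h : ℕ)
    (v : List (Fin N)) : ∑ u : Fin h → Fin N, vecMoment P ξ p (List.ofFn u ++ v) =
      (∑ i, vecMoment P ξ p [i]) ^ h * vecMoment P ξ p v := by
  simp_rw [vecMoment_append, vecMoment_ofFn]
  rw [← Finset.sum_mul, Fintype.sum_pow]

lemma vecWeight_singleton {Ω : Type*} (ξ : List (Fin N) × Fin d → Ω → Fin N → ℝ) (p : Fin d → ℝ) (i : Fin N) (ω : Ω) :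
    vecWeight ξ p [] [i] ω = ENNReal.ofReal (∏ k, |ξ ([], k) ω i| ^ p k) := by
  rw [ENNReal.ofReal_prod_of_nonneg fun k _ => by positivity]
  simp [vecWeight, weight, wordProd]

variable {ξ : List (Fin N) × Fin d → Ω → Fin N → ℝ} (H : IsVecRatioField P a b ξ)

include H

lemma vecMoment_le_one {p : Fin d → ℝ} (hp : ∀ k, 0 ≤ p k) (x : List (Fin N)) :
    vecMoment P ξ p x ≤ 1 := by
  have := H.indep.isProbabilityMeasure
  rw [← lintegral_vecWeight H p [] x]
  calc ∫⁻ ω, vecWeight ξ p [] x ω ∂P ≤ ∫⁻ _, 1 ∂P :=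
        lintegral_mono fun ω => vecWeight_le_one H hp [] x ω
    _ = 1 := by simp

lemma vecMoment_pos {p : Fin d → ℝ} (hp : ∀ k, 0 ≤ p k) (x : List (Fin N)) :
    0 < vecMoment P ξ p x := by
  have := H.indep.isProbabilityMeasure
  rw [← lintegral_vecWeight H p [] x]
  have hlow : ∏ k : Fin d, ENNReal.ofReal ((a ^ x.length) ^ p k) ≤
      ∫⁻ ω, vecWeight ξ p [] x ω ∂P := by
    calc ∏ k : Fin d, ENNReal.ofReal ((a ^ x.length) ^ p k)
        = ∫⁻ _, ∏ k : Fin d, ENNReal.ofReal ((a ^ x.length) ^ p k) ∂P := by simp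
      _ ≤ _ := by
        refine lintegral_mono fun ω => Finset.prod_le_prod' fun k _ => ?_
        refine ENNReal.ofReal_le_ofReal (Real.rpow_le_rpow (pow_nonneg (H.coord k).pos.le _) ?_
          (hp k))
        exact pow_le_abs_wordProd (H.coord k).pos (fun w i => (H.coord k).bound w ω i) [] x
  refine lt_of_lt_of_le ?_ hlow
  rw [pos_iff_ne_zero, Finset.prod_ne_zero_iff]
  intro k _
  have := (H.coord k).pos
  rw [ENNReal.ofReal_ne_zero_iff]
  positivity

/-- Raising the exponents lowers the total moment. -/
lemma sum_vecMoment_le_mul {p p' : Fin d → ℝ} (hpp : ∀ k, p k ≤ p' k) :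
    ∑ i, vecMoment P ξ p' [i] ≤
      ENNReal.ofReal (b ^ (∑ k, (p' k - p k))) * ∑ i, vecMoment P ξ p [i] := by
  rw [Finset.mul_sum]
  refine Finset.sum_le_sum fun i _ => ?_
  rw [← lintegral_vecWeight H p [] [i], ← lintegral_vecWeight H p' [] [i],
    ← lintegral_const_mul' _ _ ENNReal.ofReal_ne_top]
  refine lintegral_mono fun ω => ?_
  rcases isEmpty_or_nonempty (Fin d) with hd | ⟨⟨k₀⟩⟩
  · simp [vecWeight]
  have hb0 : 0 ≤ b := (H.coord k₀).pos.le.trans (H.coord k₀).le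
  beta_reduce
  rw [vecWeight_singleton, vecWeight_singleton, ← ENNReal.ofReal_mul (by positivity)]
  exact ENNReal.ofReal_le_ofReal
    (prod_rpow_le_mul (H.coord k₀).pos (fun k => (H.coord k).bound [] ω i) hpp)

/-- Suitable blocks, all ending with a word that separates in every coordinate, have a total moment
exceeding one. -/
lemma exists_blocks {t : Fin N → EuclideanSpace ℝ (Fin d)} (hab : 0 ≤ b) (hb : b < 1)
    (ht : ∀ k : Fin d, ∃ i j : Fin N, t i k ≠ t j k)
    (hsm : ∀ k : Fin d, ∃ l : Fin N, EventuallySmooth (P.map fun ω => Real.log |ξ ([], k) ω l|))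
    {p : Fin d → ℝ} (hp : ∀ k, 0 ≤ p k) (hM : 1 < ∑ i, vecMoment P ξ p [i]) :
    ∃ R, 0 ≤ R ∧ (∀ i k, |t i k| ≤ R) ∧ ∃ (v : List (Fin N)) (h : ℕ),
      (∀ k, IsSeparating P (fun w => ξ (w, k)) (fun i => t i k) R v) ∧ ∃ r : ℝ, 1 < r ∧
        ∑ u : Fin h → Fin N, vecMoment P ξ p (List.ofFn u ++ v) = ENNReal.ofReal r := by
  set T := ∑ i, ∑ k, |t i k| with hTdef
  have hT : ∀ i k, |t i k| ≤ T := fun i k =>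
    (Finset.single_le_sum (f := fun k => |t i k|) (fun _ _ => abs_nonneg _)
      (Finset.mem_univ k)).trans
    (Finset.single_le_sum (f := fun i => ∑ k, |t i k|)
      (fun _ _ => Finset.sum_nonneg fun _ _ => abs_nonneg _) (Finset.mem_univ i))
  have hT0 : 0 ≤ T := Finset.sum_nonneg fun _ _ => Finset.sum_nonneg fun _ _ => abs_nonneg _
  have hb1 : 0 < 1 - b := by linarith
  -- this value of `R` solves `b * R + (1 + b) * T = R`
  set R := (1 + b) * T / (1 - b) with hRdef
  have hTR : T ≤ R := by
    rw [hRdef, le_div_iff₀ hb1]; nlinarith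
  have hR : b * R + (1 + b) * T ≤ R := by
    have : R * (1 - b) = (1 + b) * T := div_mul_cancel₀ _ hb1.ne'
    linarith
  have hs : ∀ k, ∃ s : List (Fin N), ∀ v₁ v₃ : List (Fin N),
      IsSeparating P (fun w => ξ (w, k)) (fun i => t i k) R (v₁ ++ s ++ v₃) := by
    intro k
    obtain ⟨l, hl⟩ := hsm k
    obtain ⟨i, hi⟩ : ∃ i, t i k ≠ t l k := by
      obtain ⟨i, j, hij⟩ := ht k
      by_contra hall
      push Not at hall
      exact hij ((hall i).trans (hall j).symm)
    exact exists_isSeparating (H.coord k) (fun i => hT i k) hTR hR hi hl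
  choose s hs using hs
  set v := (List.finRange d).flatMap s with hv
  have hsep : ∀ k, IsSeparating P (fun w => ξ (w, k)) (fun i => t i k) R v := by
    intro k
    obtain ⟨l₁, l₂, hl⟩ := List.append_of_mem (List.mem_finRange k)
    have : v = l₁.flatMap s ++ s k ++ l₂.flatMap s := by
      rw [hv, hl]; simp
    rw [this]
    exact hs k _ _
  have hv0 := vecMoment_pos H hp v
  -- long blocks compensate for the moment of `v`
  obtain ⟨h, hh⟩ : ∃ h : ℕ, 1 < (∑ i, vecMoment P ξ p [i]) ^ h * vecMoment P ξ p v := by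
    have htend := ENNReal.tendsto_pow_atTop_nhds_top_iff.mpr hM
    have h2 := ENNReal.Tendsto.mul_const (b := vecMoment P ξ p v) htend (Or.inl (by simp))
    rw [ENNReal.top_mul hv0.ne'] at h2
    exact (h2.eventually (lt_mem_nhds ENNReal.one_lt_top)).exists
  have hfin : (∑ i, vecMoment P ξ p [i]) ^ h * vecMoment P ξ p v ≠ ⊤ := by
    refine ENNReal.mul_ne_top (ENNReal.pow_ne_top (ENNReal.sum_ne_top.mpr fun i _ => ?_)) ?_
    · exact ((vecMoment_le_one H hp [i]).trans_lt ENNReal.one_lt_top).ne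
    · exact ((vecMoment_le_one H hp v).trans_lt ENNReal.one_lt_top).ne
  refine ⟨R, hT0.trans hTR, fun i k => (hT i k).trans hTR, v, h, hsep,
    ((∑ i, vecMoment P ξ p [i]) ^ h * vecMoment P ξ p v).toReal, ?_, ?_⟩
  · rw [← ENNReal.toReal_one]
    exact ENNReal.toReal_strict_mono hfin hh
  · rw [sum_vecMoment_ofFn_append, ENNReal.ofReal_toReal hfin]

/-- The energy inequality in `ENNReal`, read in the real numbers. -/
lemma sum_toReal_energy_le {h : ℕ} {v : List (Fin N)} {p : Fin d → ℝ} (hp : ∀ k, 0 ≤ p k)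
    {c : Fin d → Fin N → ℝ} {q : Fin d → ℝ} {g : Fin d → ℝ → ℝ} (hg : ∀ k z, 0 ≤ g k z) {n : ℕ}
    {w : List (Fin N)} {ω : Ω} {C : ℝ} (hC : 0 ≤ C)
    (hE : energy h v ξ p c q (fun k z => ENNReal.ofReal (g k z)) n w ω ≤
      ENNReal.ofReal C * mass h v ξ p n w ω ^ 2) :
    ∑ X : Fin n → Fin h → Fin N, ∑ Y : Fin n → Fin h → Fin N,
      (vecWeight ξ p w (blockWord v (List.ofFn X)) ω).toReal *
        (vecWeight ξ p w (blockWord v (List.ofFn Y)) ω).toReal *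
        ∏ k, g k (wordMap (c k) (fun z => ξ (z, k) ω) w (blockWord v (List.ofFn X)) (q k) -
          wordMap (c k) (fun z => ξ (z, k) ω) w (blockWord v (List.ofFn Y)) (q k)) ≤
      C * (∑ X : Fin n → Fin h → Fin N,
        (vecWeight ξ p w (blockWord v (List.ofFn X)) ω).toReal) ^ 2 := by
  have hw : ∀ x, vecWeight ξ p w x ω ≠ ⊤ := fun x =>
    ((vecWeight_le_one H hp w x ω).trans_lt ENNReal.one_lt_top).ne
  have hk : ∀ x y, vecKernel ξ c q (fun k z => ENNReal.ofReal (g k z)) w x y ω =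
      ENNReal.ofReal (∏ k, g k (wordMap (c k) (fun z => ξ (z, k) ω) w x (q k) -
          wordMap (c k) (fun z => ξ (z, k) ω) w y (q k))) := fun x y =>
    (ENNReal.ofReal_prod_of_nonneg fun k _ => hg k _).symm
  have hfin : ENNReal.ofReal C * mass h v ξ p n w ω ^ 2 ≠ ⊤ :=
    ENNReal.mul_ne_top ENNReal.ofReal_ne_top
      (ENNReal.pow_ne_top (ENNReal.sum_ne_top.mpr fun X _ => hw _))
  have := ENNReal.toReal_mono hfin hE
  rw [ENNReal.toReal_mul, ENNReal.toReal_ofReal hC, ENNReal.toReal_pow, mass,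
    ENNReal.toReal_sum fun X _ => hw _, energy] at this
  simp_rw [hk] at this
  have hne : ∀ x y, vecWeight ξ p w x ω * vecWeight ξ p w y ω *
      ENNReal.ofReal (∏ k, g k (wordMap (c k) (fun z => ξ (z, k) ω) w x (q k) -
          wordMap (c k) (fun z => ξ (z, k) ω) w y (q k))) ≠ ⊤ := fun x y =>
    ENNReal.mul_ne_top (ENNReal.mul_ne_top (hw x) (hw y)) ENNReal.ofReal_ne_top
  rw [ENNReal.toReal_sum fun X _ => ENNReal.sum_ne_top.mpr fun Y _ => hne _ _] at this
  simp_rw [ENNReal.toReal_sum fun Y _ => hne _ _, ENNReal.toReal_mul] at this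
  simp_rw [ENNReal.toReal_ofReal (Finset.prod_nonneg fun k _ => hg k _)] at this
  exact this

end Moments

/-! ### Lower bounds for the dimension and the volume -/

lemma cylinderMap_append_sub {N d : ℕ} (t : Fin N → EuclideanSpace ℝ (Fin d))
    (e : Fin d → List (Fin N) → Fin N → ℝ) (w x y : List (Fin N)) (q : EuclideanSpace ℝ (Fin d))
    (k : Fin d) : cylinderMap t e (w ++ x) q k - cylinderMap t e (w ++ y) q k =
      wordProd (e k) [] w * (wordMap (fun i => t i k) (e k) w x (q k) -
        wordMap (fun i => t i k) (e k) w y (q k)) := by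
  simp only [cylinderMap, wordMap_append, wordMap_sub, List.nil_append]

section LowerBound

variable {N d : ℕ} {Ω : Type*} [MeasurableSpace Ω] {P : Measure Ω} {a b : ℝ}
  {ξ : List (Fin N) × Fin d → Ω → Fin N → ℝ} (H : IsVecRatioField P a b ξ)

include H

/-- If the words of length one have a total moment exceeding one, then almost surely there is a
word below which, at arbitrarily small scales `ρ`, there are weighted words with a bounded
normalized energy for the kernel `g ρ`. -/
lemma ae_exists_energy_le (hd : 1 ≤ d) {t : Fin N → EuclideanSpace ℝ (Fin d)}
    (ht : ∀ k : Fin d, ∃ i j : Fin N, t i k ≠ t j k)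
    (hsm : ∀ k : Fin d, ∃ l : Fin N, EventuallySmooth (P.map fun ω => Real.log |ξ ([], k) ω l|))
    {p : Fin d → ℝ} (hp : ∀ k, 0 ≤ p k) (hM : 1 < ∑ i, vecMoment P ξ p [i])
    {g : ℝ → Fin d → ℝ → ℝ} (hg : ∀ ρ k z, 0 < ρ → 0 ≤ g ρ k z) (hgm : ∀ ρ k, Measurable (g ρ k))
    (hg0 : ∀ ρ k, 0 < ρ → ρ ≤ 1 → g ρ k 0 ≤ ρ⁻¹)
    (hgi : ∀ R : ℝ, 0 ≤ R → ∃ K : ENNReal, K ≠ ⊤ ∧ ∀ ρ k, 0 < ρ → ∀ A : ℝ, 0 < A → A ≤ 1 →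
      ∫⁻ z in Set.Icc (-(A * (2 * R))) (A * (2 * R)), ENNReal.ofReal (g ρ k z) ≤
        K * ENNReal.ofReal (A ^ (1 - p k))) (i₀ : Fin N) :
    ∀ᵐ ω ∂P, ∃ (w₀ : List (Fin N)) (C : ℝ), ∀ ε > 0, ∃ ρ, 0 < ρ ∧ ρ < ε ∧
      ∃ (ι : Type) (_ : Fintype ι) (x : ι → List (Fin N)) (q : ι → ℝ), (∀ X, 0 ≤ q X) ∧
        0 < ∑ X, q X ∧ ∑ X, ∑ Y, q X * q Y * ∏ k, g ρ k
          (wordMap (fun i => t i k) (fun z => ξ (z, k) ω) w₀ (x X) (t i₀ k) -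
            wordMap (fun i => t i k) (fun z => ξ (z, k) ω) w₀ (x Y) (t i₀ k)) ≤
        C * (∑ X, q X) ^ 2 := by
  have k₀ : Fin d := ⟨0, hd⟩
  have hd0 : (d : ℝ) ≠ 0 := by positivity
  obtain ⟨R, hR, hRt, v, h, hsep, r, hr, hrv⟩ := exists_blocks H
    ((H.coord k₀).pos.le.trans (H.coord k₀).le) (H.coord k₀).lt_one ht hsm hp hM
  obtain ⟨K, hK, hKi⟩ := hgi R hR
  have hr0 : 0 < r := by linarith
  -- the scale of generation `n` is `θ ^ n`, where `θ ^ d = 1 / r`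
  set θ := r ^ (-(1 / d : ℝ)) with hθ
  have hθ0 : 0 < θ := Real.rpow_pos_of_pos hr0 _
  have hθ1 : θ < 1 := Real.rpow_lt_one_of_one_lt_of_neg hr
    (neg_neg_of_pos (by positivity))
  have hθd : θ⁻¹ ^ d = r := by
    rw [hθ, ← Real.rpow_neg hr0.le, neg_neg, ← Real.rpow_natCast, ← Real.rpow_mul hr0.le,
      one_div_mul_cancel hd0, Real.rpow_one]
  obtain ⟨C, hC, hae⟩ := ae_frequently_energy_le H (Fin.pos i₀) hp (c := fun k i => t i k) hR
    (q := fun k => t i₀ k) (fun k => hRt i₀ k) hsep hr hrv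
    (κ := fun n k z => ENNReal.ofReal (g (θ ^ n) k z)) (fun n k => (hgm _ k).ennreal_ofReal) hK
    (fun n k => hKi _ k (pow_pos hθ0 n)) (fun n => by
      calc ∏ k, ENNReal.ofReal (g (θ ^ n) k 0) ≤ ∏ _k : Fin d, ENNReal.ofReal (θ ^ n)⁻¹ :=
            Finset.prod_le_prod' fun k _ => ENNReal.ofReal_le_ofReal
              (hg0 _ k (pow_pos hθ0 n) (pow_le_one₀ hθ0.le hθ1.le))
        _ = ENNReal.ofReal r ^ n := by
            rw [Finset.prod_const, Finset.card_univ, Fintype.card_fin,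
              ← ENNReal.ofReal_pow (by positivity), ← ENNReal.ofReal_pow hr0.le, ← inv_pow,
              ← pow_mul, mul_comm, pow_mul, hθd]
        _ ≤ _ := le_rfl)
  filter_upwards [hae] with ω hω
  obtain ⟨w₀, hfreq⟩ := hω
  refine ⟨w₀, C, fun ε hε => ?_⟩
  have hsmall : ∀ᶠ n in atTop, θ ^ n < ε :=
    (tendsto_pow_atTop_nhds_zero_of_lt_one hθ0.le hθ1).eventually (gt_mem_nhds hε)
  obtain ⟨n, ⟨hmass, hE⟩, hn⟩ := (hfreq.and_eventually hsmall).exists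
  refine ⟨θ ^ n, pow_pos hθ0 n, hn, Fin n → Fin h → Fin N, inferInstance,
    fun X => blockWord v (List.ofFn X),
    fun X => (vecWeight ξ p w₀ (blockWord v (List.ofFn X)) ω).toReal,
    fun X => ENNReal.toReal_nonneg, ?_,
    sum_toReal_energy_le H hp (fun k z => hg _ k z (pow_pos hθ0 n)) hC hE⟩
  have hw : ∀ x, vecWeight ξ p w₀ x ω ≠ ⊤ := fun x =>
    ((vecWeight_le_one H hp w₀ x ω).trans_lt ENNReal.one_lt_top).ne
  rw [← ENNReal.toReal_sum fun X _ => hw _]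
  exact ENNReal.toReal_pos hmass.ne' (ENNReal.sum_ne_top.mpr fun X _ => hw _)

end LowerBound

lemma lintegral_abs_rpow_neg_le {p : ℝ} (hp1 : p < 1) {L : ℝ} (hL : 0 ≤ L) :
    ∫⁻ z in Set.Icc (-L) L, ENNReal.ofReal (|z| ^ (-p)) ≤
      ENNReal.ofReal (2 / (1 - p) * L ^ (1 - p)) := by
  have hp' : 0 < 1 - p := by linarith
  have h1 : ∫⁻ z in Set.Icc 0 L, ENNReal.ofReal (|z| ^ (-p)) =
      ENNReal.ofReal (L ^ (1 - p) / (1 - p)) := by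
    have hint : IntervalIntegrable (fun z : ℝ => z ^ (-p)) volume 0 L :=
      intervalIntegral.intervalIntegrable_rpow' (by linarith)
    rw [intervalIntegrable_iff_integrableOn_Icc_of_le hL] at hint
    have e1 : ∫⁻ z in Set.Icc 0 L, ENNReal.ofReal (|z| ^ (-p)) =
        ∫⁻ z in Set.Icc 0 L, ENNReal.ofReal (z ^ (-p)) :=
      setLIntegral_congr_fun measurableSet_Icc fun z hz => by
        simp only [abs_of_nonneg hz.1]
    rw [e1, ← ofReal_integral_eq_lintegral_ofReal hint
      (ae_restrict_of_forall_mem measurableSet_Icc fun z hz => Real.rpow_nonneg hz.1 _),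
      integral_Icc_eq_integral_Ioc, ← intervalIntegral.integral_of_le hL,
      integral_rpow (Or.inl (by linarith)), Real.zero_rpow (by linarith), sub_zero,
      neg_add_eq_sub]
  have h2 : ∫⁻ z in Set.Icc (-L) 0, ENNReal.ofReal (|z| ^ (-p)) =
      ∫⁻ z in Set.Icc 0 L, ENNReal.ofReal (|z| ^ (-p)) := by
    have := (Measure.measurePreserving_neg (volume : Measure ℝ)).setLIntegral_comp_preimage_emb
      (MeasurableEquiv.neg ℝ).measurableEmbedding (fun z => ENNReal.ofReal (|z| ^ (-p)))
      (Set.Icc 0 L)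
    rw [← this]
    simp
  have hsub : Set.Icc (-L) L ⊆ Set.Icc (-L) 0 ∪ Set.Icc 0 L := by
    intro z hz
    rcases le_total z 0 with h | h
    · exact Or.inl ⟨hz.1, h⟩
    · exact Or.inr ⟨h, hz.2⟩
  calc ∫⁻ z in Set.Icc (-L) L, ENNReal.ofReal (|z| ^ (-p))
      ≤ ∫⁻ z in Set.Icc (-L) 0 ∪ Set.Icc 0 L, ENNReal.ofReal (|z| ^ (-p)) :=
        lintegral_mono_set hsub
    _ ≤ _ := lintegral_union_le _ _ _
    _ = _ := by
        rw [h2, h1, ← ENNReal.ofReal_add (by positivity) (by positivity)]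
        congr 1
        ring

lemma lintegral_max_rpow_neg_le {p : ℝ} (hp : 0 ≤ p) (hp1 : p < 1) {R A ρ : ℝ} (hR : 0 ≤ R)
    (hA : 0 < A) :
    ∫⁻ z in Set.Icc (-(A * (2 * R))) (A * (2 * R)), ENNReal.ofReal (max |z| ρ ^ (-p)) ≤
      ENNReal.ofReal (2 / (1 - p) * (2 * R) ^ (1 - p)) * ENNReal.ofReal (A ^ (1 - p)) := by
  have hp' : 0 < 1 - p := by linarith
  calc ∫⁻ z in Set.Icc (-(A * (2 * R))) (A * (2 * R)), ENNReal.ofReal (max |z| ρ ^ (-p))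
      ≤ ∫⁻ z in Set.Icc (-(A * (2 * R))) (A * (2 * R)), ENNReal.ofReal (|z| ^ (-p)) := by
        refine lintegral_mono_ae (ae_restrict_of_ae ?_)
        filter_upwards [compl_mem_ae_iff.mpr (measure_singleton (0 : ℝ))] with z hz
        have hz0 : 0 < |z| := abs_pos.mpr hz
        exact ENNReal.ofReal_le_ofReal
          (Real.rpow_le_rpow_of_nonpos hz0 (le_max_left _ _) (by linarith))
    _ ≤ _ := lintegral_abs_rpow_neg_le hp1 (by positivity)
    _ = _ := by
        rw [Real.mul_rpow hA.le (by positivity), ← ENNReal.ofReal_mul (by positivity)]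
        congr 1
        ring

section LowerBound

variable {N d : ℕ} {Ω : Type*} [MeasurableSpace Ω] {P : Measure Ω} {a b : ℝ}
  {ξ : List (Fin N) × Fin d → Ω → Fin N → ℝ} (H : IsVecRatioField P a b ξ)

include H

/-- Supercritical exponents below one bound the dimension of a compact set that contains the images
of a fixed point. -/
theorem ae_le_dimH (hd : 1 ≤ d) {t : Fin N → EuclideanSpace ℝ (Fin d)}
    (ht : ∀ k : Fin d, ∃ i j : Fin N, t i k ≠ t j k)
    (hsm : ∀ k : Fin d, ∃ l : Fin N, EventuallySmooth (P.map fun ω => Real.log |ξ ([], k) ω l|))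
    {p : Fin d → ℝ} (hp : ∀ k, 0 ≤ p k) (hp1 : ∀ k, p k < 1) (hM : 1 < ∑ i, vecMoment P ξ p [i])
    {S : Ω → Set (EuclideanSpace ℝ (Fin d))} (i₀ : Fin N) :
    ∀ᵐ ω ∂P, IsCompact (S ω) → (∀ w, cylinderMap t (fun k z => ξ (z, k) ω) w (t i₀) ∈ S ω) →
      ENNReal.ofReal (∑ k, p k) ≤ dimH (S ω) := by
  have k₀ : Fin d := ⟨0, hd⟩
  filter_upwards [ae_exists_energy_le H hd ht hsm hp hM
    (g := fun ρ k z => max |z| ρ ^ (-p k)) (fun ρ k z hρ => by positivity)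
    (fun ρ k => by fun_prop)
    (fun ρ k hρ hρ1 => by
      simp only [abs_zero, max_eq_right hρ.le]
      rw [← Real.rpow_neg_one]
      exact Real.rpow_le_rpow_of_exponent_ge hρ hρ1 (by linarith [hp1 k]))
    (fun R hR => ⟨∑ k, ENNReal.ofReal (2 / (1 - p k) * (2 * R) ^ (1 - p k)),
      ENNReal.sum_ne_top.mpr fun k _ => ENNReal.ofReal_ne_top, fun ρ k hρ A hA hA1 =>
      (lintegral_max_rpow_neg_le (hp k) (hp1 k) hR hA).trans (mul_le_mul_left
        (Finset.single_le_sum (f := fun k => ENNReal.ofReal (2 / (1 - p k) * (2 * R) ^ (1 - p k)))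
          (fun _ _ => zero_le) (Finset.mem_univ k)) _)⟩) i₀] with ω hω hS hmem
  obtain ⟨w₀, C, hω⟩ := hω
  have hc0 : 0 < a ^ w₀.length := pow_pos (H.coord k₀).pos _
  set c := a ^ w₀.length
  have hc1 : c ≤ 1 := pow_le_one₀ (H.coord k₀).pos.le
    ((H.coord k₀).le.trans (H.coord k₀).lt_one.le)
  refine le_dimH_of_energy_le hS hp (K := (∏ k, c ^ (-p k)) * C) fun ε hε => ?_
  obtain ⟨ρ, hρ, hρε, ι, hι, x, q, hq, hq0, hE⟩ := hω ε hε
  refine ⟨ρ, hρ, hρε, ι, hι, fun X => cylinderMap t (fun k z => ξ (z, k) ω) (w₀ ++ x X) (t i₀),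
    q, fun X => hmem _, hq, hq0, ?_⟩
  rw [mul_assoc]
  refine le_trans ?_ (mul_le_mul_of_nonneg_left hE (by positivity))
  rw [Finset.mul_sum]
  refine Finset.sum_le_sum fun X _ => ?_
  rw [Finset.mul_sum]
  refine Finset.sum_le_sum fun Y _ => ?_
  rw [mul_left_comm]
  refine mul_le_mul_of_nonneg_left ?_ (mul_nonneg (hq X) (hq Y))
  rw [← Finset.prod_mul_distrib]
  refine Finset.prod_le_prod (fun k _ => by positivity) fun k _ => ?_
  rw [cylinderMap_append_sub, abs_mul, ← Real.mul_rpow hc0.le (by positivity)]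
  refine Real.rpow_le_rpow_of_nonpos (by positivity) ?_ (by linarith [hp k])
  rw [mul_max_of_nonneg _ _ hc0.le]
  refine max_le_max ?_ (mul_le_of_le_one_left hρ.le hc1)
  exact mul_le_mul_of_nonneg_right
    (pow_le_abs_wordProd (H.coord k).pos (fun w i => (H.coord k).bound w ω i) [] w₀) (abs_nonneg _)

/-- If all exponents can be equal to one, the volume is positive. -/
theorem ae_volume_pos (hd : 1 ≤ d) {t : Fin N → EuclideanSpace ℝ (Fin d)}
    (ht : ∀ k : Fin d, ∃ i j : Fin N, t i k ≠ t j k)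
    (hsm : ∀ k : Fin d, ∃ l : Fin N, EventuallySmooth (P.map fun ω => Real.log |ξ ([], k) ω l|))
    (hM : 1 < ∑ i, vecMoment P ξ (fun _ => 1) [i])
    {S : Ω → Set (EuclideanSpace ℝ (Fin d))} (i₀ : Fin N) :
    ∀ᵐ ω ∂P, IsCompact (S ω) → (∀ w, cylinderMap t (fun k z => ξ (z, k) ω) w (t i₀) ∈ S ω) →
      0 < volume (S ω) := by
  have k₀ : Fin d := ⟨0, hd⟩
  filter_upwards [ae_exists_energy_le H hd ht hsm (fun _ => zero_le_one) hM
    (g := fun ρ k z => if |z| ≤ ρ then ρ⁻¹ else 0) (fun ρ k z hρ => by positivity)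
    (fun ρ k => Measurable.ite (measurableSet_le (by fun_prop) measurable_const) measurable_const
      measurable_const)
    (fun ρ k hρ hρ1 => by simp [hρ.le])
    (fun R hR => ⟨2, by simp, fun ρ k hρ A hA hA1 => by
      calc ∫⁻ z in Set.Icc (-(A * (2 * R))) (A * (2 * R)),
            ENNReal.ofReal (if |z| ≤ ρ then ρ⁻¹ else 0)
          ≤ ∫⁻ z, (Set.Icc (-ρ) ρ).indicator (fun _ => ENNReal.ofReal ρ⁻¹) z := by
            refine (setLIntegral_le_lintegral _ _).trans (lintegral_mono fun z => ?_)
            by_cases hz : |z| ≤ ρ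
            · rw [if_pos hz, Set.indicator_of_mem (show z ∈ Set.Icc (-ρ) ρ from abs_le.mp hz)]
            · simp [hz]
        _ = ENNReal.ofReal (ρ⁻¹ * (2 * ρ)) := by
            rw [lintegral_indicator measurableSet_Icc, setLIntegral_const, Real.volume_Icc,
              ← ENNReal.ofReal_mul (by positivity)]
            congr 2
            ring
        _ = _ := by
            rw [show ρ⁻¹ * (2 * ρ) = 2 by field_simp]
            simp⟩) i₀] with ω hω hS hmem
  obtain ⟨w₀, C, hω⟩ := hω
  have hc0 : 0 < a ^ w₀.length := pow_pos (H.coord k₀).pos _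
  set c := a ^ w₀.length
  have hc1 : c ≤ 1 := pow_le_one₀ (H.coord k₀).pos.le
    ((H.coord k₀).le.trans (H.coord k₀).lt_one.le)
  refine volume_pos_of_energy_le hS (K := (∏ _k : Fin d, c⁻¹) * C) fun ε hε => ?_
  obtain ⟨ρ, hρ, hρε, ι, hι, x, q, hq, hq0, hE⟩ := hω ε hε
  -- the cylinder of `w₀` contracts distances at most by the factor `c`
  refine ⟨c * ρ, by positivity, (mul_le_of_le_one_left hρ.le hc1).trans_lt hρε, ι, hι,
    fun X => cylinderMap t (fun k z => ξ (z, k) ω) (w₀ ++ x X) (t i₀),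
    q, fun X => hmem _, hq, hq0, ?_⟩
  rw [mul_assoc]
  refine le_trans ?_ (mul_le_mul_of_nonneg_left hE (by positivity))
  rw [Finset.mul_sum]
  refine Finset.sum_le_sum fun X _ => ?_
  rw [Finset.mul_sum]
  refine Finset.sum_le_sum fun Y _ => ?_
  rw [mul_left_comm]
  refine mul_le_mul_of_nonneg_left ?_ (mul_nonneg (hq X) (hq Y))
  rw [← Finset.prod_mul_distrib]
  refine Finset.prod_le_prod (fun k _ => by positivity) fun k _ => ?_
  rw [cylinderMap_append_sub, abs_mul]
  have hle := pow_le_abs_wordProd (H.coord k).pos (fun w i => (H.coord k).bound w ω i) [] w₀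
  set D := |wordMap (fun i => t i k) (fun z => ξ (z, k) ω) w₀ (x X) (t i₀ k) -
    wordMap (fun i => t i k) (fun z => ξ (z, k) ω) w₀ (x Y) (t i₀ k)|
  have hD : 0 ≤ D := abs_nonneg _
  split_ifs with h1 h2 h2
  · rw [mul_inv]
  · exact absurd (le_of_mul_le_mul_left ((mul_le_mul_of_nonneg_right hle hD).trans h1) hc0) h2
  · positivity
  · simp

end LowerBound

/-! ### Almost sure covering bounds -/

section UpperBound

variable {N d : ℕ} {Ω : Type*} [MeasurableSpace Ω] {P : Measure Ω} {a b : ℝ}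
  {ξ : List (Fin N) × Fin d → Ω → Fin N → ℝ} (H : IsVecRatioField P a b ξ)

include H

/-- Subcritical weights are almost surely summable over all words. -/
lemma ae_exists_sum_prod_rpow_le {p : Fin d → ℝ}
    (hM : ∑ i, vecMoment P ξ p [i] < 1) :
    ∀ᵐ ω ∂P, ∃ K : ℝ, ∀ W : Finset (List (Fin N)),
      ∑ w ∈ W, ∏ k, |wordProd (fun z => ξ (z, k) ω) [] w| ^ p k ≤ K := by
  have hmeas : ∀ w, Measurable (vecWeight ξ p [] w) := fun w =>
    (measurable_vecWeight ξ p [] w).mono (sigmaOf_le H.measurable _) le_rfl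
  have hint : ∫⁻ ω, ∑' w, vecWeight ξ p [] w ω ∂P ≠ ⊤ := by
    rw [lintegral_tsum fun w => (hmeas w).aemeasurable]
    simp_rw [lintegral_vecWeight H]
    rw [← List.equivSigmaTuple.symm.tsum_eq, ENNReal.tsum_sigma']
    have : ∀ n : ℕ, ∑' u : Fin n → Fin N, vecMoment P ξ p
        (List.equivSigmaTuple.symm ⟨n, u⟩) = (∑ i, vecMoment P ξ p [i]) ^ n := by
      intro n
      rw [tsum_fintype, Fintype.sum_pow]
      exact Finset.sum_congr rfl fun u _ => vecMoment_ofFn ξ p u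
    simp_rw [this]
    rw [ENNReal.tsum_geometric, ENNReal.inv_ne_top, ← pos_iff_ne_zero]
    exact tsub_pos_of_lt hM
  filter_upwards [ae_lt_top (Measurable.tsum hmeas) hint] with ω hω
  refine ⟨(∑' w, vecWeight ξ p [] w ω).toReal, fun W => ?_⟩
  have hle : ENNReal.ofReal (∑ w ∈ W, ∏ k, |wordProd (fun z => ξ (z, k) ω) [] w| ^ p k) ≤
      ∑' w, vecWeight ξ p [] w ω := by
    rw [ENNReal.ofReal_sum_of_nonneg fun w _ => by positivity]
    refine le_trans (le_of_eq ?_) (ENNReal.sum_le_tsum W)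
    exact Finset.sum_congr rfl fun w _ => ENNReal.ofReal_prod_of_nonneg fun k _ => by positivity
  have h0 : 0 ≤ ∑ w ∈ W, ∏ k, |wordProd (fun z => ξ (z, k) ω) [] w| ^ p k := by positivity
  rw [← ENNReal.toReal_ofReal h0]
  exact ENNReal.toReal_mono hω.ne hle

lemma ae_exists_ballCoverNumber_le (hd : 1 ≤ d) {t : Fin N → EuclideanSpace ℝ (Fin d)}
    {B : Set (EuclideanSpace ℝ (Fin d))} {R : ℝ} (hR : 0 ≤ R) (hBR : ∀ x ∈ B, ∀ k, |x k| ≤ R)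
    {s : ℝ} (hs : 0 < s) (hsd : s ≤ d)
    (hM : ∀ σ : Equiv.Perm (Fin d),
      ∑ i, vecMoment P ξ (fun k => svfExponent d s (σ.symm k)) [i] < 1) :
    ∀ᵐ ω ∂P, (∀ w i, ∀ x ∈ B, (WithLp.toLp 2 fun k => ξ (w, k) ω i * x k +
        (1 - ξ (w, k) ω i) * t i k : EuclideanSpace ℝ (Fin d)) ∈ B) →
      ∃ K : ℝ, ∀ r : ℝ, 0 < r → r < 1 → (ballCoverNumber r (⋂ n : ℕ, ⋃ w : List (Fin N),
        ⋃ _ : w.length = n, cylinderMap t (fun k z => ξ (z, k) ω) w '' B) : ℝ) ≤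
          K * r ^ (-s) := by
  have k₀ : Fin d := ⟨0, hd⟩
  have ha := (H.coord k₀).pos
  have hall := ae_all_iff.mpr fun σ => ae_exists_sum_prod_rpow_le H (hM σ)
  filter_upwards [hall] with ω hω hinv
  choose K hK using hω
  refine ⟨(2 * d * R + 1) ^ d * a ^ (-s) * ∑ σ, K σ, fun r hr hr1 => ?_⟩
  obtain ⟨W, hW⟩ := exists_ballCoverNumber_le (e := fun k z => ξ (z, k) ω) hd hinv hR hBR ha
    (H.coord k₀).le (H.coord k₀).lt_one (fun k w i => (H.coord k).bound w ω i) hs hsd hr hr1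
  refine hW.trans ?_
  rw [Finset.sum_comm, Real.mul_rpow ha.le hr.le]
  have hsum : ∑ σ : Equiv.Perm (Fin d), ∑ w ∈ W,
      ∏ k, |wordProd (fun z => ξ (z, σ k) ω) [] w| ^ svfExponent d s k ≤ ∑ σ, K σ := by
    refine Finset.sum_le_sum fun σ _ => le_trans (le_of_eq ?_) (hK σ W)
    refine Finset.sum_congr rfl fun w _ => ?_
    rw [← Equiv.prod_comp σ fun k =>
      |wordProd (fun z => ξ (z, k) ω) [] w| ^ svfExponent d s (σ.symm k)]
    simp
  calc _ ≤ (2 * d * R + 1) ^ d * (a ^ (-s) * r ^ (-s)) * ∑ σ, K σ :=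
        mul_le_mul_of_nonneg_left hsum (by positivity)
    _ = _ := by ring

end UpperBound

lemma exists_ballCoverNumber_le_of_bounded {d : ℕ} {S : Set (EuclideanSpace ℝ (Fin d))} {R : ℝ}
    (hR : 0 ≤ R) (hS : ∀ x ∈ S, ∀ k, |x k| ≤ R) :
    ∃ K : ℝ, ∀ r : ℝ, 0 < r → r < 1 → (ballCoverNumber r S : ℝ) ≤ K * r ^ (-(d : ℝ)) := by
  refine ⟨(d * (2 * R) + 1) ^ d, fun r hr hr1 => ?_⟩
  obtain ⟨C, hC, hsub⟩ := exists_finset_cover_box hr (fun _ : Fin d => -R) (fun _ => 2 * R)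
  have h1 : ballCoverNumber r S ≤ C.card := ballCoverNumber_le hr.le C <| by
    refine Set.Subset.trans (fun x hx => ?_) hsub
    intro k
    have := abs_le.mp (hS x hx k)
    exact ⟨this.1, by linarith [this.2]⟩
  calc (ballCoverNumber r S : ℝ) ≤ C.card := by exact_mod_cast h1
    _ ≤ ((∏ _k : Fin d, (⌊d * (2 * R) / r⌋₊ + 1) : ℕ) : ℝ) := by exact_mod_cast hC
    _ = (⌊d * (2 * R) / r⌋₊ + 1 : ℝ) ^ d := by simp
    _ ≤ ((d * (2 * R) + 1) * r⁻¹) ^ d := by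
        gcongr
        have h2 := Nat.floor_le (show 0 ≤ d * (2 * R) / r by positivity)
        have h3 : 1 ≤ r⁻¹ := (one_le_inv₀ hr).mpr hr1.le
        rw [div_eq_mul_inv] at h2
        rw [add_mul, one_mul, div_eq_mul_inv]
        linarith
    _ = _ := by
        rw [mul_pow, Real.rpow_neg hr.le, Real.rpow_natCast, inv_pow]

/-- A lower bound for the Hausdorff dimension and matching covering bounds determine both
dimensions. -/
lemma dimH_eq_and_hasMinkowskiDim {d : ℕ} {S : Set (EuclideanSpace ℝ (Fin d))}
    (hS : Bornology.IsBounded S) (hne : S.Nonempty) {D : ℝ} (hD : 0 ≤ D)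
    (hlow : ENNReal.ofReal D ≤ dimH S)
    (hup : ∀ ε > 0, ∃ K : ℝ, ∀ r : ℝ, 0 < r → r < 1 →
      (ballCoverNumber r S : ℝ) ≤ K * r ^ (-(D + ε))) :
    dimH S = ENNReal.ofReal D ∧ HasMinkowskiDim S D := by
  have hev1 : ∀ᶠ r : ℝ in 𝓝[>] 0, r ∈ Set.Ioo (0 : ℝ) 1 := Ioo_mem_nhdsGT one_pos
  have hlog : Tendsto (fun r : ℝ => -Real.log r) (𝓝[>] 0) atTop :=
    tendsto_neg_atBot_atTop.comp Real.tendsto_log_nhdsGT_zero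
  refine ⟨le_antisymm ?_ hlow, hS, ?_⟩
  · have hε : ∀ ε > 0, dimH S ≤ ENNReal.ofReal (D + ε) := by
      intro ε hε
      obtain ⟨K, hK⟩ := hup ε hε
      refine dimH_le_of_frequently_ballCoverNumber_le hS (by linarith) (K := K) ?_
      exact (hev1.mono fun r hr => hK r hr.1 hr.2).frequently
    have ht : Tendsto (fun ε : ℝ => ENNReal.ofReal (D + ε)) (𝓝[>] 0) (𝓝 (ENNReal.ofReal D)) := by
      have : Tendsto (fun ε : ℝ => ENNReal.ofReal (D + ε)) (𝓝 0) (𝓝 (ENNReal.ofReal (D + 0))) :=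
        (ENNReal.continuous_ofReal.comp (continuous_const.add continuous_id)).tendsto 0
      rw [add_zero] at this
      exact this.mono_left nhdsWithin_le_nhds
    exact ge_of_tendsto ht (eventually_mem_nhdsWithin.mono fun ε h => hε ε h)
  · have hone : ∀ r : ℝ, 0 < r → (1 : ℝ) ≤ ballCoverNumber r S := fun r hr => by
      exact_mod_cast one_le_ballCoverNumber hr hS hne
    refine tendsto_order.mpr ⟨fun c hc => ?_, fun c hc => ?_⟩
    · rcases lt_or_ge c 0 with hc0 | hc0
      · filter_upwards [hev1] with r hr
        exact hc0.trans_le (div_nonneg (Real.log_nonneg (hone r hr.1))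
          (neg_nonneg.mpr (Real.log_nonpos hr.1.le hr.2.le)))
      · obtain ⟨τ, hcτ, hτD⟩ := exists_between hc
        have hτ : 0 ≤ τ := hc0.trans hcτ.le
        have hnot : ¬ ∃ᶠ r in 𝓝[>] (0 : ℝ), (ballCoverNumber r S : ℝ) ≤ 1 * r ^ (-τ) := by
          intro hfr
          have := hlow.trans (dimH_le_of_frequently_ballCoverNumber_le hS hτ hfr)
          rw [ENNReal.ofReal_le_ofReal_iff hτ] at this
          linarith
        filter_upwards [hev1, not_frequently.mp hnot] with r hr hr2
        rw [one_mul, not_le] at hr2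
        have hl : 0 < -Real.log r := neg_pos.mpr (Real.log_neg hr.1 hr.2)
        rw [lt_div_iff₀ hl]
        have h3 := Real.log_lt_log (Real.rpow_pos_of_pos hr.1 _) hr2
        rw [Real.log_rpow hr.1] at h3
        nlinarith
    · obtain ⟨K, hK⟩ := hup ((c - D) / 2) (by linarith)
      have hbig := hlog.eventually (eventually_gt_atTop (Real.log (max K 1) / ((c - D) / 2)))
      filter_upwards [hev1, hbig] with r hr hr2
      have hl : 0 < -Real.log r := neg_pos.mpr (Real.log_neg hr.1 hr.2)
      rw [div_lt_iff₀ hl]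
      rw [div_lt_iff₀ (by linarith)] at hr2
      have hK1 : 0 < max K 1 := lt_max_of_lt_right one_pos
      have hrp := Real.rpow_pos_of_pos hr.1 (-(D + (c - D) / 2))
      have h3 : Real.log (ballCoverNumber r S) ≤
          Real.log (max K 1 * r ^ (-(D + (c - D) / 2))) :=
        Real.log_le_log (by linarith [hone r hr.1])
          ((hK r hr.1 hr.2).trans (mul_le_mul_of_nonneg_right (le_max_left _ _) hrp.le))
      rw [Real.log_mul hK1.ne' hrp.ne', Real.log_rpow hr.1] at h3
      nlinarith

/-! ### The dimension for uniformly bounded ratios -/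

section Bounded

variable {N d : ℕ} {Ω : Type*} [MeasurableSpace Ω] {P : Measure Ω} {a b : ℝ}
  {α : List (Fin N) → Fin d → Ω → ℝ}

/-- Since the moments carry no permutation, `σ` is moved to the exponents. -/
lemma sum_vecMoment_svfExponent (hd : 1 ≤ d) (H : IsVecRatioField P a b (ratioField α))
    (hmeas : ∀ w : List (Fin N), w ≠ [] → ∀ k, Measurable (α w k))
    (hbd : ∀ w : List (Fin N), w ≠ [] → ∀ k ω, |α w k ω| ∈ Set.Icc a b)
    (σ : Equiv.Perm (Fin d)) {s : ℝ} (hs : 0 ≤ s) :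
    ∑ i, vecMoment P (ratioField α) (fun k => svfExponent d s (σ.symm k)) [i] =
      ENNReal.ofReal (∑ i, ∫ ω, permSVF σ s (fun k => α [i] k ω) ∂P) := by
  have k₀ : Fin d := ⟨0, hd⟩
  have := H.indep.isProbabilityMeasure
  simp_rw [integral_permSVF (P := P) hd (H.coord k₀).pos hbd σ hs]
  rw [ENNReal.ofReal_sum_of_nonneg fun i _ => integral_nonneg fun ω => by positivity]
  refine Finset.sum_congr rfl fun i _ => ?_
  rw [ofReal_integral_eq_lintegral_ofReal (integrable_prod_abs_rpow (H.coord k₀).lt_one hmeas hbd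
    (by simp) σ fun k => svfExponent_nonneg _ _ _) (ae_of_all _ fun ω => by positivity),
    ← lintegral_vecWeight H _ [] [i]]
  refine lintegral_congr fun ω => ?_
  rw [vecWeight_singleton, ← Equiv.prod_comp σ]
  simp [ratioField]

/-- The statement of the theorem for ratios that satisfy the bounds everywhere. -/
theorem exists_dimension_of_bounded [IsProbabilityMeasure P] (hd : 1 ≤ d) (hN : 2 ≤ N)
    {t : Fin N → EuclideanSpace ℝ (Fin d)} (ht : ∀ k : Fin d, ∃ i j : Fin N, t i k ≠ t j k)
    (ha : 0 < a) (hab : a ≤ b) (hb : b < 1)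
    (hmeas : ∀ w : List (Fin N), w ≠ [] → ∀ k, Measurable (α w k))
    (hindep : iIndepFun (ratioField α) P)
    (hident : ∀ k w w', IdentDistrib (ratioField α (w, k)) (ratioField α (w', k)) P P)
    (hbd : ∀ w : List (Fin N), w ≠ [] → ∀ k ω, |α w k ω| ∈ Set.Icc a b)
    (hsm : ∀ k : Fin d, ∃ l : Fin N,
      EventuallySmooth (P.map fun ω => Real.log |α [l] k ω|))
    {B : Set (EuclideanSpace ℝ (Fin d))} (hBc : IsCompact B) (hBne : B.Nonempty)
    (hB : ∀ᵐ ω ∂P, ∀ w : List (Fin N), Set.MapsTo (affMap t α ω w) B B) :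
    ∃ s₀ : ℝ, 0 ≤ s₀ ∧ maxExpectedSVF P α s₀ = 1 ∧
      (∀ s : ℝ, 0 ≤ s → maxExpectedSVF P α s = 1 → s = s₀) ∧
      (∀ᵐ ω ∂P, dimH (sponge t α B ω) = ENNReal.ofReal (min (d : ℝ) s₀) ∧
        HasMinkowskiDim (sponge t α B ω) (min (d : ℝ) s₀)) ∧
      ((d : ℝ) < s₀ → ∀ᵐ ω ∂P, 0 < volume (sponge t α B ω)) := by
  have hd0 : (0 : ℝ) < d := by exact_mod_cast hd
  have hb0 : 0 < b := ha.trans_le hab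
  have i₀ : Fin N := ⟨0, by omega⟩
  have H := isVecRatioField_ratioField ha hab hb hmeas hindep hident hbd
  obtain ⟨s₀, hs₀, hs₁, huniq⟩ := exists_unique_maxExpectedSVF_eq_one (P := P) hd
    (by omega : 1 ≤ N) ha hab hb hmeas hbd
  refine ⟨s₀, hs₀, hs₁, huniq, ?_⟩
  have hle : ∀ σ : Equiv.Perm (Fin d),
      ∑ i, vecMoment P (ratioField α) (fun k => svfExponent d s₀ (σ.symm k)) [i] ≤ 1 := by
    intro σ
    rw [sum_vecMoment_svfExponent hd H hmeas hbd σ hs₀, ← ENNReal.ofReal_one]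
    apply ENNReal.ofReal_le_ofReal
    rw [← hs₁]
    exact Finset.le_sup' (fun σ : Equiv.Perm (Fin d) =>
      ∑ i : Fin N, ∫ ω, permSVF σ s₀ (fun k => α [i] k ω) ∂P) (Finset.mem_univ σ)
  obtain ⟨σ, hσ⟩ : ∃ σ : Equiv.Perm (Fin d),
      ∑ i, vecMoment P (ratioField α) (fun k => svfExponent d s₀ (σ.symm k)) [i] = 1 := by
    obtain ⟨σ, -, hσ⟩ := Finset.exists_mem_eq_sup' Finset.univ_nonempty
      (fun σ : Equiv.Perm (Fin d) => ∑ i : Fin N, ∫ ω, permSVF σ s₀ (fun k => α [i] k ω) ∂P)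
    refine ⟨σ, ?_⟩
    rw [sum_vecMoment_svfExponent hd H hmeas hbd σ hs₀, ← ENNReal.ofReal_one, ← hs₁]
    congr 1
    exact hσ.symm
  have hspos : 0 < s₀ := by
    rcases hs₀.eq_or_lt with h | h
    · exfalso
      have hexp : ∀ k : ℕ, svfExponent d 0 k = 0 := by
        intro k
        simp [svfExponent]
      rw [← h] at hσ
      simp_rw [hexp] at hσ
      have hone : ∀ i : Fin N, vecMoment P (ratioField α) (fun _ => (0 : ℝ)) [i] = 1 := fun i => by
        simp [vecMoment, wordMoment]
      simp_rw [hone] at hσ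
      simp only [Finset.sum_const, Finset.card_univ, Fintype.card_fin, nsmul_eq_mul, mul_one] at hσ
      have : N = 1 := by exact_mod_cast hσ
      omega
    · exact h
  -- lowering the exponents raises the total moment above one
  have hgt : ∀ p : Fin d → ℝ, (∀ k, p k ≤ svfExponent d s₀ (σ.symm k)) → ∑ k, p k < s₀ →
      1 < ∑ i, vecMoment P (ratioField α) p [i] := by
    intro p hp hlt
    have h1 := sum_vecMoment_le_mul H hp
    rw [hσ, Finset.sum_sub_distrib, Equiv.sum_comp σ.symm (fun k : Fin d => svfExponent d s₀ k),
      sum_svfExponent hd hs₀] at h1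
    by_contra hcon
    push Not at hcon
    have h2 : b ^ (s₀ - ∑ k, p k) < 1 := Real.rpow_lt_one hb0.le hb (by linarith)
    have h3 : ENNReal.ofReal (b ^ (s₀ - ∑ k, p k)) < 1 := by
      rw [← ENNReal.ofReal_one]
      exact (ENNReal.ofReal_lt_ofReal_iff one_pos).mpr h2
    exact absurd (h1.trans (mul_le_of_le_one_right' hcon)) (not_le.mpr h3)
  have hlt : ∀ s, s₀ < s → ∀ τ : Equiv.Perm (Fin d),
      ∑ i, vecMoment P (ratioField α) (fun k => svfExponent d s (τ.symm k)) [i] < 1 := by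
    intro s hs τ
    refine (sum_vecMoment_le_mul H fun k => svfExponent_mono d hs.le (τ.symm k)).trans_lt ?_
    refine (mul_le_of_le_one_right' (hle τ)).trans_lt ?_
    rw [Finset.sum_sub_distrib, Equiv.sum_comp τ.symm (fun k : Fin d => svfExponent d s k),
      Equiv.sum_comp τ.symm (fun k : Fin d => svfExponent d s₀ k), sum_svfExponent hd hs₀,
      sum_svfExponent hd (hs₀.trans hs.le), ← ENNReal.ofReal_one]
    exact (ENNReal.ofReal_lt_ofReal_iff one_pos).mpr
      (Real.rpow_lt_one hb0.le hb (by linarith))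
  have hinv : ∀ᵐ ω ∂P, ∀ w i, ∀ x ∈ B, (WithLp.toLp 2 fun k => ratios α ω k w i * x k +
      (1 - ratios α ω k w i) * t i k : EuclideanSpace ℝ (Fin d)) ∈ B := by
    filter_upwards [hB] with ω hω w i x hx
    have h1 := hω (w ++ [i]) hx
    have h2 : affMap t α ω (w ++ [i]) x = WithLp.toLp 2 fun k => ratios α ω k w i * x k +
        (1 - ratios α ω k w i) * t i k := by
      ext k
      rw [affMap_append_apply]
    rwa [h2] at h1
  have hcomp : ∀ ω, IsCompact (sponge t α B ω) := fun ω => by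
    rw [sponge_eq]
    exact isCompact_iInter_cylinders hBc _
  have hmem : ∀ᵐ ω ∂P, ∀ w, cylinderMap t (fun k z => ratioField α (z, k) ω) w (t i₀) ∈
      sponge t α B ω := by
    filter_upwards [hinv] with ω hω w
    rw [sponge_eq]
    exact cylinderMap_fixedPoint_mem hω (fixedPoint_mem hω hBc hBne hb
      (fun k w i => hbd _ (by simp) k ω) i₀) w
  have hsm' : ∀ k : Fin d, ∃ l : Fin N,
      EventuallySmooth (P.map fun ω => Real.log |ratioField α ([], k) ω l|) := hsm
  refine ⟨?_, fun hds => ?_⟩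
  · obtain ⟨R, hR⟩ := hBc.isBounded.exists_norm_le
    have hBR : ∀ x ∈ B, ∀ k, |x k| ≤ max R 0 := fun x hx k =>
      (PiLp.norm_apply_le x k).trans ((hR x hx).trans (le_max_left _ _))
    have hlow : ∀ᵐ ω ∂P, ∀ m : ℕ,
        ENNReal.ofReal ((1 - 1 / (m + 1 : ℝ)) * min (d : ℝ) s₀) ≤ dimH (sponge t α B ω) := by
      rw [ae_all_iff]
      intro m
      have hm : (0 : ℝ) < 1 / (m + 1) := by positivity
      have hm1 : 1 / (m + 1 : ℝ) ≤ 1 := by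
        rw [div_le_one (by positivity)]
        linarith [(Nat.cast_nonneg m : (0 : ℝ) ≤ m)]
      set p : Fin d → ℝ := fun k =>
        (1 - 1 / (m + 1 : ℝ)) * max 0 (min (s₀ - (σ.symm k : ℕ)) 1) with hp
      have hsum : ∑ k, p k = (1 - 1 / (m + 1 : ℝ)) * min (d : ℝ) s₀ := by
        rw [hp, ← Finset.mul_sum,
          Equiv.sum_comp σ.symm (fun k : Fin d => max 0 (min (s₀ - (k : ℕ)) 1)), sum_clamp hs₀,
          min_comm]
      have hcl : ∀ k, max 0 (min (s₀ - (σ.symm k : ℕ)) 1) ≤ 1 := fun k =>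
        max_le zero_le_one (min_le_right _ _)
      have hcl0 : ∀ k, 0 ≤ max 0 (min (s₀ - (σ.symm k : ℕ)) 1) := fun k => le_max_left _ _
      have hmin : 0 < min (d : ℝ) s₀ := lt_min hd0 hspos
      have hae := ae_le_dimH H hd ht hsm' (p := p) (S := sponge t α B)
        (fun k => mul_nonneg (by linarith) (hcl0 k))
        (fun k => by have := hcl k; have := hcl0 k; simp only [hp]; nlinarith)
        (hgt p (fun k => by
          have h1 := hcl0 k
          have h2 : 0 ≤ max (s₀ / d - 1) 0 := le_max_right _ _
          simp only [hp, svfExponent]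
          nlinarith) (by
          rw [hsum]
          have := min_le_right (d : ℝ) s₀
          nlinarith)) i₀
      filter_upwards [hae, hmem] with ω hω hω2
      rw [← hsum]
      exact hω (hcomp ω) hω2
    have hup : ∀ᵐ ω ∂P, ∀ ε > 0, ∃ K : ℝ, ∀ r : ℝ, 0 < r → r < 1 →
        (ballCoverNumber r (sponge t α B ω) : ℝ) ≤ K * r ^ (-(min (d : ℝ) s₀ + ε)) := by
      -- a bound with a smaller exponent is stronger, as `r < 1`
      have hmono : ∀ (ω : Ω) (s s' : ℝ), s ≤ s' → (∃ K : ℝ, ∀ r : ℝ, 0 < r → r < 1 →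
          (ballCoverNumber r (sponge t α B ω) : ℝ) ≤ K * r ^ (-s)) →
          ∃ K : ℝ, ∀ r : ℝ, 0 < r → r < 1 →
            (ballCoverNumber r (sponge t α B ω) : ℝ) ≤ K * r ^ (-s') := by
        rintro ω s s' hss ⟨K, hK⟩
        refine ⟨max K 0, fun r hr hr1 => (hK r hr hr1).trans ?_⟩
        have := Real.rpow_pos_of_pos hr (-s)
        exact mul_le_mul (le_max_left _ _)
          (Real.rpow_le_rpow_of_exponent_ge hr hr1.le (by linarith)) this.le (le_max_right _ _)
      rcases le_or_gt (d : ℝ) s₀ with hds | hds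
      · refine ae_of_all _ fun ω ε hε => hmono ω d _ (by rw [min_eq_left hds]; linarith) ?_
        refine exists_ballCoverNumber_le_of_bounded (le_max_right R 0) fun x hx k => ?_
        have hxB : x ∈ B := by
          rw [sponge_eq] at hx
          have := Set.mem_iInter.mp hx 0
          simp only [Set.mem_iUnion, List.length_eq_zero_iff, exists_prop, exists_eq_left] at this
          obtain ⟨y, hy, hyx⟩ := this
          have : cylinderMap t (ratios α ω) [] y = y := by
            ext k; simp [cylinderMap, wordMap]
          rwa [← hyx, this]
        exact hBR x hxB k
      · have hseq : ∀ᵐ ω ∂P, ∀ m : ℕ, ∃ K : ℝ, ∀ r : ℝ, 0 < r → r < 1 →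
            (ballCoverNumber r (sponge t α B ω) : ℝ) ≤
              K * r ^ (-(s₀ + (d - s₀) * (1 / (m + 1 : ℝ)))) := by
          rw [ae_all_iff]
          intro m
          have hm : (0 : ℝ) < 1 / (m + 1) := by positivity
          have hm1 : 1 / (m + 1 : ℝ) ≤ 1 := by
            rw [div_le_one (by positivity)]
            linarith [(Nat.cast_nonneg m : (0 : ℝ) ≤ m)]
          have hpos : 0 < (d - s₀) * (1 / (m + 1 : ℝ)) := mul_pos (by linarith) hm
          filter_upwards [ae_exists_ballCoverNumber_le H hd (t := t) (le_max_right R 0) hBR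
            (s := s₀ + (d - s₀) * (1 / (m + 1 : ℝ))) (by linarith) (by nlinarith)
            (hlt _ (by linarith)), hinv] with ω hω hω2
          rw [sponge_eq]
          exact hω hω2
        filter_upwards [hseq] with ω hω ε hε
        obtain ⟨m, hm⟩ := exists_nat_one_div_lt (show 0 < ε / (d - s₀) from
          div_pos hε (by linarith))
        refine hmono ω _ _ ?_ (hω m)
        rw [lt_div_iff₀ (by linarith)] at hm
        rw [min_eq_right hds.le]
        linarith
    filter_upwards [hlow, hup, hmem] with ω h1 h2 h3
    refine dimH_eq_and_hasMinkowskiDim (hcomp ω).isBounded ⟨_, h3 []⟩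
      (le_min hd0.le hs₀) ?_ h2
    have htend : Tendsto (fun m : ℕ => ENNReal.ofReal ((1 - 1 / (m + 1 : ℝ)) * min (d : ℝ) s₀))
        atTop (𝓝 (ENNReal.ofReal ((1 - 0) * min (d : ℝ) s₀))) :=
      ENNReal.tendsto_ofReal
        ((tendsto_one_div_add_atTop_nhds_zero_nat.const_sub 1).mul_const _)
    rw [sub_zero, one_mul] at htend
    exact le_of_tendsto' htend h1
  · have hae := ae_volume_pos H hd ht hsm' (S := sponge t α B) (hgt (fun _ => 1) (fun k => by
      have hk : ((σ.symm k : ℕ) : ℝ) + 1 ≤ d := by exact_mod_cast (σ.symm k).isLt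
      rw [svfExponent, min_eq_right (by linarith), max_eq_right zero_le_one]
      linarith [le_max_right (s₀ / d - 1) 0]) (by simpa using hds)) i₀
    filter_upwards [hae, hmem] with ω hω hω2
    exact hω (hcomp ω) hω2

end Bounded

/-! ### Reduction to uniformly bounded ratios -/

section Reduction

variable {N d : ℕ} {Ω : Type*}

/-- The ratios, with the values of absolute value outside `[a, b]` replaced by `b`. -/
noncomputable def boundedRatio (a b x : ℝ) : ℝ :=
  if a ≤ |x| ∧ |x| ≤ b then x else b

lemma abs_boundedRatio_mem {a b : ℝ} (ha : 0 < a) (hab : a ≤ b) (x : ℝ) :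
    |boundedRatio a b x| ∈ Set.Icc a b := by
  unfold boundedRatio
  split_ifs with h
  · exact h
  · rw [abs_of_pos (ha.trans_le hab)]
    exact ⟨hab, le_rfl⟩

lemma measurable_boundedRatio (a b : ℝ) : Measurable (boundedRatio a b) :=
  Measurable.ite ((measurableSet_le (measurable_const (a := a)) measurable_abs).inter
    (measurableSet_le measurable_abs (measurable_const (a := b)))) measurable_id measurable_const

lemma affMap_congr (t : Fin N → EuclideanSpace ℝ (Fin d)) {α α' : List (Fin N) → Fin d → Ω → ℝ}
    {ω : Ω} (h : ∀ w ≠ [], ∀ k, α w k ω = α' w k ω) : affMap t α ω = affMap t α' ω := by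
  have : diagMatrix α ω = diagMatrix α' ω := by
    funext w
    unfold diagMatrix
    split_ifs with hw
    · rfl
    · congr 1
      exact funext (h w hw)
  funext w x
  rw [affMap, affMap, this]

lemma sponge_congr (t : Fin N → EuclideanSpace ℝ (Fin d)) (B : Set (EuclideanSpace ℝ (Fin d)))
    {α α' : List (Fin N) → Fin d → Ω → ℝ} {ω : Ω} (h : ∀ w ≠ [], ∀ k, α w k ω = α' w k ω) :
    sponge t α B ω = sponge t α' B ω := by
  have : ∀ w n, prefixComp t α ω w n = prefixComp t α' ω w n := by
    intro w n
    induction n with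
    | zero => rw [prefixComp, prefixComp, affMap_congr t h]
    | succ n ih => rw [prefixComp, prefixComp, ih, affMap_congr t h]
  simp_rw [sponge, this]

end Reduction

end RandomSponge

theorem theorem1p2
    {Ω : Type*} [MeasurableSpace Ω] (P : Measure Ω) [IsProbabilityMeasure P]
    (d N : ℕ) (hd : 1 ≤ d) (hN : 2 ≤ N)
    -- the fixed points
    (t : Fin N → EuclideanSpace ℝ (Fin d))
    (ht : ∀ k : Fin d, ∃ i j : Fin N, t i k ≠ t j k)
    -- the random contraction ratios, indexed by words (the value at the empty word plays no role)
    (a b : ℝ) (ha : 0 < a) (hab : a ≤ b) (hb : b < 1)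
    (α : List (Fin N) → Fin d → Ω → ℝ)
    (hmeas : ∀ w : List (Fin N), w ≠ [] → ∀ k : Fin d, Measurable (α w k))
    (hR1 : iIndepFun
      (fun (p : List (Fin N) × Fin d) (ω : Ω) (j : Fin N) => α (p.1 ++ [j]) p.2 ω) P)
    (hR2 : ∀ l : Fin d, ∀ w w' : List (Fin N),
      IdentDistrib (fun (ω : Ω) (j : Fin N) => α (w ++ [j]) l ω)
        (fun (ω : Ω) (j : Fin N) => α (w' ++ [j]) l ω) P P)
    (hR3 : ∀ w : List (Fin N), w ≠ [] → ∀ k : Fin d, ∀ᵐ ω ∂P, |α w k ω| ∈ Set.Icc a b)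
    (hR4 : ∀ k : Fin d, ∃ l : Fin N,
      RandomSponge.EventuallySmooth (P.map (fun ω => Real.log |α [l] k ω|)))
    -- the compact set from which the sponge is generated
    (B : Set (EuclideanSpace ℝ (Fin d))) (hBc : IsCompact B) (hBne : B.Nonempty)
    (hB : ∀ᵐ ω ∂P, ∀ w : List (Fin N), Set.MapsTo (RandomSponge.affMap t α ω w) B B) :
    ∃ s₀ : ℝ, 0 ≤ s₀ ∧ RandomSponge.maxExpectedSVF P α s₀ = 1 ∧
      (∀ s : ℝ, 0 ≤ s → RandomSponge.maxExpectedSVF P α s = 1 → s = s₀) ∧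
      (∀ᵐ ω ∂P,
        dimH (RandomSponge.sponge t α B ω) = ENNReal.ofReal (min (d : ℝ) s₀) ∧
        RandomSponge.HasMinkowskiDim (RandomSponge.sponge t α B ω) (min (d : ℝ) s₀)) ∧
      ((d : ℝ) < s₀ → ∀ᵐ ω ∂P, 0 < volume (RandomSponge.sponge t α B ω)) := by
  have heq : ∀ᵐ ω ∂P, ∀ w ≠ [], ∀ k,
      RandomSponge.boundedRatio a b (α w k ω) = α w k ω := by
    refine ae_all_iff.mpr fun w => ?_
    by_cases hw : w = []
    · exact ae_of_all _ fun ω h => absurd hw h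
    · filter_upwards [ae_all_iff.mpr (hR3 w hw)] with ω hω _ k
      exact if_pos (hω k)
  have hm : Measurable fun (v : Fin N → ℝ) j => RandomSponge.boundedRatio a b (v j) :=
    measurable_pi_lambda _ fun j =>
      (RandomSponge.measurable_boundedRatio a b).comp (measurable_pi_apply j)
  obtain ⟨s₀, h0, h1, h2, h3, h4⟩ := RandomSponge.exists_dimension_of_bounded (P := P)
    (α := fun w k ω => RandomSponge.boundedRatio a b (α w k ω)) hd hN ht ha hab hb
    (fun w hw k => (RandomSponge.measurable_boundedRatio a b).comp (hmeas w hw k))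
    (hR1.comp (fun _ v j => RandomSponge.boundedRatio a b (v j)) fun _ => hm)
    (fun k w w' => (hR2 k w w').comp hm)
    (fun w _ k ω => RandomSponge.abs_boundedRatio_mem ha hab _)
    (fun k => by
      obtain ⟨l, hl⟩ := hR4 k
      refine ⟨l, ?_⟩
      convert hl using 1
      refine Measure.map_congr ?_
      filter_upwards [heq] with ω hω
      rw [hω [l] (by simp) k])
    hBc hBne (by
      filter_upwards [hB, heq] with ω hω hω2
      rwa [RandomSponge.affMap_congr t hω2])
  have hmax : RandomSponge.maxExpectedSVF P
      (fun w k ω => RandomSponge.boundedRatio a b (α w k ω)) =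
      RandomSponge.maxExpectedSVF P α := by
    funext s
    unfold RandomSponge.maxExpectedSVF
    congr 1
    funext σ
    refine Finset.sum_congr rfl fun i _ => integral_congr_ae ?_
    filter_upwards [heq] with ω hω
    congr 1
    exact funext fun k => hω [i] (by simp) k
  rw [hmax] at h1 h2
  refine ⟨s₀, h0, h1, h2, ?_, fun hds => ?_⟩
  · filter_upwards [h3, heq] with ω hω hω2
    rwa [RandomSponge.sponge_congr t B hω2] at hω
  · filter_upwards [h4 hds, heq] with ω hω hω2
    rwa [RandomSponge.sponge_congr t B hω2] at hω
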